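/- **Conventions.** $\lambda\in\mathbb N$ is the security parameter; all objects depend on it. Finite sets are sets of bit strings whose length is a polynomial-time computable function of $\lambda$; membership in the sets $\mathcal X,\mathcal X',\mathcal B',\mathcal Y$ below is decidable in polynomial time. A poly-time (PPT, QPT) algorithm is a family of Boolean circuits (Boolean circuits with uniformly random auxiliary input bits; quantum circuits over NOT, CNOT, Toffoli, Hadamard and $T$ gates, with work qubits initialised to $|0\rangle$ and a final measurement), one for each $\lambda$, that is printed by a single deterministic machine in time polynomial in $\lambda$ on input $1^\lambda$. $\mathrm{negl}$ is a function that is $o(\lambda^{-c})$ for every $c$; where a bound is required for all keys $k$ (and bits $b$, elements $x$), one negligible function serves all of them. $\mathcal D_{\mathcal Y}$ is the set of probability distributions on $\mathcal Y$, and $H^2(p,q)=1-\sum_y\sqrt{p(y)q(y)}$. Two key distributions are computationally indistinguishable if every PPT algorithm outputs $0$ on them with probabilities that differ by $\mathrm{negl}(\lambda)$. **e³NTCF tuples.** Let $\emptyset\ne\mathcal X\subseteq\mathcal X'$, $\{0,1\}\subseteq\mathcal B'$ and $\mathcal Y$ be finite sets, let $\mathrm{CHK}$ be a deterministic poly-time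 algorithm, and let $\mathrm{SAMP}$ be a QPT procedure given by a quantum circuit without measurement. We say that $\mathrm{SAMP}$ *prepares* $p_{k,b}:\mathcal X\to\mathcal D_{\mathcal Y}$ on a set $\mathcal K$ of keys if for all $k\in\mathcal K$ and $b\in\{0,1\}$ it maps $|k\rangle|b\rangle|0\cdots0\rangle$ to $|k\rangle|b\rangle\otimes|\mathcal X|^{-1/2}\sum_{x\in\mathcal X,y\in\mathcal Y}\sqrt{p_{k,b}(x)(y)}\,|x\rangle|y\rangle\otimes|0\cdots0\rangle$ up to an error of negligible norm. An e³NTCF tuple $(\mathcal F,\mathcal G,\mathcal H)$ with injective-pair parameter $c_{\mathcal F}\in[0,1]$ consists of the following, with the same $\mathrm{CHK}$ and $\mathrm{SAMP}$ throughout. *$\mathcal F$ is a noisy trapdoor claw-free family with an adaptive hardcore bit:* functions $f_{k,b},f'_{k,b}:\mathcal X\to\mathcal D_{\mathcal Y}$ for $k\in\mathcal K_{\mathcal F}$, $b\in\{0,1\}$; a PPT algorithm $\mathrm{GEN}_{\mathcal F}$ that outputs a key $k\in\mathcal K_{\mathcal F}$ and a trapdoor $t_k$; a set $\mathcal I_{\mathcal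 F}$ of good pairs with $\Pr[(k,t_k)\notin\mathcal I_{\mathcal F}]=\mathrm{negl}(\lambda)$; subsets $\mathcal X_0,\mathcal X_1\subseteq\mathcal X$; and a deterministic poly-time algorithm $\mathrm{INV}_{\mathcal F}$. Let $\mathcal R_k=\{(x_0,x_1)\in\mathcal X^2: f_{k,0}(x_0)=f_{k,1}(x_1)\}$. 1. For all good $(k,t_k)$, all $b$ and all $x\in\mathcal X$: $\mathrm{INV}_{\mathcal F}(t_k,b,y)=x$ for all $y\in\mathrm{supp} f_{k,b}(x)$ and all $y\in\mathrm{supp} f'_{k,b}(x)$. If moreover $(x_0,x_1)\in\mathcal R_k$ and $y\in\mathrm{supp}f'_{k,b}(x_b)$, then $\mathrm{INV}_{\mathcal F}(t_k,b\oplus1,y)=x_{b\oplus1}$. 2. For all good $(k,t_k)$: each $x\in\mathcal X_0$ has exactly one $x'$ with $(x,x')\in\mathcal R_k$, each $x\in\mathcal X_1$ has exactly one $x'$ with $(x',x)\in\mathcal R_k$, and membership of a pair from $\mathcal X^2$ in $\mathcal R_k$ is decidable in polynomial time from $k,t_k$. There is $\lambda_0$ such that for all $\lambda>\lambda_0$: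 $|\mathcal X_0\cap\mathcal X_1|/|\mathcal X|\ge c_{\mathcal F}$, and for all good $(k,t_k)$ and $(x_0,x_1)\in\mathcal R_k$, $x_b\in\mathcal X_0\cap\mathcal X_1$ implies $x_{b\oplus1}\in\mathcal X_{b\oplus1}$. 3. For $k\in\mathcal K_{\mathcal F}$, $b\in\{0,1\}$, $x\in\mathcal X$, $y\in\mathcal Y$: $\mathrm{CHK}(k,y,b,x)=1$ if and only if $y\in\mathrm{supp}f'_{k,b}(x)$. For all $k\in\mathcal K_{\mathcal F}$ and $b$, $\mathbb E_{x\in\mathcal X}H^2(f_{k,b}(x),f'_{k,b}(x))=\mathrm{negl}(\lambda)$, and $\mathrm{SAMP}$ prepares $f'_{k,b}$ on $\mathcal K_{\mathcal F}$. 4. There are $w$ (a polynomial-time computable length), sets $G_{k,b,x}\subseteq\{0,1\}^w$ with $\Pr_{d}[d\notin G_{k,b,x}]=\mathrm{negl}(\lambda)$ for uniform $d\in\{0,1\}^w$ and all $k\in\mathcal K_{\mathcal F}$, $b$, $x\in\mathcal X$, with membership decidable in polynomial time given also $t_k$, and an injection $J:\mathcal X\to\{0,1\}^w$, computable and invertible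 on its range in polynomial time, such that with $H_k=\{(b,x_b,d,d\cdot(J(x_0)\oplus J(x_1))): b\in\{0,1\},(x_0,x_1)\in\mathcal R_k,x_b\in\mathcal X_b,d\in G_{k,0,x_0}\cap G_{k,1,x_1}\}$ and $\overline H_k=\{(b,x,d,c):(b,x,d,c\oplus1)\in H_k\}$, every PPT $\mathcal A$ satisfies $|\Pr[\mathcal A(k)\in H_k]-\Pr[\mathcal A(k)\in\overline H_k]|=\mathrm{negl}(\lambda)$ for $(k,t_k)\leftarrow\mathrm{GEN}_{\mathcal F}$. *$\mathcal G$ is a trapdoor injective family:* functions $g_{k,b}:\mathcal X'\to\mathcal D_{\mathcal Y}$ for $k\in\mathcal K_{\mathcal G}$, $b\in\mathcal B'$; a PPT algorithm $\mathrm{GEN}_{\mathcal G}$ that outputs a key $k\in\mathcal K_{\mathcal G}$ and a trapdoor; a set of good pairs, missed with probability $\mathrm{negl}(\lambda)$; and a deterministic poly-time $\mathrm{INV}_{\mathcal G}$ with output in $\{0,1\}\times\mathcal X$. For good pairs the supports of $g_{k,b}(x)$, $(b,x)\in\mathcal B'\times\mathcal X'$, are pairwise disjoint and $\mathrm{INV}_{\mathcal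 G}(t_k,y)=(b,x)$ for $(b,x)\in\{0,1\}\times\mathcal X$, $y\in\mathrm{supp}g_{k,b}(x)$. For $k\in\mathcal K_{\mathcal G}$, $(b,x)\in\mathcal B'\times\mathcal X'$, $y\in\mathcal Y$: $\mathrm{CHK}(k,y,b,x)=1$ iff $y\in\mathrm{supp}g_{k,b}(x)$; and $\mathrm{SAMP}$ prepares $g_{k,b}$ (restricted to $\mathcal X$) on $\mathcal K_{\mathcal G}$. The keys of $\mathrm{GEN}_{\mathcal F}$ and $\mathrm{GEN}_{\mathcal G}$ are computationally indistinguishable. *$\mathcal H$ is a weak extension of $\mathcal F$ with the weak extractability property:* functions $h_{k,b}:\mathcal X'\to\mathcal D_{\mathcal Y}$ for $k\in\mathcal K_{\mathcal H}$, $b\in\mathcal B'$, and a PPT algorithm $\mathrm{GEN}_{\mathcal H}$ that outputs a key $k\in\mathcal K_{\mathcal H}$ and a trapdoor, with the same $\mathrm{CHK}$ and $\mathrm{SAMP}$ conditions as for $\mathcal G$ and with keys computationally indistinguishable from those of $\mathrm{GEN}_{\mathcal F}$. There is a deterministic poly-time $\mathrm{IMCHK}_{\mathcal H}$ such that $\mathrm{IMCHK}_{\mathcal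 H}(t_k,y)=1$ whenever $(k,t_k)$ is an output of $\mathrm{GEN}_{\mathcal H}$ and $y\in\mathrm{supp}h_{k,b}(x)$ for some $(b,x)\in\mathcal B'\times\mathcal X'$; and for every PPT $\mathcal A$ with input $k$, coins $r$ and output $y$ there is a deterministic poly-time $\mathcal A^*$ with $\mathcal A^*(k,r)=(b,x)\in\mathcal B'\times\mathcal X'$ such that $\Pr[y\in\mathcal Y\wedge\mathrm{CHK}(k,y,b,x)=0\wedge\mathrm{IMCHK}_{\mathcal H}(t_k,y)=1]=\mathrm{negl}(\lambda)$ over $(k,t_k)\leftarrow\mathrm{GEN}_{\mathcal H}$ and $r$. **Protocol.** The verifier picks one of three tests uniformly at random, samples $(k,t_k)$ from $\mathrm{GEN}_{\mathcal F}$ (equation test), $\mathrm{GEN}_{\mathcal H}$ (weak image test) or $\mathrm{GEN}_{\mathcal G}$ (strong image test), sends $k$, and receives $(y,d,c)$, where $d\in\{0,1\}^w$ and $c\in\{0,1\}$. It rejects if $y\notin\mathcal Y$. Otherwise it accepts in the - *equation test* iff, with $x_b=\mathrm{INV}_{\mathcal F}(t_k,b,y)$: $\mathrm{CHK}(k,y,0,x_0)=\mathrm{CHK}(k,y,1,x_1)=1$,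 $(x_0,x_1)\in\mathcal R_k$, $x_0\in\mathcal X_0$, $x_1\in\mathcal X_1$, $d\in G_{k,0,x_0}\cap G_{k,1,x_1}$ and $(J(x_0)\oplus J(x_1))\cdot d=c$; - *weak image test* iff $\mathrm{IMCHK}_{\mathcal H}(t_k,y)=1$; - *strong image test* iff $\mathrm{CHK}(k,y,b,x)=1$ for $(b,x)=\mathrm{INV}_{\mathcal G}(t_k,y)$. **Theorem.** Let $(\mathcal F,\mathcal G,\mathcal H)$ be an e³NTCF tuple with injective-pair parameter $c_{\mathcal F}$. 1. (Completeness) There is a QPT prover that succeeds in the protocol with probability at least $\frac{2+c_{\mathcal F}}3-\mathrm{negl}(\lambda)$. 2. (Soundness) Every PPT prover succeeds in the protocol with probability at most $\frac56+\mathrm{negl}(\lambda)$. -/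

import Mathlib

open scoped BigOperators

noncomputable section

namespace PoQ

/-! ## Strings, coin averages, negligible functions -/

/-- Bit strings of length `m`. -/
abbrev Str (m : ℕ) : Type := Fin m → Bool

/-- Expectation over a uniformly random string of `m` bits. -/
def avg {m : ℕ} (φ : Str m → ℝ) : ℝ := (∑ r, φ r) / 2 ^ m

open Classical in
/-- The number `1` if `E` holds and `0` otherwise. -/
def ind (E : Prop) : ℝ := if E then 1 else 0

/-- `f` is negligible: it decays faster than every inverse power of the security parameter. -/
def Negl (f : ℕ → ℝ) : Prop :=
  Asymptotics.SuperpolynomialDecay Filter.atTop (fun n : ℕ => (n : ℝ)) f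

/-- Inner product of bit strings modulo `2`. -/
def dot {m : ℕ} (d v : Str m) : Bool :=
  decide (Odd (Finset.univ.filter (fun i => (d i && v i) = true)).card)

/-- Bitwise exclusive or. -/
def xorStr {m : ℕ} (u v : Str m) : Str m := fun i => xor (u i) (v i)

/-- The bit `b`, padded with zeros to a string of length `m`. -/
def bitStr {m : ℕ} (b : Bool) : Str m := fun i => b && decide ((i : ℕ) = 0)

/-! ## Polynomial time: a multi-stack machine with a step count

A machine has finitely many stacks of bits and a finite control, the latter written as a
structured program.  Two stacks make up one Turing tape, so this is the multi-tape Turing machine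
up to a constant factor in the running time. -/

/-- Programs over stacks of bits indexed by natural numbers. -/
inductive Prog : Type
  | skip : Prog
  | push (r : ℕ) (b : Bool) : Prog
  | pop (r : ℕ) : Prog
  | seq (p q : Prog) : Prog
  /-- Branch on stack `r`: empty, top bit `false`, or top bit `true`. -/
  | branch (r : ℕ) (pEmpty pFalse pTrue : Prog) : Prog
  /-- Repeat `p` as long as stack `r` is not empty. -/
  | loop (r : ℕ) (p : Prog) : Prog

/-- Contents of the stacks; the head of a list is the top of the stack. -/
abbrev Store : Type := ℕ → List Bool

/-- `Exec p s s' t`: started on the store `s`, the program `p` halts on `s'` after `t` steps. -/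
inductive Exec : Prog → Store → Store → ℕ → Prop
  | skip (s : Store) : Exec Prog.skip s s 1
  | push (s : Store) (r : ℕ) (b : Bool) :
      Exec (Prog.push r b) s (Function.update s r (b :: s r)) 1
  | pop (s : Store) (r : ℕ) :
      Exec (Prog.pop r) s (Function.update s r (s r).tail) 1
  | seq {p q : Prog} {s s₁ s₂ : Store} {t₁ t₂ : ℕ} :
      Exec p s s₁ t₁ → Exec q s₁ s₂ t₂ → Exec (Prog.seq p q) s s₂ (t₁ + t₂ + 1)
  | branchEmpty {r : ℕ} {p₀ p₁ p₂ : Prog} {s s₁ : Store} {t : ℕ} :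
      s r = [] → Exec p₀ s s₁ t → Exec (Prog.branch r p₀ p₁ p₂) s s₁ (t + 1)
  | branchFalse {r : ℕ} {p₀ p₁ p₂ : Prog} {s s₁ : Store} {t : ℕ} :
      (s r).head? = some false → Exec p₁ s s₁ t → Exec (Prog.branch r p₀ p₁ p₂) s s₁ (t + 1)
  | branchTrue {r : ℕ} {p₀ p₁ p₂ : Prog} {s s₁ : Store} {t : ℕ} :
      (s r).head? = some true → Exec p₂ s s₁ t → Exec (Prog.branch r p₀ p₁ p₂) s s₁ (t + 1)
  | loopDone {r : ℕ} {p : Prog} {s : Store} :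
      s r = [] → Exec (Prog.loop r p) s s 1
  | loopStep {r : ℕ} {p : Prog} {s s₁ s₂ : Store} {t₁ t₂ : ℕ} :
      s r ≠ [] → Exec p s s₁ t₁ → Exec (Prog.loop r p) s₁ s₂ t₂ →
        Exec (Prog.loop r p) s s₂ (t₁ + t₂ + 1)

/-- The store that holds the security parameter `n` in unary on stack `0` and nothing else. -/
def initStore (n : ℕ) : Store := fun r => if r = 0 then List.replicate n true else []

/-- A family of strings that one machine prints on stack `1`, on input `1ⁿ`, in a number of steps
that is polynomial in `n`. -/
def PolyTime (F : ℕ → List Bool) : Prop :=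
  ∃ (p : Prog) (T : Polynomial ℕ), ∀ n, ∃ (s : Store) (t : ℕ),
    Exec p (initStore n) s t ∧ s 1 = F n ∧ t ≤ T.eval n

/-- The natural number `m` in unary, with an end marker. -/
def encNat (m : ℕ) : List Bool := List.replicate m true ++ [false]

/-! ## Circuits

Wires are indexed by natural numbers.  A circuit works in place on its wires; the input stands on
the first wires, all other wires are work wires that start in `0`. -/

/-- Classical gates: the last wire named is the target. -/
inductive CGate : Type
  | not (k : ℕ) : CGate
  | cnot (i k : ℕ) : CGate
  | toffoli (i j k : ℕ) : CGate

/-- Quantum gates: the classical gates, the Hadamard gate, and the gate `T = diag(1, exp(iπ/4))`. -/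
inductive QGate : Type
  | classical (g : CGate) : QGate
  | hadamard (k : ℕ) : QGate
  | tGate (k : ℕ) : QGate

/-- Printed form of a classical gate. -/
def CGate.code : CGate → List Bool
  | .not k => encNat 0 ++ encNat k
  | .cnot i k => encNat 1 ++ encNat i ++ encNat k
  | .toffoli i j k => encNat 2 ++ encNat i ++ encNat j ++ encNat k

/-- Printed form of a quantum gate. -/
def QGate.code : QGate → List Bool
  | .classical g => g.code
  | .hadamard k => encNat 3 ++ encNat k
  | .tGate k => encNat 4 ++ encNat k

/-- Values of all wires. -/
abbrev Wires : Type := ℕ → Bool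

/-- Action of a classical gate.  A gate whose target is also one of its controls does nothing. -/
def CGate.act : CGate → Wires → Wires
  | .not k, s => Function.update s k (!(s k))
  | .cnot i k, s => if i = k then s else Function.update s k (xor (s k) (s i))
  | .toffoli i j k, s =>
      if i = k ∨ j = k then s else Function.update s k (xor (s k) (s i && s j))

/-- Quantum states: finite superpositions of computational basis states. -/
abbrev QState : Type := Wires →₀ ℂ

/-- Action of a quantum gate on a computational basis state. -/
def QGate.onBasis : QGate → Wires → QState
  | .classical g, s => Finsupp.single (g.act s) 1
  | .hadamard k, s =>
      Finsupp.single (Function.update s k false) (1 / (Real.sqrt 2 : ℂ)) +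
      Finsupp.single (Function.update s k true)
        ((if s k then -1 else 1) / (Real.sqrt 2 : ℂ))
  | .tGate k, s =>
      Finsupp.single s (if s k then Complex.exp (Complex.I * (Real.pi / 4 : ℝ)) else 1)

/-- Action of a quantum gate on states, by linear extension. -/
def QGate.act (g : QGate) : QState →ₗ[ℂ] QState := Finsupp.linearCombination ℂ g.onBasis

/-- Squared norm of a state. -/
def sqNorm (ψ : QState) : ℝ := ψ.sum fun _ a => ‖a‖ ^ 2

/-- Probability that a measurement of all wires in the computational basis yields values in `E`. -/
def measureProb (ψ : QState) (E : Wires → Prop) : ℝ := ψ.sum fun s a => ind (E s) * ‖a‖ ^ 2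

/-- The wires loaded with the input `l`. -/
def load (l : List Bool) : Wires := fun i => l.getD i false

/-- The string on the `m` wires that start at wire `o`. -/
def readStr (s : Wires) (o m : ℕ) : Str m := fun i => s (o + i)

/-! ## Efficient algorithms: uniform circuit families -/

/-- A length that is computable in polynomial time (in unary), hence polynomially bounded. -/
structure PolyLen where
  len : ℕ → ℕ
  poly : PolyTime fun n => List.replicate (len n) true

/-- A deterministic polynomial-time algorithm: a family of Boolean circuits, one for each value of
the security parameter, printed in polynomial time. -/
structure Alg where
  circ : ℕ → List CGate
  poly : PolyTime fun n => (circ n).flatMap CGate.code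

/-- The values of all wires at the end of the computation. -/
def Alg.run (A : Alg) (n : ℕ) (input : List Bool) : Wires :=
  (A.circ n).foldl (fun s g => g.act s) (load input)

/-- The output of an algorithm with a one-bit output. -/
def Alg.bit (A : Alg) (n : ℕ) (input : List Bool) : Bool := A.run n input 0

/-- A PPT algorithm: a deterministic polynomial-time algorithm that is given a polynomial number of
uniformly random bits after its input. -/
structure PPT where
  alg : Alg
  coins : PolyLen

/-- The values of all wires at the end of the computation with random coins `r`. -/
def PPT.run (A : PPT) (n : ℕ) (input : List Bool) (r : Str (A.coins.len n)) : Wires :=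
  A.alg.run n (input ++ List.ofFn r)

/-- Probability, over the coins of `A`, that the output satisfies `E`. -/
def PPT.prob (A : PPT) (n : ℕ) (input : List Bool) (E : Wires → Prop) : ℝ :=
  avg fun r => ind (E (A.run n input r))

/-- A QPT algorithm: a family of quantum circuits printed in polynomial time. -/
structure QPT where
  circ : ℕ → List QGate
  poly : PolyTime fun n => (circ n).flatMap QGate.code

/-- The final state of a quantum circuit on a classical input. -/
def QPT.run (A : QPT) (n : ℕ) (input : List Bool) : QState :=
  (A.circ n).foldl (fun ψ g => g.act ψ) (Finsupp.single (load input) 1)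

/-- A family of finite sets of bit strings with membership decidable in polynomial time. -/
structure EffSet (ℓ : PolyLen) where
  set : ∀ n, Finset (Str (ℓ.len n))
  decidable : ∃ A : Alg, ∀ n x, A.bit n (List.ofFn x) = true ↔ x ∈ set n

/-- A PPT key generation algorithm, with output a key and then a trapdoor. -/
structure KeyGen (κ : PolyLen) where
  trapLen : PolyLen
  alg : PPT

namespace KeyGen

variable {κ : PolyLen} (g : KeyGen κ)

/-- The key generated with coins `r`. -/
def key (n : ℕ) (r : Str (g.alg.coins.len n)) : Str (κ.len n) :=
  readStr (g.alg.run n [] r) 0 (κ.len n)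

/-- The trapdoor generated with coins `r`. -/
def trap (n : ℕ) (r : Str (g.alg.coins.len n)) : Str (g.trapLen.len n) :=
  readStr (g.alg.run n [] r) (κ.len n) (g.trapLen.len n)

/-- Expectation over a freshly generated pair of key and trapdoor. -/
def mean (n : ℕ) (φ : Str (κ.len n) → Str (g.trapLen.len n) → ℝ) : ℝ :=
  avg fun r => φ (g.key n r) (g.trap n r)

end KeyGen

/-- Computational indistinguishability of the marginal distributions of the keys. -/
def KeysIndist {κ : PolyLen} (g₁ g₂ : KeyGen κ) : Prop :=
  ∀ D : PPT, Negl fun n =>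
    |g₁.mean n (fun k _ => D.prob n (List.ofFn k) (fun s => s 0 = false)) -
     g₂.mean n (fun k _ => D.prob n (List.ofFn k) (fun s => s 0 = false))|

/-- Squared Hellinger distance `1 - ∑ √(p y · q y)`. -/
def hellingerSq {m : ℕ} (p q : PMF (Str m)) : ℝ :=
  1 - ∑ y, Real.sqrt ((p y).toReal * (q y).toReal)

/-! ## The function families -/

/-- The objects that the three function families have in common: key space, domain `X`, range `Y`,
the extended domain `XExt` and the extended set `BExt` of branches, which contains the bits, and the
check and state preparation algorithms. -/
structure Setup where
  keyLen : PolyLen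
  ranLen : PolyLen
  branchLen : PolyLen
  domLen : PolyLen
  branchLen_pos : ∀ n, 0 < branchLen.len n
  X : EffSet domLen
  X_nonempty : ∀ n, (X.set n).Nonempty
  XExt : EffSet domLen
  X_subset : ∀ n, X.set n ⊆ XExt.set n
  BExt : EffSet branchLen
  bit_mem : ∀ n b, bitStr b ∈ BExt.set n
  Y : EffSet ranLen
  chk : Alg
  samp : QPT

namespace Setup

variable (S : Setup)

abbrev Key (n : ℕ) : Type := Str (S.keyLen.len n)
abbrev Dom (n : ℕ) : Type := Str (S.domLen.len n)
abbrev Ran (n : ℕ) : Type := Str (S.ranLen.len n)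
abbrev Branch (n : ℕ) : Type := Str (S.branchLen.len n)

/-- The output of the check algorithm on key `k`, image `y`, branch `b` and preimage `x`. -/
def check (n : ℕ) (k : S.Key n) (y : S.Ran n) (b : S.Branch n) (x : S.Dom n) : Bool :=
  S.chk.bit n (List.ofFn k ++ List.ofFn y ++ List.ofFn b ++ List.ofFn x)

/-- The state `|k⟩|b⟩ ⊗ |X|^{-1/2} ∑_{x ∈ X, y} √(p x y) |x⟩|y⟩`, with all other wires `0`. -/
def target (n : ℕ) (k : S.Key n) (b : Bool) (p : S.Dom n → PMF (S.Ran n)) : QState :=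
  ∑ x ∈ S.X.set n, ∑ y : S.Ran n,
    Finsupp.single (load (List.ofFn k ++ [b] ++ List.ofFn x ++ List.ofFn y))
      ((Real.sqrt ((p x y).toReal / (S.X.set n).card) : ℝ) : ℂ)

/-- On keys in `K` and bits `b`, the state preparation circuit prepares the superposition over the
graph of `p`, up to a negligible error in norm, and returns all its work wires to `0`. -/
def Prepares (K : ∀ n, Set (S.Key n))
    (p : ∀ n, S.Key n → Bool → S.Dom n → PMF (S.Ran n)) : Prop :=
  ∃ ν : ℕ → ℝ, Negl ν ∧ ∀ n, ∀ k ∈ K n, ∀ b,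
    sqNorm (S.samp.run n (List.ofFn k ++ [b]) - S.target n k b (p n k b)) ≤ ν n

/-- The check algorithm decides, for keys in `K`, branches in `B` and preimages in `D`, whether `y`
lies in the support of `p k b x`. -/
def ChecksSupport (K : ∀ n, Set (S.Key n)) (B : ∀ n, Finset (S.Branch n))
    (D : ∀ n, Finset (S.Dom n))
    (p : ∀ n, S.Key n → S.Branch n → S.Dom n → PMF (S.Ran n)) : Prop :=
  ∀ n, ∀ k ∈ K n, ∀ b ∈ B n, ∀ x ∈ D n, ∀ y ∈ S.Y.set n,
    (S.check n k y b x = true ↔ y ∈ (p n k b x).support)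

/-- The relation `R_k` of all pairs `(x₀, x₁)` in the domain with `f_{k,0}(x₀) = f_{k,1}(x₁)`. -/
def claws (f : ∀ n, S.Key n → Bool → S.Dom n → PMF (S.Ran n)) (n : ℕ) (k : S.Key n) :
    Set (S.Dom n × S.Dom n) :=
  {p | p.1 ∈ S.X.set n ∧ p.2 ∈ S.X.set n ∧ f n k false p.1 = f n k true p.2}

/-- The output of an inversion algorithm that is given a trapdoor, a bit and an image. -/
def invert (inv : Alg) {n τ : ℕ} (t : Str τ) (b : Bool) (y : S.Ran n) : S.Dom n :=
  readStr (inv.run n (List.ofFn t ++ [b] ++ List.ofFn y)) 0 (S.domLen.len n)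

/-- The output of the algorithm `J`, a string of length `m`, on the domain element `x`. -/
def applyJ (J : Alg) {n : ℕ} (m : ℕ) (x : S.Dom n) : Str m :=
  readStr (J.run n (List.ofFn x)) 0 m

/-- The set `H_k` of all `(b, x_b, d, d · (J x₀ ⊕ J x₁))` with `(x₀, x₁)` in the relation `R`,
`x_b` in the subset `P b` of the domain, and `d` in both `G 0 x₀` and `G 1 x₁`. -/
def hardcoreSet {n m : ℕ} (R : Set (S.Dom n × S.Dom n)) (P : Bool → Finset (S.Dom n))
    (G : Bool → S.Dom n → Set (Str m)) (J : S.Dom n → Str m) :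
    Set (Bool × S.Dom n × Str m × Bool) :=
  {q | ∃ b x₀ x₁ d, (x₀, x₁) ∈ R ∧ (if b then x₁ else x₀) ∈ P b ∧
    d ∈ G false x₀ ∩ G true x₁ ∧
    q = (b, if b then x₁ else x₀, d, dot d (xorStr (J x₀) (J x₁)))}

end Setup

/-- A noisy trapdoor claw-free family `f` with the adaptive hardcore bit property; `fHat` is the
family of the functions `f'_{k,b}` that are close to `f_{k,b}` and can be sampled in superposition. -/
structure NTCF (S : Setup) where
  keys : ∀ n, Set (S.Key n)
  f : ∀ n, S.Key n → Bool → S.Dom n → PMF (S.Ran n)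
  f_range : ∀ n, ∀ k ∈ keys n, ∀ b, ∀ x ∈ S.X.set n, ∀ y ∈ (f n k b x).support, y ∈ S.Y.set n
  /-- Efficient function generation. -/
  gen : KeyGen S.keyLen
  gen_key : ∀ n r, gen.key n r ∈ keys n
  /-- The good pairs of key and trapdoor. -/
  good : ∀ n, Set (S.Key n × Str (gen.trapLen.len n))
  good_key : ∀ n, ∀ p ∈ good n, p.1 ∈ keys n
  good_negl : Negl fun n => gen.mean n fun k t => ind ((k, t) ∉ good n)
  /-- The subsets `X₀` (for `false`) and `X₁` (for `true`) of the domain. -/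
  part : Bool → ∀ n, Finset (S.Dom n)
  part_subset : ∀ b n, part b n ⊆ S.X.set n
  /-- The inversion algorithm. -/
  inv : Alg
  inv_f : ∀ n k t, (k, t) ∈ good n → ∀ b, ∀ x ∈ S.X.set n, ∀ y ∈ (f n k b x).support,
    S.invert inv t b y = x
  /-- Injective pair. -/
  partner_of_zero : ∀ n k t, (k, t) ∈ good n → ∀ x ∈ part false n, ∃! x', (x, x') ∈ S.claws f n k
  partner_of_one : ∀ n k t, (k, t) ∈ good n → ∀ x ∈ part true n, ∃! x', (x', x) ∈ S.claws f n k
  /-- The injective-pair parameter. -/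
  c : ℝ
  c_nonneg : 0 ≤ c
  c_le_one : c ≤ 1
  threshold : ℕ
  overlap : ∀ n, threshold < n →
    c ≤ ((part false n ∩ part true n).card : ℝ) / ((S.X.set n).card : ℝ)
  overlap_zero : ∀ n, threshold < n → ∀ k t, (k, t) ∈ good n → ∀ x₀ x₁,
    (x₀, x₁) ∈ S.claws f n k → x₀ ∈ part false n ∩ part true n → x₁ ∈ part true n
  overlap_one : ∀ n, threshold < n → ∀ k t, (k, t) ∈ good n → ∀ x₀ x₁,
    (x₀, x₁) ∈ S.claws f n k → x₁ ∈ part false n ∩ part true n → x₀ ∈ part false n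
  claws_check : ∃ A : Alg, ∀ n k t, (k, t) ∈ good n → ∀ x₀ ∈ S.X.set n, ∀ x₁ ∈ S.X.set n,
    (A.bit n (List.ofFn k ++ List.ofFn t ++ List.ofFn x₀ ++ List.ofFn x₁) = true ↔
      (x₀, x₁) ∈ S.claws f n k)
  /-- Efficient range superposition. -/
  fHat : ∀ n, S.Key n → Bool → S.Dom n → PMF (S.Ran n)
  fHat_range : ∀ n, ∀ k ∈ keys n, ∀ b, ∀ x ∈ S.X.set n, ∀ y ∈ (fHat n k b x).support,
    y ∈ S.Y.set n
  /-- The inversion algorithm is correct on the supports of all `fHat n k b x`, also for those `x`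
  that have no partner in `R_k`. -/
  inv_fHat : ∀ n k t, (k, t) ∈ good n → ∀ b, ∀ x ∈ S.X.set n, ∀ y ∈ (fHat n k b x).support,
    S.invert inv t b y = x
  inv_partner : ∀ n k t, (k, t) ∈ good n → ∀ x₀ x₁, (x₀, x₁) ∈ S.claws f n k → ∀ b,
    ∀ y ∈ (fHat n k b (if b then x₁ else x₀)).support,
      S.invert inv t (!b) y = if b then x₀ else x₁
  chk_spec : ∀ n, ∀ k ∈ keys n, ∀ b, ∀ x ∈ S.X.set n, ∀ y ∈ S.Y.set n,
    (S.check n k y (bitStr b) x = true ↔ y ∈ (fHat n k b x).support)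
  hellinger : ∃ ν : ℕ → ℝ, Negl ν ∧ ∀ n, ∀ k ∈ keys n, ∀ b,
    (∑ x ∈ S.X.set n, hellingerSq (f n k b x) (fHat n k b x)) / (S.X.set n).card ≤ ν n
  samp_spec : S.Prepares keys fHat
  /-- The length `w` of the strings in the adaptive hardcore bit property. -/
  w : PolyLen
  /-- The sets `G_{k,b,x}`. -/
  hcSet : ∀ n, S.Key n → Bool → S.Dom n → Set (Str (w.len n))
  hcSet_dense : ∃ ν : ℕ → ℝ, Negl ν ∧ ∀ n, ∀ k ∈ keys n, ∀ b, ∀ x ∈ S.X.set n,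
    avg (fun d => ind (d ∉ hcSet n k b x)) ≤ ν n
  hcSet_check : ∃ A : Alg, ∀ n r b, ∀ x ∈ S.X.set n, ∀ d : Str (w.len n),
    (A.bit n (List.ofFn (gen.key n r) ++ [b] ++ List.ofFn x ++ List.ofFn (gen.trap n r) ++
      List.ofFn d) = true ↔ d ∈ hcSet n (gen.key n r) b x)
  /-- The algorithm that computes the injection `J` of the domain into the strings of length `w`;
  an efficient inverse exists. -/
  J : Alg
  J_inv : ∃ A : Alg, ∀ n, ∀ x ∈ S.X.set n,
    readStr (A.run n (List.ofFn (S.applyJ J (w.len n) x))) 0 (S.domLen.len n) = x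
  /-- Adaptive hardcore bit property: no PPT algorithm with output `(b, x, d, e)` hits `H_k` with a
  probability that differs noticeably from that of `(b, x, d, 1 - e)` hitting `H_k`. -/
  ahcb : ∀ A : PPT, Negl fun n =>
    |gen.mean n (fun k _ => A.prob n (List.ofFn k) fun s =>
        (s 0, readStr s 1 (S.domLen.len n), readStr s (1 + S.domLen.len n) (w.len n),
            s (1 + S.domLen.len n + w.len n)) ∈
          S.hardcoreSet (S.claws f n k) (fun b => part b n) (hcSet n k) (S.applyJ J (w.len n))) -
     gen.mean n (fun k _ => A.prob n (List.ofFn k) fun s =>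
        (s 0, readStr s 1 (S.domLen.len n), readStr s (1 + S.domLen.len n) (w.len n),
            !(s (1 + S.domLen.len n + w.len n))) ∈
          S.hardcoreSet (S.claws f n k) (fun b => part b n) (hcSet n k) (S.applyJ J (w.len n)))|

/-- A trapdoor injective family `g`, on the extended domain and the extended set of branches. -/
structure TrapdoorInjective (S : Setup) where
  keys : ∀ n, Set (S.Key n)
  g : ∀ n, S.Key n → S.Branch n → S.Dom n → PMF (S.Ran n)
  g_range : ∀ n, ∀ k ∈ keys n, ∀ b ∈ S.BExt.set n, ∀ x ∈ S.XExt.set n,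
    ∀ y ∈ (g n k b x).support, y ∈ S.Y.set n
  /-- Efficient function generation. -/
  gen : KeyGen S.keyLen
  gen_key : ∀ n r, gen.key n r ∈ keys n
  /-- The good pairs of key and trapdoor. -/
  good : ∀ n, Set (S.Key n × Str (gen.trapLen.len n))
  good_key : ∀ n, ∀ p ∈ good n, p.1 ∈ keys n
  good_negl : Negl fun n => gen.mean n fun k t => ind ((k, t) ∉ good n)
  /-- Disjoint trapdoor injective pair. -/
  disjoint : ∀ n k t, (k, t) ∈ good n → ∀ b ∈ S.BExt.set n, ∀ b' ∈ S.BExt.set n,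
    ∀ x ∈ S.XExt.set n, ∀ x' ∈ S.XExt.set n, (b, x) ≠ (b', x') →
      Disjoint (g n k b x).support (g n k b' x').support
  /-- The inversion algorithm, with output a bit and a domain element. -/
  inv : Alg
  inv_mem : ∀ n k t, (k, t) ∈ good n → ∀ y ∈ S.Y.set n,
    readStr (inv.run n (List.ofFn t ++ List.ofFn y)) 1 (S.domLen.len n) ∈ S.X.set n
  inv_g : ∀ n k t, (k, t) ∈ good n → ∀ b, ∀ x ∈ S.X.set n, ∀ y ∈ (g n k (bitStr b) x).support,
    inv.run n (List.ofFn t ++ List.ofFn y) 0 = b ∧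
    readStr (inv.run n (List.ofFn t ++ List.ofFn y)) 1 (S.domLen.len n) = x
  /-- Efficient range superposition. -/
  chk_spec : S.ChecksSupport keys S.BExt.set S.XExt.set g
  samp_spec : S.Prepares keys fun n k b => g n k (bitStr b)

/-- A weak extension `h` of the family `F`. -/
structure WeakExtension (S : Setup) (F : NTCF S) where
  keys : ∀ n, Set (S.Key n)
  h : ∀ n, S.Key n → S.Branch n → S.Dom n → PMF (S.Ran n)
  h_range : ∀ n, ∀ k ∈ keys n, ∀ b ∈ S.BExt.set n, ∀ x ∈ S.XExt.set n,
    ∀ y ∈ (h n k b x).support, y ∈ S.Y.set n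
  /-- Efficient function generation. -/
  gen : KeyGen S.keyLen
  gen_key : ∀ n r, gen.key n r ∈ keys n
  /-- Efficient range superposition. -/
  chk_spec : S.ChecksSupport keys S.BExt.set S.XExt.set h
  samp_spec : S.Prepares keys fun n k b => h n k (bitStr b)
  /-- Indistinguishability of keys. -/
  indist : KeysIndist gen F.gen

/-- The weak extractability property of a weak extension. -/
structure WeakExtractability (S : Setup) (F : NTCF S) (H : WeakExtension S F) where
  /-- The image check algorithm. -/
  imChk : Alg
  imChk_image : ∀ n r, ∀ b ∈ S.BExt.set n, ∀ x ∈ S.XExt.set n,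
    ∀ y ∈ (H.h n (H.gen.key n r) b x).support,
      imChk.bit n (List.ofFn (H.gen.trap n r) ++ List.ofFn y) = true
  /-- For every PPT algorithm `A` that outputs a point of the range there is a deterministic
  polynomial-time extractor `E` that is given the same key and the same coins. -/
  extractor : ∀ A : PPT, ∃ E : Alg,
    (∀ n, ∀ k ∈ H.keys n, ∀ r : Str (A.coins.len n),
      readStr (E.run n (List.ofFn k ++ List.ofFn r)) 0 (S.branchLen.len n) ∈ S.BExt.set n ∧
      readStr (E.run n (List.ofFn k ++ List.ofFn r)) (S.branchLen.len n) (S.domLen.len n) ∈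
        S.XExt.set n) ∧
    Negl fun n => H.gen.mean n fun k t => avg fun r : Str (A.coins.len n) =>
      let y := readStr (A.run n (List.ofFn k) r) 0 (S.ranLen.len n)
      let e := E.run n (List.ofFn k ++ List.ofFn r)
      ind (y ∈ S.Y.set n ∧
        S.check n k y (readStr e 0 _) (readStr e (S.branchLen.len n) _) = false ∧
        imChk.bit n (List.ofFn t ++ List.ofFn y) = true)

/-- A doubly extended extractable noisy trapdoor claw-free family tuple.  The check and state
preparation algorithms of the three families are the same by construction. -/
structure E3NTCF where
  S : Setup
  F : NTCF S
  G : TrapdoorInjective S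
  injectiveInvariant : KeysIndist F.gen G.gen
  H : WeakExtension S F
  weakExtract : WeakExtractability S F H

/-! ## The protocol -/

namespace E3NTCF

variable (P : E3NTCF)

/-- The answer `(y, d, e)` of a prover. -/
structure Answer (n : ℕ) where
  y : P.S.Ran n
  d : Str (P.F.w.len n)
  e : Bool

/-- The answer that stands on the first output wires. -/
def readAnswer (n : ℕ) (s : Wires) : P.Answer n where
  y := readStr s 0 _
  d := readStr s (P.S.ranLen.len n) _
  e := s (P.S.ranLen.len n + P.F.w.len n)

/-- The equation test. -/
def EqAccepts (n : ℕ) (k : P.S.Key n) (t : Str (P.F.gen.trapLen.len n)) (a : P.Answer n) : Prop :=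
  let x₀ := P.S.invert P.F.inv t false a.y
  let x₁ := P.S.invert P.F.inv t true a.y
  a.y ∈ P.S.Y.set n ∧
  P.S.check n k a.y (bitStr false) x₀ = true ∧
  P.S.check n k a.y (bitStr true) x₁ = true ∧
  (x₀, x₁) ∈ P.S.claws P.F.f n k ∧
  x₀ ∈ P.F.part false n ∧ x₁ ∈ P.F.part true n ∧
  a.d ∈ P.F.hcSet n k false x₀ ∩ P.F.hcSet n k true x₁ ∧
  dot a.d (xorStr (P.S.applyJ P.F.J (P.F.w.len n) x₀) (P.S.applyJ P.F.J (P.F.w.len n) x₁)) = a.e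

/-- The weak image test. -/
def WImAccepts (n : ℕ) (_k : P.S.Key n) (t : Str (P.H.gen.trapLen.len n)) (a : P.Answer n) : Prop :=
  a.y ∈ P.S.Y.set n ∧ P.weakExtract.imChk.bit n (List.ofFn t ++ List.ofFn a.y) = true

/-- The strong image test. -/
def SImAccepts (n : ℕ) (k : P.S.Key n) (t : Str (P.G.gen.trapLen.len n)) (a : P.Answer n) : Prop :=
  let s := P.G.inv.run n (List.ofFn t ++ List.ofFn a.y)
  a.y ∈ P.S.Y.set n ∧ P.S.check n k a.y (bitStr (s 0)) (readStr s 1 _) = true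

/-- The success probability in the protocol of a prover for which `resp k E` is the probability
that its answer to the key `k` satisfies `E`.  The verifier picks one of the tests uniformly. -/
def success (n : ℕ) (resp : P.S.Key n → (P.Answer n → Prop) → ℝ) : ℝ :=
  (P.F.gen.mean n (fun k t => resp k (P.EqAccepts n k t)) +
   P.H.gen.mean n (fun k t => resp k (P.WImAccepts n k t)) +
   P.G.gen.mean n (fun k t => resp k (P.SImAccepts n k t))) / 3

/-- Success probability of a PPT prover. -/
def classicalSuccess (A : PPT) (n : ℕ) : ℝ :=
  P.success n fun k E => A.prob n (List.ofFn k) fun s => E (P.readAnswer n s)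

/-- Success probability of a QPT prover. -/
def quantumSuccess (Q : QPT) (n : ℕ) : ℝ :=
  P.success n fun k E => measureProb (Q.run n (List.ofFn k)) fun s => E (P.readAnswer n s)

end E3NTCF

end PoQ

end

namespace PoQ

/-! ## Polynomial bounds -/

/-! Soundness. Run the extractor for the prover on the prover's own key and coins. Let Ext be the
event that the image y lies in Y and that the extracted pair lies in the extended sets and passes
the check. Let Bit be the event that y lies in Y, that the extracted point lies in X, and that this
point passes the check on the branch given by the first extracted bit. Weak extractability bounds
acceptance in the weak image test by Pr[Ext] under keys of H, up to negligible error. Both events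
can be decided efficiently from the key and the coins, so their probabilities carry over between key
distributions (`exists_extracts_distinguisher`, `exists_extractsBit_distinguisher`). Under keys of G
the supports are disjoint, so Ext together with acceptance in the strong image test forces the
extracted pair to be the one found by inversion. Its branch is then a bit and its point lies in X,
so Bit holds (`extractsBit_of_sImAccepts`). Under keys of F, Bit together with a correct equation
yields an element of H_k (`equationOutput_mem`). For good keys H_k is disjoint from its flipped copy
(`not_mem_flipLast`), and the adaptive hardcore bit makes the two almost equally likely to be hit,
so either is hit with probability at most about 1/2. Two uses of Pr[U] + Pr[V] ≤ 1 + Pr[U ∧ V] then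
bound the sum of the three acceptance probabilities by 1 + 1 + 1/2, and a third of that is 5/6.

Completeness. The prover puts the branch in uniform superposition, applies the state preparation,
replaces x by J(x) in place by means of the inverse of J, applies Hadamard gates to J(x) and the
branch, and measures. The image tests depend only on y, which lies in the right support up to
preparation error (`prover_image`). In the equation test a claw contributes two paths to the same
outcome (y, d, e), and they add constructively exactly when e = d · (J(x₀) ⊕ J(x₁)). By (a + b)² ≥
4ab the probability of the accepting outcomes is at least an average of Bhattacharyya coefficients
of f'(x₀) and f'(x₁) (`norm_eqState_ge`, `measureProb_eqState_ge`). The Hellinger condition brings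
these close to 1 on average, and the claws with x₀ in X₀ ∩ X₁ have weight at least c
(`eqState_accept`).

Uniformity. Both halves need composite circuits that a single machine prints in polynomial time.
Subcircuits act on interleaved registers: wire i of register r + 1 is L + r + K·i. The renaming is
affine, so no bound on the number of wires of a subcircuit is needed. Two printers suffice: one for
lists of gates with arguments affine in a loop index (`polyTime_downList_tokens`), and one that
reverses and affinely renames a printed circuit (`polyTime_reverse_relabel`). -/

/-- `f` is bounded by a polynomial. -/
def PolyBdd (f : ℕ → ℕ) : Prop := ∃ T : Polynomial ℕ, ∀ n, f n ≤ T.eval n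

namespace PolyBdd

lemma const (c : ℕ) : PolyBdd fun _ => c := ⟨Polynomial.C c, fun n => by simp⟩

lemma id : PolyBdd fun n => n := ⟨Polynomial.X, fun n => by simp⟩

lemma add {f g : ℕ → ℕ} (hf : PolyBdd f) (hg : PolyBdd g) : PolyBdd fun n => f n + g n := by
  obtain ⟨T, hT⟩ := hf
  obtain ⟨U, hU⟩ := hg
  exact ⟨T + U, fun n => by simpa using add_le_add (hT n) (hU n)⟩

lemma mul {f g : ℕ → ℕ} (hf : PolyBdd f) (hg : PolyBdd g) : PolyBdd fun n => f n * g n := by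
  obtain ⟨T, hT⟩ := hf
  obtain ⟨U, hU⟩ := hg
  exact ⟨T * U, fun n => by simpa using Nat.mul_le_mul (hT n) (hU n)⟩

end PolyBdd

/-! ## Running programs -/

/-- Started on `s`, the program `p` halts on `s'` after at most `T` steps. -/
def Takes (p : Prog) (s s' : Store) (T : ℕ) : Prop := ∃ t ≤ T, Exec p s s' t

namespace Takes

variable {p q : Prog} {s s₁ s₂ : Store} {T T₁ T₂ : ℕ}

lemma mono (h : Takes p s s₁ T₁) (hT : T₁ ≤ T₂) : Takes p s s₁ T₂ := by
  obtain ⟨t, ht, h⟩ := h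
  exact ⟨t, ht.trans hT, h⟩

lemma cast {s₁' : Store} (h : Takes p s s₁ T₁) (hs : s₁ = s₁') (hT : T₁ ≤ T₂) :
    Takes p s s₁' T₂ := hs ▸ h.mono hT

lemma skip (s : Store) : Takes Prog.skip s s 1 := ⟨1, le_rfl, .skip s⟩

lemma push (s : Store) (r : ℕ) (b : Bool) :
    Takes (.push r b) s (Function.update s r (b :: s r)) 1 := ⟨1, le_rfl, .push s r b⟩

lemma pop (s : Store) (r : ℕ) :
    Takes (.pop r) s (Function.update s r (s r).tail) 1 := ⟨1, le_rfl, .pop s r⟩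

lemma seq (h₁ : Takes p s s₁ T₁) (h₂ : Takes q s₁ s₂ T₂) :
    Takes (.seq p q) s s₂ (T₁ + T₂ + 1) := by
  obtain ⟨t₁, ht₁, h₁⟩ := h₁
  obtain ⟨t₂, ht₂, h₂⟩ := h₂
  exact ⟨_, by omega, .seq h₁ h₂⟩

lemma branchFalse {r : ℕ} {p₀ p₁ p₂ : Prog} {l : List Bool} (hr : s r = false :: l)
    (h : Takes p₁ s s₁ T) : Takes (.branch r p₀ p₁ p₂) s s₁ (T + 1) := by
  obtain ⟨t, ht, h⟩ := h
  exact ⟨_, Nat.succ_le_succ ht, .branchFalse (by simp [hr]) h⟩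

lemma branchTrue {r : ℕ} {p₀ p₁ p₂ : Prog} {l : List Bool} (hr : s r = true :: l)
    (h : Takes p₂ s s₁ T) : Takes (.branch r p₀ p₁ p₂) s s₁ (T + 1) := by
  obtain ⟨t, ht, h⟩ := h
  exact ⟨_, Nat.succ_le_succ ht, .branchTrue (by simp [hr]) h⟩

lemma loopDone {r : ℕ} (hr : s r = []) : Takes (.loop r p) s s 1 := ⟨1, le_rfl, .loopDone hr⟩

lemma loopStep {r : ℕ} (hr : s r ≠ []) (h₁ : Takes p s s₁ T₁) (h₂ : Takes (.loop r p) s₁ s₂ T₂) :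
    Takes (.loop r p) s s₂ (T₁ + T₂ + 1) := by
  obtain ⟨t₁, ht₁, h₁⟩ := h₁
  obtain ⟨t₂, ht₂, h₂⟩ := h₂
  exact ⟨_, by omega, .loopStep hr h₁ h₂⟩

end Takes

/-! ## Locality -/

/-- A number above all stacks that the program mentions. -/
def Prog.bound : Prog → ℕ
  | .skip => 0
  | .push r _ => r + 1
  | .pop r => r + 1
  | .seq p q => max p.bound q.bound
  | .branch r p₀ p₁ p₂ => max (r + 1) (max p₀.bound (max p₁.bound p₂.bound))
  | .loop r p => max (r + 1) p.bound

/-- The program with its stacks renamed. -/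
def Prog.rename (ρ : ℕ → ℕ) : Prog → Prog
  | .skip => .skip
  | .push r b => .push (ρ r) b
  | .pop r => .pop (ρ r)
  | .seq p q => .seq (p.rename ρ) (q.rename ρ)
  | .branch r p₀ p₁ p₂ => .branch (ρ r) (p₀.rename ρ) (p₁.rename ρ) (p₂.rename ρ)
  | .loop r p => .loop (ρ r) (p.rename ρ)

lemma Exec.frame {p : Prog} {s s' : Store} {t : ℕ} (h : Exec p s s' t) :
    ∀ r, p.bound ≤ r → s' r = s r := by
  induction h with
  | skip s => intro r _; rfl
  | push s r b => intro x hx; rw [Function.update_of_ne]; simp [Prog.bound] at hx; omega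
  | pop s r => intro x hx; rw [Function.update_of_ne]; simp [Prog.bound] at hx; omega
  | seq _ _ ih₁ ih₂ =>
    intro x hx; simp [Prog.bound] at hx; rw [ih₂ x hx.2, ih₁ x hx.1]
  | branchEmpty _ _ ih => intro x hx; simp [Prog.bound] at hx; exact ih x hx.2.1
  | branchFalse _ _ ih => intro x hx; simp [Prog.bound] at hx; exact ih x hx.2.2.1
  | branchTrue _ _ ih => intro x hx; simp [Prog.bound] at hx; exact ih x hx.2.2.2
  | loopDone _ => intro x _; rfl
  | loopStep _ _ _ ih₁ ih₂ =>
    intro x hx; rw [ih₂ x hx, ih₁ x]; simp [Prog.bound] at hx; exact hx.2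

/-- A step pushes at most one bit. This bounds the length of the output and the cost of emptying the
stacks afterwards. -/
lemma Exec.length_le {p : Prog} {s s' : Store} {t : ℕ} (h : Exec p s s' t) :
    ∀ r, (s' r).length ≤ (s r).length + t := by
  induction h with
  | skip s => intro r; omega
  | push s r b => intro x; by_cases hx : x = r <;> simp [hx]
  | pop s r =>
    intro x
    by_cases hx : x = r
    · subst hx; simp; omega
    · simp [hx]
  | seq _ _ ih₁ ih₂ => intro x; have := ih₁ x; have := ih₂ x; omega
  | branchEmpty _ _ ih => intro x; have := ih x; omega
  | branchFalse _ _ ih => intro x; have := ih x; omega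
  | branchTrue _ _ ih => intro x; have := ih x; omega
  | loopDone _ => intro x; omega
  | loopStep _ _ _ ih₁ ih₂ => intro x; have := ih₁ x; have := ih₂ x; omega

/-- An injective renaming keeps distinct stacks distinct, so the execution can be replayed step by
step. This is what turns a program into a relocatable subroutine. -/
lemma Exec.rename {p : Prog} {s s' : Store} {t : ℕ} (h : Exec p s s' t) {ρ : ℕ → ℕ}
    (hρ : Function.Injective ρ) : ∀ S : Store, (∀ r, S (ρ r) = s r) →
      ∃ S', Exec (p.rename ρ) S S' t ∧ (∀ r, S' (ρ r) = s' r) ∧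
        ∀ x, x ∉ Set.range ρ → S' x = S x := by
  induction h with
  | skip s => intro S hS; exact ⟨S, .skip S, hS, fun _ _ => rfl⟩
  | push s r b =>
    intro S hS
    refine ⟨_, .push S (ρ r) b, fun x => ?_, fun x hx => ?_⟩
    · simp only [Function.update_apply, hρ.eq_iff, hS]
    · rw [Function.update_of_ne]; rintro rfl; exact hx ⟨r, rfl⟩
  | pop s r =>
    intro S hS
    refine ⟨_, .pop S (ρ r), fun x => ?_, fun x hx => ?_⟩
    · simp only [Function.update_apply, hρ.eq_iff, hS]
    · rw [Function.update_of_ne]; rintro rfl; exact hx ⟨r, rfl⟩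
  | seq _ _ ih₁ ih₂ =>
    intro S hS
    obtain ⟨S₁, e₁, h₁, f₁⟩ := ih₁ S hS
    obtain ⟨S₂, e₂, h₂, f₂⟩ := ih₂ S₁ h₁
    exact ⟨S₂, .seq e₁ e₂, h₂, fun x hx => (f₂ x hx).trans (f₁ x hx)⟩
  | branchEmpty hr _ ih =>
    intro S hS
    obtain ⟨S₁, e₁, h₁, f₁⟩ := ih S hS
    exact ⟨S₁, .branchEmpty (by rw [hS, hr]) e₁, h₁, f₁⟩
  | branchFalse hr _ ih =>
    intro S hS
    obtain ⟨S₁, e₁, h₁, f₁⟩ := ih S hS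
    exact ⟨S₁, .branchFalse (by rw [hS, hr]) e₁, h₁, f₁⟩
  | branchTrue hr _ ih =>
    intro S hS
    obtain ⟨S₁, e₁, h₁, f₁⟩ := ih S hS
    exact ⟨S₁, .branchTrue (by rw [hS, hr]) e₁, h₁, f₁⟩
  | loopDone hr => intro S hS; exact ⟨S, .loopDone (by rw [hS, hr]), hS, fun _ _ => rfl⟩
  | loopStep hr _ _ ih₁ ih₂ =>
    intro S hS
    obtain ⟨S₁, e₁, h₁, f₁⟩ := ih₁ S hS
    obtain ⟨S₂, e₂, h₂, f₂⟩ := ih₂ S₁ h₁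
    exact ⟨S₂, .loopStep (by rwa [hS]) e₁ e₂, h₂, fun x hx => (f₂ x hx).trans (f₁ x hx)⟩

/-! ## Basic subroutines -/

namespace Prog

/-- Empty the stack `r`. -/
def clear (r : ℕ) : Prog := .loop r (.pop r)

/-- Empty the `m` stacks from `a` on. -/
def clearRange (a : ℕ) : ℕ → Prog
  | 0 => .skip
  | m + 1 => .seq (clearRange a m) (clear (a + m))

/-- Move the top bit of `r` to `z`. -/
def moveTop (r z : ℕ) : Prog :=
  .branch r .skip (.seq (.pop r) (.push z false)) (.seq (.pop r) (.push z true))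

/-- Move the contents of `r` to `z`, bit by bit. -/
def moveAll (r z : ℕ) : Prog := .loop r (moveTop r z)

/-- Move the top bit of `z` to both `r` and `r'`. -/
def splitTop (z r r' : ℕ) : Prog :=
  .branch z .skip (.seq (.pop z) (.seq (.push r false) (.push r' false)))
    (.seq (.pop z) (.seq (.push r true) (.push r' true)))

/-- Move the contents of `z` to both `r` and `r'`, bit by bit. -/
def splitAll (z r r' : ℕ) : Prog := .loop z (splitTop z r r')

/-- Put a copy of the contents of `r` in front of those of `r'`, using the empty stack `z`. -/
def prepend (r r' z : ℕ) : Prog := .seq (moveAll r z) (splitAll z r r')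

/-- Push `true` for `m` times. -/
def pushTrues (r : ℕ) : ℕ → Prog
  | 0 => .skip
  | m + 1 => .seq (pushTrues r m) (.push r true)

/-- Push a list. -/
def pushList (r : ℕ) : List Bool → Prog
  | [] => .skip
  | b :: l => .seq (pushList r l) (.push r b)

end Prog

namespace Takes

open Prog

lemma clear (s : Store) (r : ℕ) :
    Takes (clear r) s (Function.update s r []) (2 * (s r).length + 1) := by
  generalize hl : s r = l
  induction l generalizing s with
  | nil =>
    refine (loopDone hl).cast ?_ (by simp)
    rw [← hl, Function.update_eq_self]
  | cons b l ih =>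
    refine (loopStep (r := r) (by simp [hl]) (pop s r)
      (ih (Function.update s r (s r).tail) (by simp [hl]))).cast ?_ ?_
    · rw [Function.update_idem]
    · rw [List.length_cons]; omega

lemma clearRange (s : Store) (a m N : ℕ) (h : ∀ r, a ≤ r → (s r).length ≤ N) :
    Takes (clearRange a m) s (fun r => if a ≤ r ∧ r < a + m then [] else s r)
      (m * (2 * N + 2) + 1) := by
  induction m with
  | zero =>
    refine (skip s).cast ?_ (by simp)
    funext r; rw [if_neg (by omega)]
  | succ m ih =>
    refine (ih.seq (Takes.clear _ (a + m))).cast ?_ ?_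
    · funext r
      simp only [Function.update_apply]
      split_ifs <;> first | rfl | omega
    · have := h (a + m) (by omega)
      simp only [lt_self_iff_false, and_false, if_false]
      have e : (m + 1) * (2 * N + 2) = m * (2 * N + 2) + (2 * N + 2) := by ring
      omega

lemma moveTop {s : Store} {r z : ℕ} {b : Bool} {l : List Bool} (hrz : r ≠ z) (h : s r = b :: l) :
    Takes (moveTop r z) s (Function.update (Function.update s r l) z (b :: s z)) 4 := by
  have key : ∀ b, Takes (.seq (.pop r) (.push z b)) s
      (Function.update (Function.update s r l) z (b :: s z)) 3 := by
    intro b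
    have h2 := (pop s r).seq (push (Function.update s r (s r).tail) z b)
    rwa [h, List.tail_cons, Function.update_of_ne hrz.symm] at h2
  cases b
  · exact branchFalse h (key false)
  · exact branchTrue h (key true)

lemma moveAll {r z : ℕ} (hrz : r ≠ z) (s : Store) :
    Takes (moveAll r z) s (Function.update (Function.update s r []) z ((s r).reverse ++ s z))
      (5 * (s r).length + 1) := by
  generalize hl : s r = l
  induction l generalizing s with
  | nil =>
    refine (loopDone hl).cast ?_ (by simp)
    rw [List.reverse_nil, List.nil_append, ← hl, Function.update_eq_self, Function.update_eq_self]
  | cons b l ih =>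
    refine (loopStep (by simp [hl]) (moveTop hrz hl) (ih _ (by simp [hrz]))).cast ?_ ?_
    · funext x
      simp only [Function.update_apply]
      split_ifs <;> simp_all
    · rw [List.length_cons]; omega

lemma splitTop {s : Store} {z r r' : ℕ} {b : Bool} {l : List Bool} (h1 : z ≠ r) (h2 : z ≠ r')
    (h3 : r ≠ r') (h : s z = b :: l) :
    Takes (splitTop z r r') s (Function.update (Function.update (Function.update s z l) r (b :: s r))
      r' (b :: s r')) 6 := by
  have key : ∀ b, Takes (.seq (.pop z) (.seq (.push r b) (.push r' b))) s
      (Function.update (Function.update (Function.update s z l) r (b :: s r))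
      r' (b :: s r')) 5 := by
    intro b
    refine ((pop s z).seq ((push _ r b).seq (push _ r' b))).cast ?_ le_rfl
    funext x
    simp only [Function.update_apply]
    split_ifs <;> simp_all
  cases b
  · exact branchFalse h (key false)
  · exact branchTrue h (key true)

lemma splitAll {z r r' : ℕ} (h1 : z ≠ r) (h2 : z ≠ r') (h3 : r ≠ r') (s : Store) :
    Takes (splitAll z r r') s (Function.update (Function.update (Function.update s z []) r
      ((s z).reverse ++ s r)) r' ((s z).reverse ++ s r')) (7 * (s z).length + 1) := by
  generalize hl : s z = l
  induction l generalizing s with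
  | nil =>
    refine (loopDone hl).cast ?_ (by simp)
    simp only [List.reverse_nil, List.nil_append]
    funext x
    simp only [Function.update_apply]
    split_ifs <;> simp_all
  | cons b l ih =>
    refine (loopStep (by simp [hl]) (splitTop h1 h2 h3 hl) (ih _ (by simp [h1, h2]))).cast ?_ ?_
    · funext x
      simp only [Function.update_apply]
      split_ifs <;> simp_all
    · rw [List.length_cons]; omega

/-- The move to `z` reverses the contents and the split back reverses them again, so both copies
come out in the original order. -/
lemma prepend {r r' z : ℕ} (h1 : r ≠ r') (h2 : r ≠ z) (h3 : r' ≠ z) {s : Store} (hz : s z = []) :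
    Takes (prepend r r' z) s (Function.update s r' (s r ++ s r'))
      (12 * (s r).length + 3) := by
  refine ((moveAll h2 s).seq (splitAll h2.symm h3.symm h1 _)).cast ?_ ?_
  · funext x
    simp only [Function.update_apply]
    split_ifs <;> simp_all
  · simp [hz]; omega

lemma pushTrues (s : Store) (r m : ℕ) :
    Takes (pushTrues r m) s (Function.update s r (List.replicate m true ++ s r)) (2 * m + 1) := by
  induction m with
  | zero => exact (skip s).cast (by simp) (by simp)
  | succ m ih =>
    refine (ih.seq (push _ r true)).cast ?_ (by omega)
    rw [Function.update_idem, Function.update_self, List.replicate_succ, List.cons_append]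

lemma pushList (s : Store) (r : ℕ) (l : List Bool) :
    Takes (pushList r l) s (Function.update s r (l ++ s r)) (2 * l.length + 1) := by
  induction l with
  | nil => exact (skip s).cast (by simp) (by simp)
  | cons b l ih =>
    refine (ih.seq (push _ r b)).cast ?_ (by rw [List.length_cons]; omega)
    rw [Function.update_idem, Function.update_self, List.cons_append]

end Takes

/-! ## Closure properties of polynomial time -/

lemma PolyTime.of_takes {F : ℕ → List Bool} (p : Prog) {f : ℕ → ℕ} (hf : PolyBdd f)
    (h : ∀ n, ∃ s, Takes p (initStore n) s (f n) ∧ s 1 = F n) : PolyTime F := by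
  obtain ⟨T, hT⟩ := hf
  refine ⟨p, T, fun n => ?_⟩
  obtain ⟨s, ⟨t, ht, h⟩, hs⟩ := h n
  exact ⟨s, t, h, hs, ht.trans (hT n)⟩

lemma PolyTime.length_bdd {F : ℕ → List Bool} (hF : PolyTime F) : PolyBdd fun n => (F n).length := by
  obtain ⟨p, T, h⟩ := hF
  refine ⟨T, fun n => ?_⟩
  obtain ⟨s, t, e, hs, ht⟩ := h n
  have := e.length_le 1
  rw [hs] at this
  simp only [initStore, one_ne_zero, if_false, List.length_nil, zero_add] at this
  exact this.trans ht

lemma PolyLen.bdd (a : PolyLen) : PolyBdd a.len := by simpa using a.poly.length_bdd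

/-- A polynomial-time computable family as a subroutine that keeps all other stacks. -/
lemma PolyTime.call {F : ℕ → List Bool} (hF : PolyTime F) {j c : ℕ} (hj : 0 < j) (hc : j < c) :
    ∃ (p : Prog) (f : ℕ → ℕ), PolyBdd f ∧ ∀ n (S : Store), S 0 = List.replicate n true →
      S j = [] → (∀ r, c ≤ r → S r = []) → Takes p S (Function.update S j (F n)) (f n) := by
  obtain ⟨p, T, h⟩ := hF
  -- The output stack becomes `j` and every other stack is shifted by `c`. Since `ρ 1 = j`, the
  -- position `c + 1` is not in the range and is free as scratch space.
  set ρ : ℕ → ℕ := fun r => if r = 1 then j else r + c with hρ_def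
  have hρ : Function.Injective ρ := by
    intro a b hab
    simp only [hρ_def] at hab
    split_ifs at hab <;> omega
  have hrange : ∀ x, x ∈ Set.range ρ ↔ x = j ∨ (c ≤ x ∧ x ≠ c + 1) := by
    intro x
    constructor
    · rintro ⟨r, rfl⟩
      simp only [hρ_def]
      split_ifs <;> omega
    · rintro (rfl | ⟨h1, h2⟩)
      · exact ⟨1, by simp [hρ_def]⟩
      · exact ⟨x - c, by simp only [hρ_def]; rw [if_neg] <;> omega⟩
  have hT : PolyBdd fun n => T.eval n := ⟨T, fun n => le_rfl⟩
  have hlen := PolyTime.length_bdd ⟨p, T, h⟩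
  -- The subroutine reads its input at `ρ 0 = c`, so the unary parameter is copied there first. The
  -- margin 2 in the cleanup guarantees that `c` is emptied even if `p` mentions no stack.
  refine ⟨.seq (.prepend 0 c (c + 1)) (.seq (p.rename ρ) (.clearRange c (p.bound + 2))),
    fun n => (12 * n + 3) +
      ((T.eval n) + ((p.bound + 2) * (2 * (n + T.eval n) + 2) + 1) + 1) + 1, ?_, ?_⟩
  · exact (((PolyBdd.const 12).mul .id |>.add (.const 3)).add ((hT.add (((PolyBdd.const _).mul
      (((PolyBdd.const 2).mul (PolyBdd.id.add hT)).add (.const 2))).add (.const 1))).add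
        (.const 1))).add (.const 1)
  intro n S h0 hSj hSc
  obtain ⟨s, t, e, hs, ht⟩ := h n
  have h1 := Takes.prepend (r := 0) (r' := c) (z := c + 1) (by omega) (by omega) (by omega)
    (s := S) (hSc _ (by omega))
  rw [h0, List.length_replicate, hSc c le_rfl, List.append_nil] at h1
  obtain ⟨S', e', hS', fS'⟩ := e.rename hρ (Function.update S c (List.replicate n true)) (by
    intro r
    by_cases hr1 : r = 1
    · subst hr1
      simp only [hρ_def, if_true, initStore]
      rw [Function.update_of_ne (by omega), hSj]
      rfl
    · simp only [hρ_def, if_neg hr1, initStore]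
      by_cases hr0 : r = 0
      · subst hr0; simp
      · rw [Function.update_of_ne (by omega), if_neg hr0, hSc _ (by omega)])
  have hge : ∀ x, c ≤ x → x ≠ c + 1 → S' x = s (x - c) := by
    intro x hx hx1
    rw [← hS']
    congr 1
    simp only [hρ_def]; rw [if_neg] <;> omega
  have hc1 : S' (c + 1) = [] := by
    rw [fS' _ (by rw [hrange]; omega), Function.update_of_ne (by omega), hSc _ (by omega)]
  refine h1.seq (Takes.seq (T₁ := T.eval n) ⟨t, ht, e'⟩ ?_)
  refine (Takes.clearRange S' c (p.bound + 2) (n + T.eval n) ?_).cast ?_ le_rfl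
  · intro r hr
    by_cases hr1 : r = c + 1
    · rw [hr1, hc1]; simp
    · rw [hge r hr hr1]
      have h2 := e.length_le (r - c)
      have h3 : (initStore n (r - c)).length ≤ n := by
        simp only [initStore]; split_ifs <;> simp
      omega
  · funext x
    by_cases hx : c ≤ x
    · rw [Function.update_of_ne (by omega), hSc x hx]
      split_ifs with h2
      · rfl
      · rw [hge x hx (by omega), e.frame _ (by omega)]
        simp only [initStore]
        rw [if_neg (by omega)]
    · rw [if_neg (by omega)]
      by_cases hxj : x = j
      · subst hxj
        rw [Function.update_self, ← hs, ← hS' 1]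
        simp [hρ_def]
      · rw [Function.update_of_ne hxj, fS' x (by rw [hrange]; omega),
          Function.update_of_ne (by omega)]

lemma PolyTime.const (l : List Bool) : PolyTime fun _ => l := by
  refine .of_takes (Prog.pushList 1 l) (.const (2 * l.length + 1)) fun n =>
    ⟨_, Takes.pushList _ 1 l, ?_⟩
  simp [initStore]

lemma PolyTime.append {F G : ℕ → List Bool} (hF : PolyTime F) (hG : PolyTime G) :
    PolyTime fun n => F n ++ G n := by
  obtain ⟨p, f, hf, hp⟩ := hF.call (j := 2) (c := 4) (by omega) (by omega)
  obtain ⟨q, g, hg, hq⟩ := hG.call (j := 1) (c := 4) (by omega) (by omega)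
  refine .of_takes (.seq (.seq p q) (.prepend 2 1 3))
    (f := fun n => (f n + g n + 1) + (12 * (F n).length + 3) + 1) ?_ fun n => ?_
  · exact (((hf.add hg).add (.const 1)).add (((PolyBdd.const 12).mul hF.length_bdd).add
      (.const 3))).add (.const 1)
  have h1 := hp n (initStore n) (by simp [initStore]) (by simp [initStore])
    (fun r hr => by simp [initStore]; omega)
  have h2 := hq n (Function.update (initStore n) 2 (F n)) (by simp [initStore])
    (by simp [initStore]) (fun r hr => by
      rw [Function.update_of_ne (by omega)]; simp [initStore]; omega)
  have h3 := (h1.seq h2).seq (Takes.prepend (r := 2) (r' := 1) (z := 3) (by omega) (by omega)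
    (by omega) (by simp [initStore]))
  exact ⟨_, h3.cast rfl (by simp), by simp⟩

/-! ## Lengths -/

namespace PolyLen

/-- A constant length. -/
def const (c : ℕ) : PolyLen := ⟨fun _ => c, .const _⟩

/-- The sum of two lengths. -/
def add (a b : PolyLen) : PolyLen :=
  ⟨fun n => a.len n + b.len n, by simpa only [List.replicate_add] using a.poly.append b.poly⟩

/-- A constant multiple of a length. -/
def mul (c : ℕ) (a : PolyLen) : PolyLen where
  len n := c * a.len n
  poly := by
    induction c with
    | zero => simpa using PolyTime.const []
    | succ c ih =>
      simpa only [Nat.succ_mul, List.replicate_add] using ih.append a.poly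

instance : Add PolyLen := ⟨add⟩

@[simp] lemma const_len (c n : ℕ) : (const c).len n = c := rfl

@[simp] lemma add_len (a b : PolyLen) (n : ℕ) : (a + b).len n = a.len n + b.len n := rfl

@[simp] lemma mul_len (c : ℕ) (a : PolyLen) (n : ℕ) : (mul c a).len n = c * a.len n := rfl

end PolyLen

/-! ## Printing loops -/

lemma PolyBdd.sum {f : ℕ → ℕ → ℕ} (q : ℕ) (hf : ∀ j, PolyBdd (f j)) :
    PolyBdd fun n => ∑ j ∈ Finset.range q, f j n := by
  induction q with
  | zero => simpa using PolyBdd.const 0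
  | succ q ih => simpa only [Finset.sum_range_succ] using ih.add (hf q)

/-- The concatenation of `g (m - 1)`, …, `g 0`. -/
def downList {α : Type*} (g : ℕ → List α) : ℕ → List α
  | 0 => []
  | m + 1 => g m ++ downList g m

lemma downList_flatMap {α β : Type*} (g : ℕ → List α) (c : α → List β) (m : ℕ) :
    (downList g m).flatMap c = downList (fun i => (g i).flatMap c) m := by
  induction m with
  | zero => rfl
  | succ m ih => simp [downList, ih]

/-- The encodings of `V 0`, …, `V (q - 1)`. -/
def tokens (q : ℕ) (V : ℕ → ℕ) : List Bool := (List.range q).flatMap fun j => encNat (V j)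

lemma tokens_succ (q : ℕ) (V : ℕ → ℕ) : tokens (q + 1) V = tokens q V ++ encNat (V q) := by
  simp [tokens, List.range_succ]

namespace Prog

/-- Print the number on stack `4 + j` on stack `1`, then increase it by `s`. -/
def emitOne (j s : ℕ) : Prog :=
  .seq (.push 1 false) (.seq (.prepend (4 + j) 1 3) (.pushTrues (4 + j) s))

/-- Print the numbers on the stacks `4`, …, `3 + q` and increase them by the strides `st`. -/
def emitAll (st : ℕ → ℕ) : ℕ → Prog
  | 0 => .skip
  | q + 1 => .seq (emitOne q (st q)) (emitAll st q)

end Prog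

namespace Takes

lemma loop_iterate {r : ℕ} {p : Prog} {T : ℕ} (m : ℕ) (σ : ℕ → Store)
    (hne : ∀ i < m, σ i r ≠ []) (hstep : ∀ i < m, Takes p (σ i) (σ (i + 1)) T)
    (hdone : σ m r = []) : Takes (.loop r p) (σ 0) (σ m) (m * (T + 1) + 1) := by
  induction m generalizing σ with
  | zero => exact (loopDone hdone).mono (by simp)
  | succ m ih =>
    refine (loopStep (hne 0 (by omega)) (hstep 0 (by omega)) (ih (fun i => σ (i + 1))
      (fun i hi => hne _ (by omega)) (fun i hi => hstep _ (by omega)) hdone)).mono ?_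
    have e : (m + 1) * (T + 1) = m * (T + 1) + (T + 1) := by ring
    omega

/-- The output grows at its head, so the end marker is pushed before the unary digits. -/
lemma emitOne {S : Store} {j s v : ℕ} (h3 : S 3 = []) (hj : S (4 + j) = List.replicate v true) :
    Takes (Prog.emitOne j s) S (Function.update (Function.update S 1 (encNat v ++ S 1)) (4 + j)
      (List.replicate (v + s) true)) (12 * v + 2 * s + 7) := by
  refine ((push S 1 false).seq ((prepend (r := 4 + j) (r' := 1) (z := 3) (by omega) (by omega)
    (by omega) (by simpa using h3)).seq (pushTrues _ (4 + j) s))).cast ?_ ?_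
  · have h4 : 4 + j ≠ 1 := by omega
    funext x
    simp only [Function.update_apply, h4, if_false, if_true, hj, encNat, List.append_assoc,
      List.cons_append, List.nil_append]
    split_ifs
    · rw [Nat.add_comm, List.replicate_add]
    all_goals rfl
  · have h4 : 4 + j ≠ 1 := by omega
    simp only [Function.update_apply, h4, if_false, hj, List.length_replicate]
    omega

/-- The tokens are printed from the last to the first, again because the output grows at its head.
Adding the strides in the same pass advances all affine arguments to the next round. -/
lemma emitAll {st V : ℕ → ℕ} {q N : ℕ} {S : Store} (h3 : S 3 = [])
    (hV : ∀ j < q, S (4 + j) = List.replicate (V j) true) (hN : ∀ j < q, V j + st j ≤ N) :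
    Takes (Prog.emitAll st q) S (fun r => if r = 1 then tokens q V ++ S 1 else
      if 4 ≤ r ∧ r < 4 + q then List.replicate (V (r - 4) + st (r - 4)) true else S r)
      (q * (12 * N + 8) + 1) := by
  induction q generalizing S with
  | zero =>
    refine (skip S).cast ?_ (by simp)
    funext r
    split_ifs with h1 h2
    · subst h1; simp [tokens]
    · omega
    · rfl
  | succ q ih =>
    have hq : 4 + q ≠ 1 := by omega
    refine ((emitOne h3 (hV q (by omega))).seq (ih ?_ ?_ ?_)).cast ?_ ?_
    · rw [Function.update_of_ne (by omega), Function.update_of_ne (by omega), h3]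
    · intro j hj
      rw [Function.update_of_ne (by omega), Function.update_of_ne (by omega), hV j (by omega)]
    · exact fun j hj => hN j (by omega)
    · funext r
      by_cases h1 : r = 1
      · subst h1
        simp [Function.update_of_ne hq.symm, tokens_succ]
      · simp only [h1, if_false, Function.update_apply]
        by_cases h2 : r = 4 + q
        · subst h2
          simp
        · simp only [h2, if_false]
          split_ifs <;> first | rfl | omega
    · have := hN q (by omega)
      have e : (q + 1) * (12 * N + 8) = q * (12 * N + 8) + (12 * N + 8) := by ring
      omega

end Takes

/-- Several lengths in unary on the stacks from `4` on. -/
lemma exists_load_lengths (m : PolyLen) (A : ℕ → PolyLen) (q Q : ℕ) (hq : q ≤ Q) :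
    ∃ (p : Prog) (f : ℕ → ℕ), PolyBdd f ∧ ∀ n, Takes p (initStore n) (fun r =>
      if r = 0 then List.replicate n true else
      if r = 2 then List.replicate (m.len n) true else
      if 4 ≤ r ∧ r < 4 + q then List.replicate ((A (r - 4)).len n) true else []) (f n) := by
  -- `Q` stays fixed, so that the scratch stacks of each later call, from `4 + Q` on, lie above all
  -- loaded lengths.
  induction q with
  | zero =>
    obtain ⟨p, f, hf, h⟩ := m.poly.call (j := 2) (c := 3) (by omega) (by omega)
    refine ⟨p, f, hf, fun n => (h n (initStore n) (by simp [initStore]) (by simp [initStore])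
      (fun r hr => by simp [initStore]; omega)).cast ?_ le_rfl⟩
    funext r
    simp only [Function.update_apply, initStore]
    split_ifs <;> first | rfl | omega
  | succ q ih =>
    obtain ⟨p, f, hf, h⟩ := ih (by omega)
    obtain ⟨p', f', hf', h'⟩ := (A q).poly.call (j := 4 + q) (c := 4 + Q) (by omega) (by omega)
    refine ⟨.seq p p', _, (hf.add hf').add (.const 1), fun n => ((h n).seq (h' n _ ?_ ?_ ?_)).cast
      ?_ le_rfl⟩
    · simp
    · simp; omega
    · intro r hr
      rw [if_neg (by omega), if_neg (by omega), if_neg (by omega)]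
    · funext r
      simp only [Function.update_apply]
      split_ifs with h1 <;> first | rfl | omega | (subst h1; simp)

/-- The generic printer for regular layers of gates: gate tag and wires are numbers affine in the
loop index, each kept in unary on its own stack and increased by a constant stride per round. Stride
0 gives constants such as the tag. -/
lemma polyTime_downList_tokens (m : PolyLen) (A : ℕ → PolyLen) (st : ℕ → ℕ) (q : ℕ) :
    PolyTime fun n =>
      downList (fun i => tokens q fun j => (A j).len n + st j * i) (m.len n) := by
  obtain ⟨p, f, hf, hp⟩ := exists_load_lengths m A q q le_rfl
  set N : ℕ → ℕ := fun n => ∑ j ∈ Finset.range q, ((A j).len n + st j * (m.len n + 1)) with hN_def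
  have hN : PolyBdd N := .sum q fun j => (A j).bdd.add ((PolyBdd.const _).mul (m.bdd.add (.const 1)))
  refine .of_takes (.seq p (.loop 2 (.seq (.pop 2) (Prog.emitAll st q))))
    (f := fun n => f n + (m.len n * ((1 + (q * (12 * N n + 8) + 1) + 1) + 1) + 1) + 1) ?_
    fun n => ?_
  · exact (hf.add ((m.bdd.mul ((((PolyBdd.const 1).add (((PolyBdd.const q).mul
      (((PolyBdd.const 12).mul hN).add (.const 8))).add (.const 1))).add (.const 1)).add
        (.const 1))).add (.const 1))).add (.const 1)
  -- The loop invariant: after `i` rounds the pieces below `i` are printed, `m - i` rounds are left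
  -- on stack 2, and the argument stacks hold their values for round `i`.
  set σ : ℕ → Store := fun i r =>
    if r = 0 then List.replicate n true else
    if r = 1 then downList (fun i => tokens q fun j => (A j).len n + st j * i) i else
    if r = 2 then List.replicate (m.len n - i) true else
    if 4 ≤ r ∧ r < 4 + q then List.replicate ((A (r - 4)).len n + st (r - 4) * i) true else []
    with hσ
  refine ⟨σ (m.len n), ((hp n).cast (s₁' := σ 0) ?_ le_rfl).seq
    (Takes.loop_iterate (m.len n) σ ?_ ?_ ?_), by simp [hσ]⟩
  · funext r
    simp only [hσ]
    split_ifs <;> simp_all [downList]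
  · intro i hi
    simp [hσ]; omega
  · intro i hi
    have h2 : (σ i 2) = true :: List.replicate (m.len n - (i + 1)) true := by
      simp only [hσ]
      rw [← List.replicate_succ]
      simp; omega
    refine ((Takes.pop (σ i) 2).seq (Takes.emitAll (V := fun j => (A j).len n + st j * i) (N := N n)
      ?_ ?_ ?_)).cast ?_ le_rfl
    · simp [hσ]
    · intro j hj
      rw [Function.update_of_ne (by omega)]
      have h1 : 4 + j ≠ 1 := by omega
      have h2 : 4 + j ≠ 2 := by omega
      have h3 : 4 + j ≠ 3 := by omega
      simp [hσ, hj, h1, h2]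
    · intro j hj
      have h1 : (A j).len n + st j * (m.len n + 1) ≤ N n :=
        Finset.single_le_sum (f := fun j => (A j).len n + st j * (m.len n + 1))
          (fun _ _ => Nat.zero_le _) (Finset.mem_range.mpr hj)
      have h2 : st j * (i + 1) ≤ st j * (m.len n + 1) := Nat.mul_le_mul_left _ (by omega)
      have h3 : st j * (i + 1) = st j * i + st j := by ring
      omega
    · funext r
      rw [h2]
      by_cases h1 : r = 1
      · subst h1
        simp [hσ, downList]
      · simp only [h1, if_false, Function.update_apply, hσ]
        split_ifs <;> first | rfl | omega | simp [Nat.mul_add, Nat.add_assoc]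
  · simp [hσ]

/-! ## Printing relabelled circuits -/

namespace QGate

/-- The number that encodes the kind of the gate. -/
def tag : QGate → ℕ
  | .classical (.not _) => 0
  | .classical (.cnot _ _) => 1
  | .classical (.toffoli _ _ _) => 2
  | .hadamard _ => 3
  | .tGate _ => 4

/-- The wires of the gate. -/
def wires : QGate → List ℕ
  | .classical (.not k) => [k]
  | .classical (.cnot i k) => [i, k]
  | .classical (.toffoli i j k) => [i, j, k]
  | .hadamard k => [k]
  | .tGate k => [k]

end QGate

/-- The gate with its wires renamed. -/
def CGate.map (φ : ℕ → ℕ) : CGate → CGate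
  | .not k => .not (φ k)
  | .cnot i k => .cnot (φ i) (φ k)
  | .toffoli i j k => .toffoli (φ i) (φ j) (φ k)

/-- The gate with its wires renamed. -/
def QGate.map (φ : ℕ → ℕ) : QGate → QGate
  | .classical g => .classical (g.map φ)
  | .hadamard k => .hadamard (φ k)
  | .tGate k => .tGate (φ k)

namespace QGate

lemma code_eq (g : QGate) : g.code = encNat g.tag ++ g.wires.flatMap encNat := by
  rcases g with ⟨_ | _ | _⟩ | _ | _ <;> simp [code, CGate.code, tag, wires]

lemma code_map (φ : ℕ → ℕ) (g : QGate) :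
    (g.map φ).code = encNat g.tag ++ (g.wires.map φ).flatMap encNat := by
  rcases g with ⟨_ | _ | _⟩ | _ | _ <;> simp [map, CGate.map, code, CGate.code, tag, wires]

/-- The table tells the parser how many wires follow a given tag. -/
lemma getElem?_tag (g : QGate) : [1, 2, 3, 1, 1][g.tag]? = some g.wires.length := by
  rcases g with ⟨_ | _ | _⟩ | _ | _ <;> rfl

lemma tag_le (g : QGate) : g.tag ≤ 4 := by
  rcases g with ⟨_ | _ | _⟩ | _ | _ <;> simp [tag]

lemma length_wires_le (g : QGate) : g.wires.length ≤ 3 := by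
  rcases g with ⟨_ | _ | _⟩ | _ | _ <;> simp [wires]

end QGate

namespace Prog

/-- Read a number in unary from stack `2` and push `K` times that number on stack `5`; the flag on
stack `6` is raised until the end marker is reached. -/
def readMul (K : ℕ) : Prog :=
  .loop 6 (.branch 2 (.pop 6) (.seq (.pop 2) (.pop 6)) (.seq (.pop 2) (pushTrues 5 K)))

/-- Read a wire from stack `2` and put its new name on stack `5`. -/
def readArg (K : ℕ) : Prog :=
  .seq (prepend 4 5 3) (.seq (.push 6 true) (.seq (readMul K) (.push 5 false)))

/-- Read `a` wires. -/
def readArgs (K : ℕ) : ℕ → Prog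
  | 0 => .skip
  | a + 1 => .seq (readArg K) (readArgs K a)

/-- Read a gate, where the list holds the numbers of wires of the kinds of gates. -/
def readGate (K : ℕ) : List ℕ → Prog
  | [] => .skip
  | a :: l => .branch 2 .skip (.seq (.pop 2) (.seq (.push 5 false) (readArgs K a)))
      (.seq (.pop 2) (.seq (.push 5 true) (readGate K l)))

/-- Read a gate from stack `2` and put its renamed version in front of stack `1`. -/
def relabelGate (K : ℕ) : Prog := .seq (readGate K [1, 2, 3, 1, 1]) (moveAll 5 1)

end Prog

namespace Takes

lemma readMul {K k : ℕ} {rest : List Bool} {S : Store} (h2 : S 2 = encNat k ++ rest)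
    (h6 : S 6 = [true]) : Takes (Prog.readMul K) S
      (Function.update (Function.update (Function.update S 2 rest) 5
        (List.replicate (K * k) true ++ S 5)) 6 []) (k * (2 * K + 5) + 6) := by
  induction k generalizing S with
  | zero =>
    refine (loopStep (by simp [h6]) (branchFalse (l := rest) (by simp [h2, encNat])
      ((pop S 2).seq (pop _ 6))) (loopDone (by simp [h6]))).cast ?_ (by omega)
    funext x
    simp only [Function.update_apply]
    split_ifs <;> simp_all [encNat]
  | succ k ih =>
    have h2' : S 2 = true :: (encNat k ++ rest) := by simp [h2, encNat, List.replicate_succ]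
    refine (loopStep (by simp [h6]) (branchTrue h2'
      ((pop S 2).seq (pushTrues _ 5 K))) (ih (by simp [h2']) (by simp [h6]))).cast ?_ ?_
    · funext x
      simp only [Function.update_apply]
      split_ifs <;> simp_all [Nat.mul_succ]
      rw [← List.append_assoc, List.replicate_append_replicate]
    · have e : (k + 1) * (2 * K + 5) = k * (2 * K + 5) + (2 * K + 5) := by ring
      omega

/-- The new name b + K·k is assembled as a copy of b, then K digits for each digit read, then the
end marker. It therefore stands on stack 5 in reverse, and moving that stack to the output restores
the order. -/
lemma readArg {K k b : ℕ} {rest : List Bool} {S : Store} (h2 : S 2 = encNat k ++ rest)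
    (h3 : S 3 = []) (h4 : S 4 = List.replicate b true) (h6 : S 6 = []) :
    Takes (Prog.readArg K) S (Function.update (Function.update S 2 rest) 5
      ((encNat (b + K * k)).reverse ++ S 5)) (12 * b + k * (2 * K + 5) + 14) := by
  refine ((prepend (r := 4) (r' := 5) (z := 3) (by omega) (by omega) (by omega) h3).seq
    ((push _ 6 true).seq ((readMul (k := k) (rest := rest) ?_ ?_).seq (push _ 5 false)))).cast ?_ ?_
  · simpa using h2
  · simp [h6]
  · funext x
    simp only [Function.update_apply]
    split_ifs <;> simp_all [encNat]
    rw [← List.append_assoc, List.replicate_append_replicate, Nat.add_comm]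
  · simp only [h4, List.length_replicate]
    omega

lemma readArgs {K b : ℕ} {l : List ℕ} {rest : List Bool} {S : Store}
    (h2 : S 2 = l.flatMap encNat ++ rest)
    (h3 : S 3 = []) (h4 : S 4 = List.replicate b true) (h6 : S 6 = []) :
    Takes (Prog.readArgs K l.length) S (Function.update (Function.update S 2 rest) 5
      (((l.map fun k => b + K * k).flatMap encNat).reverse ++ S 5))
      (l.length * (12 * b + 15) + (l.flatMap encNat).length * (2 * K + 5) + 1) := by
  induction l generalizing S with
  | nil =>
    refine (skip S).cast ?_ (by simp)
    funext x
    simp only [Function.update_apply]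
    split_ifs <;> simp_all
  | cons k l ih =>
    refine ((readArg (k := k) (by simpa using h2) h3 h4 h6).seq (ih ?_ ?_ ?_ ?_)).cast ?_ ?_
    · simp
    · simpa using h3
    · simpa using h4
    · simpa using h6
    · funext x
      simp only [Function.update_apply]
      split_ifs <;> simp_all
    · simp only [List.length_cons, List.flatMap_cons, List.length_append]
      have e1 : (l.length + 1) * (12 * b + 15) = l.length * (12 * b + 15) + (12 * b + 15) := by ring
      have e2 : (encNat k).length = k + 1 := by simp [encNat]
      rw [e1, e2, Nat.add_mul, Nat.add_mul]
      omega

/-- Each digit of the unary tag drops one entry of the table `L`, so at the end marker the head of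
the table is the number of wires to read. -/
lemma readGate {K b t : ℕ} {L : List ℕ} {l : List ℕ} {rest : List Bool} {S : Store}
    (hL : L[t]? = some l.length) (h2 : S 2 = encNat t ++ l.flatMap encNat ++ rest)
    (h3 : S 3 = []) (h4 : S 4 = List.replicate b true) (h6 : S 6 = []) :
    Takes (Prog.readGate K L) S (Function.update (Function.update S 2 rest) 5
      ((encNat t ++ (l.map fun k => b + K * k).flatMap encNat).reverse ++ S 5))
      (5 * (t + 1) +
        (l.length * (12 * b + 15) + (l.flatMap encNat).length * (2 * K + 5) + 1)) := by
  induction t generalizing S L with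
  | zero =>
    obtain ⟨L', rfl⟩ : ∃ L', L = l.length :: L' := by
      cases L with
      | nil => simp at hL
      | cons a L' => exact ⟨L', by simpa using hL⟩
    have h2' : S 2 = false :: (l.flatMap encNat ++ rest) := by simpa [encNat] using h2
    refine (branchFalse h2' ((pop S 2).seq ((push _ 5 false).seq (readArgs (b := b) (l := l)
      (rest := rest) ?_ ?_ ?_ ?_)))).cast ?_ (by omega)
    · simp [h2']
    · simpa using h3
    · simpa using h4
    · simpa using h6
    · funext x
      simp only [Function.update_apply]
      split_ifs <;> simp_all [encNat]
  | succ t ih =>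
    obtain ⟨a, L', rfl⟩ : ∃ a L', L = a :: L' := by
      cases L with
      | nil => simp at hL
      | cons a L' => exact ⟨a, L', rfl⟩
    have h2' : S 2 = true :: (encNat t ++ l.flatMap encNat ++ rest) := by
      simpa [encNat, List.replicate_succ] using h2
    refine (branchTrue h2' ((pop S 2).seq ((push _ 5 true).seq (ih (L := L') ?_ ?_ ?_ ?_ ?_)))).cast
      ?_ (by omega)
    · simpa using hL
    · simp [h2']
    · simpa using h3
    · simpa using h4
    · simpa using h6
    · funext x
      simp only [Function.update_apply]
      split_ifs <;> simp_all [encNat, List.replicate_succ]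

lemma relabelGate {K b : ℕ} {g : QGate} {rest : List Bool} {S : Store}
    (h2 : S 2 = g.code ++ rest)
    (h3 : S 3 = []) (h4 : S 4 = List.replicate b true) (h5 : S 5 = []) (h6 : S 6 = []) :
    Takes (Prog.relabelGate K) S (Function.update (Function.update S 2 rest) 1
      ((g.map fun k => b + K * k).code ++ S 1))
      (120 + 60 * b + 10 * ((K + 1) * g.code.length)) := by
  have h := (readGate (K := K) (b := b) (rest := rest) g.getElem?_tag (by rw [h2, g.code_eq]) h3 h4
    h6).seq (moveAll (r := 5) (z := 1) (by omega) _)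
  refine h.cast ?_ ?_
  · funext x
    simp only [Function.update_apply, QGate.code_map]
    split_ifs <;> simp_all
  · simp only [Function.update_self, h5, List.append_nil, List.length_reverse]
    -- In unary, the name b + K·k costs b more than at most K + 1 times the old name. With at most
    -- three wires per gate this bounds the length of the renamed gate.
    have h7 : ∀ l : List ℕ, ((l.map fun k => b + K * k).flatMap encNat).length ≤
        l.length * b + (K + 1) * (l.flatMap encNat).length := by
      intro l
      induction l with
      | nil => simp
      | cons k l ih =>
        simp only [List.map_cons, List.flatMap_cons, List.length_append, List.length_cons]
        have e2 : ∀ k, (encNat k).length = k + 1 := by simp [encNat]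
        rw [e2, e2]
        nlinarith
    have h8 := h7 g.wires
    have e : g.code.length = g.tag + 1 + (g.wires.flatMap encNat).length := by
      rw [g.code_eq, List.length_append]; simp only [encNat, List.length_append, List.length_replicate, List.length_singleton]
    have ht := g.tag_le
    have hw := g.length_wires_le
    have hwb : g.wires.length * b ≤ 3 * b := Nat.mul_le_mul_right _ hw
    have hwb' : g.wires.length * (12 * b + 15) ≤ 3 * (12 * b + 15) := Nat.mul_le_mul_right _ hw
    rw [List.length_append, e]
    have e3 : (encNat g.tag).length = g.tag + 1 := by simp [encNat]
    rw [e3]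
    set X := (g.wires.flatMap encNat).length
    have e4 : X * (2 * K + 5) ≤ 5 * ((K + 1) * X) := by nlinarith
    have e5 : (K + 1) * X ≤ (K + 1) * (g.tag + 1 + X) := Nat.mul_le_mul_left _ (by omega)
    omega

/-- Every renamed gate is placed in front of the earlier ones, which reverses the circuit. The
reversal is useful in itself, for uncomputation. -/
lemma relabelAll {K b M : ℕ} {l : List QGate} {S : Store} (hM : ∀ g ∈ l, g.code.length ≤ M)
    (h2 : S 2 = l.flatMap QGate.code)
    (h3 : S 3 = []) (h4 : S 4 = List.replicate b true) (h5 : S 5 = []) (h6 : S 6 = []) :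
    Takes (.loop 2 (Prog.relabelGate K)) S (Function.update (Function.update S 2 []) 1
      (((l.map (QGate.map fun k => b + K * k)).reverse).flatMap QGate.code ++ S 1))
      (l.length * (121 + 60 * b + 10 * ((K + 1) * M)) + 1) := by
  induction l generalizing S with
  | nil =>
    refine (loopDone (by simpa using h2)).cast ?_ (by simp)
    funext x
    simp only [Function.update_apply]
    split_ifs <;> simp_all
  | cons g l ih =>
    have h2' : S 2 = g.code ++ l.flatMap QGate.code := by simpa using h2
    refine (loopStep ?_ (relabelGate h2' h3 h4 h5 h6) (ih (fun g' hg' => hM g' (by simp [hg']))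
      ?_ ?_ ?_ ?_ ?_)).cast ?_ ?_
    · rw [h2', g.code_eq]; simp [encNat]
    · simp
    · simpa using h3
    · simpa using h4
    · simpa using h5
    · simpa using h6
    · funext x
      simp only [Function.update_apply]
      split_ifs <;> simp_all
    · have h7 : (K + 1) * g.code.length ≤ (K + 1) * M := Nat.mul_le_mul_left _ (hM g (by simp))
      have e : ∀ c, (l.length + 1) * c = l.length * c + c := fun c => by ring
      rw [List.length_cons, e]
      omega

end Takes

/-- Printing a circuit in reverse order and with its wires renamed by an affine function. -/
lemma polyTime_reverse_relabel {C : ℕ → List QGate} (hC : PolyTime fun n => (C n).flatMap QGate.code)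
    (L : PolyLen) (K : ℕ) :
    PolyTime fun n =>
      (((C n).map (QGate.map fun k => L.len n + K * k)).reverse).flatMap QGate.code := by
  obtain ⟨p, f, hf, hp⟩ := hC.call (j := 2) (c := 7) (by omega) (by omega)
  obtain ⟨q, g, hg, hq⟩ := L.poly.call (j := 4) (c := 7) (by omega) (by omega)
  have hM := hC.length_bdd
  set M := fun n => ((C n).flatMap QGate.code).length
  refine .of_takes (.seq (.seq p q) (.loop 2 (Prog.relabelGate K)))
    (f := fun n => (f n + g n + 1) + (M n * (121 + 60 * L.len n + 10 * ((K + 1) * M n)) + 1) + 1)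
    ?_ fun n => ?_
  · exact (((hf.add hg).add (.const 1)).add ((hM.mul (((PolyBdd.const 121).add
      ((PolyBdd.const 60).mul L.bdd)).add ((PolyBdd.const 10).mul ((PolyBdd.const _).mul hM)))).add
        (.const 1))).add (.const 1)
  have h1 := hp n (initStore n) (by simp [initStore]) (by simp [initStore])
    (fun r hr => by simp [initStore]; omega)
  have h2 := hq n (Function.update (initStore n) 2 ((C n).flatMap QGate.code)) (by simp [initStore])
    (by simp [initStore]) (fun r hr => by
      rw [Function.update_of_ne (by omega)]; simp [initStore]; omega)
  -- A printed gate is not empty, so the number of rounds is at most the printed length, which is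
  -- polynomial.
  have hlen : ∀ l : List QGate, l.length ≤ (l.flatMap QGate.code).length := by
    intro l
    induction l with
    | nil => simp
    | cons g l ih =>
      have : 1 ≤ g.code.length := by rw [g.code_eq]; simp [encNat]; omega
      simp only [List.flatMap_cons, List.length_append, List.length_cons]
      omega
  have hmem : ∀ g ∈ C n, g.code.length ≤ M n := by
    intro g hg
    simp only [M, List.length_flatMap]
    exact List.single_le_sum (by simp) _ (List.mem_map_of_mem hg)
  refine ⟨_, ((h1.seq h2).seq (Takes.relabelAll (b := L.len n) hmem ?_ ?_ ?_ ?_ ?_)).mono ?_, ?_⟩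
  · simp
  · simp [initStore]
  · simp
  · simp [initStore]
  · simp [initStore]
  · have := Nat.mul_le_mul_right (121 + 60 * L.len n + 10 * ((K + 1) * M n)) (hlen (C n))
    simp only [M] at this ⊢
    omega
  · simp [initStore]

/-! ## Classical circuits -/

/-- Action of a classical circuit. -/
def runC (C : List CGate) (s : Wires) : Wires := C.foldl (fun s g => g.act s) s

@[simp] lemma runC_nil (s : Wires) : runC [] s = s := rfl

@[simp] lemma runC_cons (g : CGate) (C : List CGate) (s : Wires) :
    runC (g :: C) s = runC C (g.act s) := rfl

@[simp] lemma runC_append (C D : List CGate) (s : Wires) :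
    runC (C ++ D) s = runC D (runC C s) := by simp [runC]

lemma CGate.act_act (g : CGate) (s : Wires) : g.act (g.act s) = s := by
  cases g with
  | not k => simp [act]
  | cnot i k =>
    simp only [act]
    split_ifs with h
    · rfl
    · funext x
      by_cases hx : x = k <;> simp [hx, h]
  | toffoli i j k =>
    simp only [act]
    split_ifs with h
    · rfl
    · push Not at h
      funext x
      by_cases hx : x = k <;> simp [hx, h.1, h.2]

/-- Every classical gate is an involution, so the reversed circuit uncomputes. -/
lemma runC_reverse (C : List CGate) (s : Wires) : runC C.reverse (runC C s) = s := by
  induction C generalizing s with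
  | nil => rfl
  | cons g C ih => simp [ih, CGate.act_act]

/-! ## Registers

The wires below `L` form register `0`; the other wires are distributed over the registers
`1`, …, `K` in turn. -/

/-- Position of the first wire of a register. -/
def regBase (L : ℕ) : ℕ → ℕ
  | 0 => 0
  | r + 1 => L + r

/-- Distance of consecutive wires of a register. -/
def regStride (K : ℕ) : ℕ → ℕ
  | 0 => 1
  | _ + 1 => K

/-- Position of wire `i` of register `r`. -/
def wire (L K r i : ℕ) : ℕ := regBase L r + regStride K r * i

/-- All wires, from the contents of the registers. -/
def enc (L K : ℕ) (B : ℕ → Wires) : Wires :=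
  fun i => if i < L then B 0 i else B ((i - L) % K + 1) ((i - L) / K)

/-- `i` is a wire of register `r`. -/
def ValidWire (L K r i : ℕ) : Prop := r ≤ K ∧ (r = 0 → i < L)

lemma wire_succ (L K r i : ℕ) : wire L K (r + 1) i = L + r + K * i := rfl

lemma enc_wire {L K r i : ℕ} (h : ValidWire L K r i) (B : ℕ → Wires) :
    enc L K B (wire L K r i) = B r i := by
  rcases r with _ | r
  · have := h.2 rfl
    simp [enc, wire, regBase, regStride, this]
  · have hr : r < K := h.1
    rw [wire_succ, enc, if_neg (by omega)]
    have e : L + r + K * i - L = r + K * i := by omega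
    rw [e, Nat.add_mul_mod_self_left, Nat.mod_eq_of_lt hr, Nat.add_mul_div_left _ _ (by omega),
      Nat.div_eq_of_lt hr, zero_add]

/-- Division with remainder by K recovers register and index from a position. Distinct register
wires therefore never collide, and an update of one wire touches one register only. -/
lemma eq_wire_iff {L K r i x : ℕ} (h : ValidWire L K r i) :
    x = wire L K r i ↔ (if x < L then r = 0 ∧ x = i else
      r = (x - L) % K + 1 ∧ i = (x - L) / K) := by
  rcases r with _ | r
  · have := h.2 rfl
    simp only [wire, regBase, regStride, zero_add, one_mul]
    split_ifs with hx
    · simp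
    · exact ⟨fun h => absurd h (by omega), fun h => h.1.elim⟩
  · have hr : r < K := h.1
    rw [wire_succ]
    split_ifs with hx
    · exact ⟨fun h => absurd h (by omega), fun h => h.1.elim⟩
    · constructor
      · rintro rfl
        have e : L + r + K * i - L = r + K * i := by omega
        rw [e, Nat.add_mul_mod_self_left, Nat.mod_eq_of_lt hr, Nat.add_mul_div_left _ _ (by omega),
          Nat.div_eq_of_lt hr, zero_add]
        exact ⟨rfl, rfl⟩
      · rintro ⟨h1, h2⟩
        have := Nat.mod_add_div (x - L) K
        rw [← h2] at this
        omega

lemma wire_inj {L K r r' i i' : ℕ} (h : ValidWire L K r i) (h' : ValidWire L K r' i')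
    (e : wire L K r i = wire L K r' i') : r = r' ∧ i = i' := by
  have h1 := (eq_wire_iff (x := wire L K r i) h).1 rfl
  have h2 := (eq_wire_iff h').1 e
  split_ifs at h1 h2 with hx
  · exact ⟨h1.1.trans h2.1.symm, h1.2.symm.trans h2.2⟩
  · exact ⟨h1.1.trans h2.1.symm, h1.2.trans h2.2.symm⟩

lemma wire_succ_injective {L K r : ℕ} (hr : r < K) : Function.Injective (wire L K (r + 1)) :=
  fun _ _ e => (wire_inj ⟨hr, by simp⟩ ⟨hr, by simp⟩ e).2

lemma enc_update {L K r i : ℕ} (h : ValidWire L K r i) (B : ℕ → Wires) (v : Bool) :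
    enc L K (Function.update B r (Function.update (B r) i v)) =
      Function.update (enc L K B) (wire L K r i) v := by
  funext x
  simp only [Function.update_apply (enc L K B), eq_wire_iff h]
  simp only [enc]
  split_ifs with h1 h2 h2
  · rw [← h2.1, Function.update_self, h2.2, Function.update_self]
  · by_cases h3 : r = 0
    · subst h3
      rw [Function.update_self, Function.update_of_ne (by tauto)]
    · rw [Function.update_of_ne (Ne.symm h3)]
  · rw [← h2.1, Function.update_self, h2.2, Function.update_self]
  · by_cases h3 : r = (x - L) % K + 1
    · rw [← h3, Function.update_self, Function.update_of_ne]
      intro h4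
      exact h2 ⟨h3, h4.symm⟩
    · rw [Function.update_of_ne (Ne.symm h3)]

lemma enc_load {L K : ℕ} {l : List Bool} (h : l.length ≤ L) :
    load l = enc L K (Function.update (fun _ => load []) 0 (load l)) := by
  funext i
  simp only [enc]
  split_ifs with hi
  · simp
  · simp [load, List.getElem?_eq_none (show l.length ≤ i by omega)]

/-! ## Circuits on registers -/

/-- Add `m` wires of register `r` from `a` on to those of register `r'` from `b` on. -/
def xorC (L K r a r' b m : ℕ) : List CGate :=
  downList (fun i => [.cnot (wire L K r (a + i)) (wire L K r' (b + i))]) m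

/-- Bitwise sum of `t` on the `m` positions from `b` on with those of `s` from `a` on. -/
def xorSeg (t s : Wires) (a b m : ℕ) : Wires :=
  fun i => if b ≤ i ∧ i < b + m then xor (t i) (s (a + (i - b))) else t i

lemma run_xorC {L K r a r' b m : ℕ} (hr : r ≠ r') (hK : r ≤ K) (hK' : r' ≤ K)
    (h : r = 0 → a + m ≤ L) (h' : r' = 0 → b + m ≤ L) (B : ℕ → Wires) :
    runC (xorC L K r a r' b m) (enc L K B) =
      enc L K (Function.update B r' (xorSeg (B r') (B r) a b m)) := by
  induction m generalizing B with
  | zero =>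
    have : xorSeg (B r') (B r) a b 0 = B r' := by
      funext i; simp only [xorSeg]; rw [if_neg (by omega)]
    rw [this, Function.update_eq_self]; rfl
  | succ m ih =>
    have v : ValidWire L K r (a + m) := ⟨hK, fun h0 => by have := h h0; omega⟩
    have v' : ValidWire L K r' (b + m) := ⟨hK', fun h0 => by have := h' h0; omega⟩
    simp only [xorC, downList, List.singleton_append, runC_cons, CGate.act]
    rw [if_neg (fun e => hr (wire_inj v v' e).1), enc_wire v, enc_wire v', ← enc_update v']
    refine (ih (fun h0 => by have := h h0; omega) (fun h0 => by have := h' h0; omega) _).trans ?_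
    congr 1
    rw [Function.update_idem, Function.update_self, Function.update_of_ne hr]
    congr 1
    funext i
    simp only [xorSeg, Function.update_apply]
    by_cases h1 : i = b + m
    · subst h1
      simp
    · simp only [h1, if_false]
      by_cases h2 : b ≤ i ∧ i < b + m
      · rw [if_pos h2, if_pos (by omega)]
      · rw [if_neg h2, if_neg (by omega)]

/-- A circuit on register `r`. -/
def blockC (L K r : ℕ) (C : List CGate) : List CGate := C.map (CGate.map (wire L K r))

/-- Injectivity of the renaming matters because a gate whose target is one of its controls acts
trivially, and renaming must neither create nor destroy such a coincidence. -/
lemma act_map_wire {L K r : ℕ} (hr : r < K) (g : CGate) (B : ℕ → Wires) :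
    (g.map (wire L K (r + 1))).act (enc L K B) =
      enc L K (Function.update B (r + 1) (g.act (B (r + 1)))) := by
  have v : ∀ i, ValidWire L K (r + 1) i := fun i => ⟨hr, by simp⟩
  have inj : ∀ i j, wire L K (r + 1) i = wire L K (r + 1) j ↔ i = j :=
    fun i j => (wire_succ_injective hr).eq_iff
  cases g with
  | not k => simp only [CGate.map, CGate.act, enc_wire (v _), enc_update (v _)]
  | cnot i k =>
    simp only [CGate.map, CGate.act, enc_wire (v _), inj]
    split_ifs
    · rw [Function.update_eq_self]
    · rw [enc_update (v _)]
  | toffoli i j k =>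
    simp only [CGate.map, CGate.act, enc_wire (v _), inj]
    split_ifs
    · rw [Function.update_eq_self]
    · rw [enc_update (v _)]

lemma run_blockC {L K r : ℕ} (hr : r < K) (C : List CGate) (B : ℕ → Wires) :
    runC (blockC L K (r + 1) C) (enc L K B) =
      enc L K (Function.update B (r + 1) (runC C (B (r + 1)))) := by
  induction C generalizing B with
  | nil => simp [blockC]
  | cons g C ih =>
    simp only [blockC, List.map_cons, runC_cons, act_map_wire hr]
    refine (ih _).trans ?_
    rw [Function.update_idem, Function.update_self]

lemma run_blockC_reverse {L K r : ℕ} (hr : r < K) (C : List CGate) (B : ℕ → Wires) (w : Wires) :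
    runC (blockC L K (r + 1) C).reverse (enc L K (Function.update B (r + 1) (runC C w))) =
      enc L K (Function.update B (r + 1) w) := by
  have h := run_blockC (L := L) hr C (Function.update B (r + 1) w)
  rw [Function.update_idem, Function.update_self] at h
  rw [← h, runC_reverse]

/-! ## Contents of registers -/

@[simp] lemma length_ofFn_str {m : ℕ} (v : Str m) : (List.ofFn v).length = m := by simp

lemma load_append (l l' : List Bool) (i : ℕ) :
    load (l ++ l') i = if i < l.length then load l i else load l' (i - l.length) := by
  simp only [load, List.getD_eq_getElem?_getD, List.getElem?_append]
  split_ifs <;> rfl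

lemma load_of_le {l : List Bool} {i : ℕ} (h : l.length ≤ i) : load l i = false := by
  simp [load, List.getElem?_eq_none h]

lemma load_ofFn {m : ℕ} (v : Str m) (i : Fin m) : load (List.ofFn v) i = v i := by
  simp [load]

lemma load_ofFn_readStr (s : Wires) (a m i : ℕ) :
    load (List.ofFn (readStr s a m)) i = if i < m then s (a + i) else false := by
  split_ifs with h
  · exact load_ofFn _ ⟨i, h⟩
  · exact load_of_le (by simpa using h)

@[simp] lemma load_nil (i : ℕ) : load [] i = false := rfl

lemma xorSeg_load {l : List Bool} {s : Wires} {a b m : ℕ} (hb : l.length = b) :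
    xorSeg (load l) s a b m = load (l ++ List.ofFn (readStr s a m)) := by
  funext i
  rw [load_append, load_ofFn_readStr, hb]
  simp only [xorSeg]
  by_cases h1 : i < b
  · rw [if_neg (by omega), if_pos h1]
  · rw [if_neg h1, load_of_le (by omega)]
    by_cases h2 : i - b < m
    · rw [if_pos (by omega), if_pos h2, Bool.false_xor]
    · rw [if_neg (by omega), if_neg h2]

lemma xorSeg_xorSeg (t s : Wires) (a b m : ℕ) : xorSeg (xorSeg t s a b m) s a b m = t := by
  funext i
  simp only [xorSeg]
  split_ifs <;> simp

/-- Adding a copy held in another register erases the original. This is how the input is removed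
from the main register. -/
lemma xorSeg_self {s : Wires} {m : ℕ} (h : ∀ i, m ≤ i → s i = false) :
    xorSeg s s 0 0 m = load [] := by
  funext i
  simp only [xorSeg, load_nil]
  split_ifs with h1
  · simp
  · exact h i (by omega)

lemma readStr_load_append {m : ℕ} {l l' : List Bool} {v : Str m} {a : ℕ} (ha : l.length = a) :
    readStr (load (l ++ (List.ofFn v ++ l'))) a m = v := by
  funext i
  simp only [readStr]
  rw [load_append, if_neg (by omega), load_append, if_pos (by simp; omega)]
  rw [← load_ofFn v i]
  congr 1
  omega

/-- A segment is set to zero by adding a second copy of it, and its surroundings are untouched. -/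
lemma xorSeg_erase {m : ℕ} {l l' : List Bool} {v : Str m} {s : Wires} {a b : ℕ}
    (hb : l.length = b) (hs : readStr s a m = v) :
    xorSeg (load (l ++ (List.ofFn v ++ l'))) s a b m =
      load (l ++ (List.ofFn (fun _ : Fin m => false) ++ l')) := by
  funext i
  simp only [xorSeg, load_append, hb, length_ofFn_str]
  by_cases h1 : i < b
  · simp [h1]
  · by_cases h2 : i < b + m
    · have e1 := load_ofFn v ⟨i - b, by omega⟩
      have e2 := load_ofFn (fun _ : Fin m => false) ⟨i - b, by omega⟩
      simp only at e1 e2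
      rw [if_pos ⟨by omega, h2⟩, if_neg h1, if_pos (by omega), if_neg h1, if_pos (by omega), e1, e2,
        ← hs]
      simp [readStr]
    · rw [if_neg (by omega), if_neg h1, if_neg (by omega), if_neg h1, if_neg (by omega)]

/-! ## Uniformity -/

/-- The family of circuits is printed in polynomial time. -/
def Uniform (C : ℕ → List QGate) : Prop := PolyTime fun n => (C n).flatMap QGate.code

/-- The family of classical circuits is printed in polynomial time. -/
def UniformC (C : ℕ → List CGate) : Prop := PolyTime fun n => (C n).flatMap CGate.code

lemma Uniform.append {C D : ℕ → List QGate} (hC : Uniform C) (hD : Uniform D) :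
    Uniform fun n => C n ++ D n := by
  simpa only [Uniform, List.flatMap_append] using PolyTime.append hC hD

lemma UniformC.append {C D : ℕ → List CGate} (hC : UniformC C) (hD : UniformC D) :
    UniformC fun n => C n ++ D n := by
  simpa only [UniformC, List.flatMap_append] using PolyTime.append hC hD

lemma flatMap_code_classical (C : List CGate) :
    (C.map QGate.classical).flatMap QGate.code = C.flatMap CGate.code := by
  rw [List.flatMap_map]; rfl

lemma uniform_classical {C : ℕ → List CGate} :
    Uniform (fun n => (C n).map QGate.classical) ↔ UniformC C := by
  simp only [Uniform, UniformC, flatMap_code_classical]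

lemma QGate.map_id : QGate.map (fun k => k) = id := by
  funext g
  rcases g with ⟨_ | _ | _⟩ | _ | _ <;> rfl

/-- With base 0 and stride 1 the renaming is the identity, and only the reversal remains. -/
lemma Uniform.reverse {C : ℕ → List QGate} (hC : Uniform C) : Uniform fun n => (C n).reverse := by
  simpa [QGate.map_id, Uniform] using polyTime_reverse_relabel hC (.const 0) 1

/-- The wires of a register are an affine function of the index, and a second reversal restores the
order of the gates. -/
lemma Uniform.map_wire {C : ℕ → List QGate} (hC : Uniform C) (L : PolyLen) (K r : ℕ) :
    Uniform fun n => (C n).map (QGate.map (wire (L.len n) K (r + 1))) := by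
  have h := Uniform.reverse (polyTime_reverse_relabel hC (L + .const r) K)
  simp only [List.reverse_reverse] at h
  exact h

lemma UniformC.reverse {C : ℕ → List CGate} (hC : UniformC C) :
    UniformC fun n => (C n).reverse := by
  have h := (uniform_classical.2 hC).reverse
  simp only [← List.map_reverse] at h
  exact uniform_classical.1 h

lemma UniformC.blockC {C : ℕ → List CGate} (hC : UniformC C) (L : PolyLen) (K r : ℕ) :
    UniformC fun n => blockC (L.len n) K (r + 1) (C n) := by
  have h := (uniform_classical.2 hC).map_wire L K r
  simp only [List.map_map] at h
  refine uniform_classical.1 ?_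
  simp only [PoQ.blockC, List.map_map]
  exact h

/-- The position of the first wire of a register, as a length. -/
def regBaseLen (L : PolyLen) : ℕ → PolyLen
  | 0 => .const 0
  | r + 1 => L + .const r

lemma regBaseLen_len (L : PolyLen) (r n : ℕ) : (regBaseLen L r).len n = regBase (L.len n) r := by
  cases r <;> rfl

/-- The position of a wire, as a length. -/
def wireLen (L : PolyLen) (K r : ℕ) (a : PolyLen) : PolyLen :=
  regBaseLen L r + .mul (regStride K r) a

@[simp] lemma wireLen_len (L : PolyLen) (K r : ℕ) (a : PolyLen) (n : ℕ) :
    (wireLen L K r a).len n = wire (L.len n) K r (a.len n) := by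
  simp [wireLen, wire, regBaseLen_len]

lemma wire_add (L K r a i : ℕ) : wire L K r (a + i) = wire L K r a + regStride K r * i := by
  simp only [wire]; ring

lemma uniformC_xorC (L : PolyLen) (K r : ℕ) (a : PolyLen) (r' : ℕ) (b m : PolyLen) :
    UniformC fun n => xorC (L.len n) K r (a.len n) r' (b.len n) (m.len n) := by
  have h := polyTime_downList_tokens m
    (fun j => if j = 0 then .const 1 else if j = 1 then wireLen L K r a else wireLen L K r' b)
    (fun j => if j = 0 then 0 else if j = 1 then regStride K r else regStride K r') 3
  simp only [UniformC, xorC, downList_flatMap]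
  simpa [tokens, List.range_succ, CGate.code, wire_add] using h

lemma uniformC_not (k : PolyLen) : UniformC fun n => [.not (k.len n)] := by
  have h := polyTime_downList_tokens (.const 1) (fun j => if j = 0 then .const 0 else k)
    (fun _ => 0) 2
  simpa [UniformC, downList, tokens, List.range_succ, CGate.code] using h

lemma uniformC_toffoli (i j k : PolyLen) :
    UniformC fun n => [.toffoli (i.len n) (j.len n) (k.len n)] := by
  have h := polyTime_downList_tokens (.const 1)
    (fun t => if t = 0 then .const 2 else if t = 1 then i else if t = 2 then j else k)
    (fun _ => 0) 4
  simpa [UniformC, downList, tokens, List.range_succ, CGate.code] using h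

/-- Hadamard gates on the `m` wires from `o` on. -/
def hadC (o m : ℕ) : List QGate := downList (fun i => [.hadamard (o + i)]) m

lemma uniform_hadC (o m : PolyLen) : Uniform fun n => hadC (o.len n) (m.len n) := by
  have h := polyTime_downList_tokens m (fun j => if j = 0 then .const 3 else o)
    (fun j => if j = 0 then 0 else 1) 2
  simp only [Uniform, hadC, downList_flatMap]
  simpa [tokens, List.range_succ, QGate.code] using h

/-- Copying fewer bits than the field is wide leaves zeros in the rest. With one bit this produces
the padded branch `bitStr`. -/
lemma xorSeg_load_trunc {l : List Bool} {s : Wires} {b m m' : ℕ} (hb : l.length = b)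
    (hm : m ≤ m') : xorSeg (load l) s 0 b m =
      load (l ++ List.ofFn (fun i : Fin m' => decide ((i : ℕ) < m) && s i)) := by
  funext i
  simp only [xorSeg, load_append, hb]
  by_cases h1 : i < b
  · rw [if_neg (by omega), if_pos h1]
  · rw [if_neg h1, load_of_le (by omega)]
    by_cases h2 : i - b < m'
    · have e := load_ofFn (fun i : Fin m' => decide ((i : ℕ) < m) && s i) ⟨i - b, h2⟩
      simp only at e
      rw [e]
      by_cases h3 : i - b < m
      · rw [if_pos (by omega)]; simp [h3]
      · rw [if_neg (by omega)]; simp [h3]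
    · rw [if_neg (by omega), load_of_le (by simpa using h2)]

lemma act_toffoli {L K r i r' i' r'' i'' : ℕ} (h : ValidWire L K r i) (h' : ValidWire L K r' i')
    (h'' : ValidWire L K r'' i'') (hr : r ≠ r'' ∨ i ≠ i'') (hr' : r' ≠ r'' ∨ i' ≠ i'')
    (B : ℕ → Wires) :
    (CGate.toffoli (wire L K r i) (wire L K r' i') (wire L K r'' i'')).act (enc L K B) =
      enc L K (Function.update B r''
        (Function.update (B r'') i'' (xor (B r'' i'') (B r i && B r' i')))) := by
  simp only [CGate.act]
  rw [if_neg, enc_wire h, enc_wire h', enc_wire h'', enc_update h'']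
  rintro (e | e)
  · have := wire_inj h h'' e; tauto
  · have := wire_inj h' h'' e; tauto

lemma act_not {L K r i : ℕ} (h : ValidWire L K r i) (B : ℕ → Wires) :
    (CGate.not (wire L K r i)).act (enc L K B) =
      enc L K (Function.update B r (Function.update (B r) i (!(B r i)))) := by
  simp only [CGate.act]
  rw [enc_wire h, enc_update h]

/-- The registers with the contents listed, followed by empty registers. -/
def cfg (l : List Wires) : ℕ → Wires := fun r => l.getD r (load [])

lemma update_cfg {l : List Wires} {r : ℕ} (hr : r < l.length) (w : Wires) :
    Function.update (cfg l) r w = cfg (l.set r w) := by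
  funext x
  simp only [Function.update_apply, cfg, List.getD_eq_getElem?_getD, List.getElem?_set]
  by_cases h : x = r
  · simp [h, hr]
  · simp [h, Ne.symm h]

lemma run_xorC_cfg {L K r a r' b m : ℕ} {l : List Wires} {w : Wires}
    (hw : xorSeg (cfg l r') (cfg l r) a b m = w) (hr : r ≠ r') (hK : r ≤ K) (hK' : r' ≤ K)
    (hl : r' < l.length) (h : r = 0 → a + m ≤ L) (h' : r' = 0 → b + m ≤ L) :
    runC (xorC L K r a r' b m) (enc L K (cfg l)) = enc L K (cfg (l.set r' w)) := by
  rw [run_xorC hr hK hK' h h', hw, update_cfg hl]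

lemma run_blockC_cfg {L K r : ℕ} {l : List Wires} {C : List CGate} (hr : r < K)
    (hl : r + 1 < l.length) :
    runC (blockC L K (r + 1) C) (enc L K (cfg l)) =
      enc L K (cfg (l.set (r + 1) (runC C (cfg l (r + 1))))) := by
  rw [run_blockC hr, update_cfg hl]

/-- The input fits below L, so it does not spill into the interleaved registers and all of these
start empty. -/
lemma enc_load_cfg {L K : ℕ} {l : List Bool} (h : l.length ≤ L) (m : ℕ) :
    load l = enc L K (cfg (load l :: List.replicate m (load []))) := by
  refine (enc_load (K := K) h).trans (congrArg _ ?_)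
  funext x
  rcases x with _ | x
  · rfl
  · simp only [cfg, List.getD_cons_succ]
    simp [List.getD_eq_getElem?_getD, List.getElem?_replicate]
    split_ifs <;> rfl

/-! ### The reductions of the soundness proof as circuits -/

section Distinguisher

variable (S : Setup) (A : PPT) (E : Alg)

/-- The circuits of the algorithm that runs the prover `A` and the extractor `E` on the same key and
coins, checks the extracted preimage, of whose branch only the first `bl` bits are used, and runs
the membership tests `dY` on the image, `dB` on a segment of the output of `E`, and `dX` on the
extracted preimage.  The output is `false` if all tests succeed. -/
def distinguisherCirc (bl off len : PolyLen) (dY dB dX : Alg) (n : ℕ) : List CGate :=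
  let L := S.keyLen.len n + A.coins.len n + 1
  let i := S.keyLen.len n + A.coins.len n
  let κ := S.keyLen.len n
  let R := S.ranLen.len n
  let β := S.branchLen.len n
  let δ := S.domLen.len n
  xorC L 7 0 0 1 0 i ++ xorC L 7 0 0 2 0 i ++ xorC L 7 0 0 3 0 κ ++ xorC L 7 1 0 0 0 i ++
  blockC L 7 1 (A.alg.circ n) ++ blockC L 7 2 (E.circ n) ++
  xorC L 7 1 0 3 κ R ++ xorC L 7 2 0 3 (κ + R) (bl.len n) ++ xorC L 7 2 β 3 (κ + R + β) δ ++
  blockC L 7 3 (S.chk.circ n) ++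
  xorC L 7 1 0 4 0 R ++ blockC L 7 4 (dY.circ n) ++
  xorC L 7 2 (off.len n) 5 0 (len.len n) ++ blockC L 7 5 (dB.circ n) ++
  xorC L 7 2 β 6 0 δ ++ blockC L 7 6 (dX.circ n) ++
  [.toffoli (wire L 7 4 0) (wire L 7 5 0) (wire L 7 7 0)] ++
  [.toffoli (wire L 7 3 0) (wire L 7 6 0) (wire L 7 7 1)] ++
  [.toffoli (wire L 7 7 0) (wire L 7 7 1) (wire L 7 0 0)] ++ [.not (wire L 7 0 0)]

lemma uniformC_distinguisherCirc (bl off len : PolyLen) (dY dB dX : Alg) :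
    UniformC (distinguisherCirc S A E bl off len dY dB dX) := by
  set L := S.keyLen + A.coins + PolyLen.const 1
  have hx : ∀ r a r' b m, UniformC fun n => xorC (L.len n) 7 r (PolyLen.len a n) r'
      (PolyLen.len b n) (PolyLen.len m n) := fun r a r' b m => uniformC_xorC L 7 r a r' b m
  have hb : ∀ r (A : Alg), UniformC fun n => blockC (L.len n) 7 (r + 1) (A.circ n) :=
    fun r A => UniformC.blockC A.poly L 7 r
  have ht : ∀ r i r' i' r'' i'', UniformC fun n => [.toffoli (wire (L.len n) 7 r i)
      (wire (L.len n) 7 r' i') (wire (L.len n) 7 r'' i'')] := by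
    intro r i r' i' r'' i''
    simpa using uniformC_toffoli (wireLen L 7 r (.const i)) (wireLen L 7 r' (.const i'))
      (wireLen L 7 r'' (.const i''))
  have hn : UniformC fun n => [.not (wire (L.len n) 7 0 0)] := by
    simpa using uniformC_not (wireLen L 7 0 (.const 0))
  exact (((((((((((((((((((
    (hx 0 (.const 0) 1 (.const 0) (S.keyLen + A.coins)).append
    (hx 0 (.const 0) 2 (.const 0) (S.keyLen + A.coins))).append
    (hx 0 (.const 0) 3 (.const 0) S.keyLen)).append
    (hx 1 (.const 0) 0 (.const 0) (S.keyLen + A.coins))).append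
    (hb 0 A.alg)).append (hb 1 E)).append
    (hx 1 (.const 0) 3 S.keyLen S.ranLen)).append
    (hx 2 (.const 0) 3 (S.keyLen + S.ranLen) bl)).append
    (hx 2 S.branchLen 3 (S.keyLen + S.ranLen + S.branchLen) S.domLen)).append
    (hb 2 S.chk)).append
    (hx 1 (.const 0) 4 (.const 0) S.ranLen)).append (hb 3 dY)).append
    (hx 2 off 5 (.const 0) len)).append (hb 4 dB)).append
    (hx 2 S.branchLen 6 (.const 0) S.domLen)).append (hb 5 dX)).append
    (ht 4 0 5 0 7 0)).append (ht 3 0 6 0 7 1)).append (ht 7 0 7 1 0 0)).append hn)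

/-- The algorithm with the circuits `distinguisherCirc`, which uses the coins of `A`. -/
def distinguisher (bl off len : PolyLen) (dY dB dX : Alg) : PPT where
  alg := ⟨_, uniformC_distinguisherCirc S A E bl off len dY dB dX⟩
  coins := A.coins

-- The input is copied to the registers of the prover and the extractor, and its key part to that of
-- the check. It is then erased from the main register, which frees wire 0 for the verdict. Three
-- Toffoli gates form the conjunction of the four test bits, and the final NOT turns success into
-- output 0. The extra wire in L keeps wire 0 inside the main register even for an empty input.
set_option maxHeartbeats 1000000 in
lemma distinguisher_run (bl off len : PolyLen) (dY dB dX : Alg) (n : ℕ) (k : S.Key n)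
    (r : Str (A.coins.len n)) (hbl : bl.len n ≤ S.branchLen.len n) :
    let y := readStr (A.run n (List.ofFn k) r) 0 (S.ranLen.len n)
    let e := E.run n (List.ofFn k ++ List.ofFn r)
    let x : S.Dom n := readStr e (S.branchLen.len n) (S.domLen.len n)
    (distinguisher S A E bl off len dY dB dX).run n (List.ofFn k) r 0 = false ↔
      dY.bit n (List.ofFn y) = true ∧
      dB.bit n (List.ofFn (readStr e (off.len n) (len.len n))) = true ∧
      S.check n k y (fun i => decide ((i : ℕ) < bl.len n) && e i) x = true ∧
      dX.bit n (List.ofFn x) = true := by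
  intro y e x
  obtain ⟨L, hL⟩ : ∃ L, L = S.keyLen.len n + A.coins.len n + 1 := ⟨_, rfl⟩
  set l := List.ofFn k ++ List.ofFn r with hl
  have hlen : l.length = S.keyLen.len n + A.coins.len n := by simp [hl]
  have hself : xorSeg (load l) (load l) 0 0 (S.keyLen.len n + A.coins.len n) = load [] :=
    xorSeg_self fun i hi => load_of_le (by omega)
  have hcopy : xorSeg (load []) (load l) 0 0 (S.keyLen.len n + A.coins.len n) = load l := by
    rw [xorSeg_load (b := 0) rfl, List.nil_append]
    funext i
    rw [load_ofFn_readStr]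
    split_ifs with h
    · rw [zero_add]
    · exact (load_of_le (by omega)).symm
  have hkey : xorSeg (load []) (load l) 0 0 (S.keyLen.len n) = load (List.ofFn k) := by
    rw [xorSeg_load (b := 0) rfl, List.nil_append, hl]
    congr 2
    exact readStr_load_append (l := []) rfl
  have hread : ∀ (w : Wires) a m, xorSeg (load []) w a 0 m = load (List.ofFn (readStr w a m)) :=
    fun w a m => by rw [xorSeg_load (b := 0) rfl, List.nil_append]
  set z := load [] with hz
  have hy : readStr (runC (A.alg.circ n) (load l)) 0 (S.ranLen.len n) = y := rfl
  have he : runC (E.circ n) (load l) = e := rfl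
  set a := runC (A.alg.circ n) (load l)
  set b : S.Branch n := fun i => decide ((i : ℕ) < bl.len n) && e i with hb
  set t := readStr e (off.len n) (len.len n) with ht
  set lc := List.ofFn k ++ List.ofFn y ++ List.ofFn b ++ List.ofFn x with hlc
  have h3a : xorSeg (load (List.ofFn k)) a 0 (S.keyLen.len n) (S.ranLen.len n) =
      load (List.ofFn k ++ List.ofFn y) := by rw [xorSeg_load (by simp), hy]
  have h3b : xorSeg (load (List.ofFn k ++ List.ofFn y)) e 0 (S.keyLen.len n + S.ranLen.len n)
      (bl.len n) = load (List.ofFn k ++ List.ofFn y ++ List.ofFn b) := by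
    rw [xorSeg_load_trunc (by simp) hbl]
  have h3c : xorSeg (load (List.ofFn k ++ List.ofFn y ++ List.ofFn b)) e (S.branchLen.len n)
      (S.keyLen.len n + S.ranLen.len n + S.branchLen.len n) (S.domLen.len n) = load lc := by
    rw [xorSeg_load (by simp; omega)]
  change runC (distinguisherCirc S A E bl off len dY dB dX n) (load l) 0 = false ↔ _
  rw [enc_load_cfg (L := L) (K := 7) (l := l) (by omega) 7]
  unfold distinguisherCirc
  simp only [runC_append, ← hL]
  set st : List Wires → Wires := fun l => enc L 7 (cfg l) with hst
  change runC _ (runC _ (runC _ (runC _ (runC _ (runC _ (runC _ (runC _ (runC _ (runC _ (runC _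
    (runC _ (runC _ (runC _ (runC _ (runC _ (runC _ (runC _ (runC _ (runC _
      (st [load l, z, z, z, z, z, z, z])))))))))))))))))))) 0 = false ↔ _
  -- Symbolic execution: each layer of the circuit rewrites one entry of the list of register
  -- contents.
  have s0 : runC (xorC L 7 0 0 1 0 (S.keyLen.len n + A.coins.len n)) (st [load l, z, z, z, z, z, z, z]) =
      st [load l, load l, z, z, z, z, z, z] :=
    run_xorC_cfg hcopy (by omega) (by omega) (by omega) (by simp) (by omega) (by omega)
  have s1 : runC (xorC L 7 0 0 2 0 (S.keyLen.len n + A.coins.len n)) (st [load l, load l, z, z, z, z, z, z]) =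
      st [load l, load l, load l, z, z, z, z, z] :=
    run_xorC_cfg hcopy (by omega) (by omega) (by omega) (by simp) (by omega) (by omega)
  have s2 : runC (xorC L 7 0 0 3 0 (S.keyLen.len n)) (st [load l, load l, load l, z, z, z, z, z]) =
      st [load l, load l, load l, load (List.ofFn k), z, z, z, z] :=
    run_xorC_cfg hkey (by omega) (by omega) (by omega) (by simp) (by omega) (by omega)
  have s3 : runC (xorC L 7 1 0 0 0 (S.keyLen.len n + A.coins.len n)) (st [load l, load l, load l, load (List.ofFn k), z, z, z, z]) =
      st [z, load l, load l, load (List.ofFn k), z, z, z, z] :=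
    run_xorC_cfg hself (by omega) (by omega) (by omega) (by simp) (by omega) (by omega)
  have s4 : runC (blockC L 7 1 (A.alg.circ n)) (st [z, load l, load l, load (List.ofFn k), z, z, z, z]) =
      st [z, a, load l, load (List.ofFn k), z, z, z, z] :=
    run_blockC_cfg (by omega) (by simp)
  have s5 : runC (blockC L 7 2 (E.circ n)) (st [z, a, load l, load (List.ofFn k), z, z, z, z]) =
      st [z, a, e, load (List.ofFn k), z, z, z, z] :=
    run_blockC_cfg (by omega) (by simp)
  have s6 : runC (xorC L 7 1 0 3 (S.keyLen.len n) (S.ranLen.len n)) (st [z, a, e, load (List.ofFn k), z, z, z, z]) =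
      st [z, a, e, load (List.ofFn k ++ List.ofFn y), z, z, z, z] :=
    run_xorC_cfg h3a (by omega) (by omega) (by omega) (by simp) (by omega) (by omega)
  have s7 : runC (xorC L 7 2 0 3 (S.keyLen.len n + S.ranLen.len n) (bl.len n)) (st [z, a, e, load (List.ofFn k ++ List.ofFn y), z, z, z, z]) =
      st [z, a, e, load (List.ofFn k ++ List.ofFn y ++ List.ofFn b), z, z, z, z] :=
    run_xorC_cfg h3b (by omega) (by omega) (by omega) (by simp) (by omega) (by omega)
  have s8 : runC (xorC L 7 2 (S.branchLen.len n) 3 (S.keyLen.len n + S.ranLen.len n + S.branchLen.len n) (S.domLen.len n)) (st [z, a, e, load (List.ofFn k ++ List.ofFn y ++ List.ofFn b), z, z, z, z]) =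
      st [z, a, e, load lc, z, z, z, z] :=
    run_xorC_cfg h3c (by omega) (by omega) (by omega) (by simp) (by omega) (by omega)
  have s9 : runC (blockC L 7 3 (S.chk.circ n)) (st [z, a, e, load lc, z, z, z, z]) =
      st [z, a, e, S.chk.run n lc, z, z, z, z] :=
    run_blockC_cfg (by omega) (by simp)
  have s10 : runC (xorC L 7 1 0 4 0 (S.ranLen.len n)) (st [z, a, e, S.chk.run n lc, z, z, z, z]) =
      st [z, a, e, S.chk.run n lc, load (List.ofFn y), z, z, z] :=
    run_xorC_cfg (hread _ _ _) (by omega) (by omega) (by omega) (by simp) (by omega) (by omega)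
  have s11 : runC (blockC L 7 4 (dY.circ n)) (st [z, a, e, S.chk.run n lc, load (List.ofFn y), z, z, z]) =
      st [z, a, e, S.chk.run n lc, dY.run n (List.ofFn y), z, z, z] :=
    run_blockC_cfg (by omega) (by simp)
  have s12 : runC (xorC L 7 2 (off.len n) 5 0 (len.len n)) (st [z, a, e, S.chk.run n lc, dY.run n (List.ofFn y), z, z, z]) =
      st [z, a, e, S.chk.run n lc, dY.run n (List.ofFn y), load (List.ofFn t), z, z] :=
    run_xorC_cfg (hread _ _ _) (by omega) (by omega) (by omega) (by simp) (by omega) (by omega)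
  have s13 : runC (blockC L 7 5 (dB.circ n)) (st [z, a, e, S.chk.run n lc, dY.run n (List.ofFn y), load (List.ofFn t), z, z]) =
      st [z, a, e, S.chk.run n lc, dY.run n (List.ofFn y), dB.run n (List.ofFn t), z, z] :=
    run_blockC_cfg (by omega) (by simp)
  have s14 : runC (xorC L 7 2 (S.branchLen.len n) 6 0 (S.domLen.len n)) (st [z, a, e, S.chk.run n lc, dY.run n (List.ofFn y), dB.run n (List.ofFn t), z, z]) =
      st [z, a, e, S.chk.run n lc, dY.run n (List.ofFn y), dB.run n (List.ofFn t), load (List.ofFn x), z] :=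
    run_xorC_cfg (hread _ _ _) (by omega) (by omega) (by omega) (by simp) (by omega) (by omega)
  have s15 : runC (blockC L 7 6 (dX.circ n)) (st [z, a, e, S.chk.run n lc, dY.run n (List.ofFn y), dB.run n (List.ofFn t), load (List.ofFn x), z]) =
      st [z, a, e, S.chk.run n lc, dY.run n (List.ofFn y), dB.run n (List.ofFn t), dX.run n (List.ofFn x), z] :=
    run_blockC_cfg (by omega) (by simp)
  rw [s0, s1, s2, s3, s4, s5, s6, s7, s8, s9, s10, s11, s12, s13, s14, s15]
  simp only [hst]
  have v : ∀ r i, r ≤ 7 → i < 1 ∨ r ≠ 0 → ValidWire L 7 r i := fun r i h h' => ⟨h, by omega⟩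
  simp only [runC_cons, runC_nil]
  rw [act_toffoli (v _ _ (by omega) (by omega)) (v _ _ (by omega) (by omega))
      (v _ _ (by omega) (by omega)) (by omega) (by omega),
    act_toffoli (v _ _ (by omega) (by omega)) (v _ _ (by omega) (by omega))
      (v _ _ (by omega) (by omega)) (by omega) (by omega),
    act_toffoli (v _ _ (by omega) (by omega)) (v _ _ (by omega) (by omega))
      (v _ _ (by omega) (by omega)) (by omega) (by omega),
    act_not (v _ _ (by omega) (by omega))]
  have hout : ∀ B : ℕ → Wires, enc L 7 B 0 = B 0 0 := fun B => by
    simp only [enc]; rw [if_pos (by omega)]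
  rw [hout]
  have g0 : cfg [z, a, e, S.chk.run n lc, dY.run n (List.ofFn y), dB.run n (List.ofFn t),
      dX.run n (List.ofFn x), z] 0 = z := rfl
  have g3 : cfg [z, a, e, S.chk.run n lc, dY.run n (List.ofFn y), dB.run n (List.ofFn t),
      dX.run n (List.ofFn x), z] 3 = S.chk.run n lc := rfl
  have g4 : cfg [z, a, e, S.chk.run n lc, dY.run n (List.ofFn y), dB.run n (List.ofFn t),
      dX.run n (List.ofFn x), z] 4 = dY.run n (List.ofFn y) := rfl
  have g5 : cfg [z, a, e, S.chk.run n lc, dY.run n (List.ofFn y), dB.run n (List.ofFn t),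
      dX.run n (List.ofFn x), z] 5 = dB.run n (List.ofFn t) := rfl
  have g6 : cfg [z, a, e, S.chk.run n lc, dY.run n (List.ofFn y), dB.run n (List.ofFn t),
      dX.run n (List.ofFn x), z] 6 = dX.run n (List.ofFn x) := rfl
  have g7 : cfg [z, a, e, S.chk.run n lc, dY.run n (List.ofFn y), dB.run n (List.ofFn t),
      dX.run n (List.ofFn x), z] 7 = z := rfl
  have hz0 : ∀ i, z i = false := fun _ => rfl
  have hc : S.check n k y b x = S.chk.run n lc 0 := rfl
  rw [hc]
  simp only [Alg.bit]
  generalize S.chk.run n lc = c3 at *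
  generalize dY.run n (List.ofFn y) = c4 at *
  generalize dB.run n (List.ofFn t) = c5 at *
  generalize dX.run n (List.ofFn x) = c6 at *
  simp [g0, g3, g4, g5, g6, g7, hz0]
  tauto

/-- The circuits of the algorithm that runs the prover `A`, whose answers contain strings of length
`w`, and the extractor `E` on the same key and coins, and outputs the extracted bit and preimage
together with the equation in the answer of `A`. -/
def equationCirc (w : PolyLen) (n : ℕ) : List CGate :=
  let L := S.keyLen.len n + A.coins.len n + 1 + S.domLen.len n + w.len n + 1
  let i := S.keyLen.len n + A.coins.len n
  let R := S.ranLen.len n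
  let δ := S.domLen.len n
  xorC L 2 0 0 1 0 i ++ xorC L 2 0 0 2 0 i ++ xorC L 2 1 0 0 0 i ++
  blockC L 2 1 (A.alg.circ n) ++ blockC L 2 2 (E.circ n) ++
  xorC L 2 2 0 0 0 1 ++ xorC L 2 2 (S.branchLen.len n) 0 1 δ ++
  xorC L 2 1 R 0 (1 + δ) (w.len n) ++ xorC L 2 1 (R + w.len n) 0 (1 + δ + w.len n) 1

lemma uniformC_equationCirc (w : PolyLen) : UniformC (equationCirc S A E w) := by
  set L := S.keyLen + A.coins + PolyLen.const 1 + S.domLen + w + PolyLen.const 1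
  have hx : ∀ r a r' b m, UniformC fun n => xorC (L.len n) 2 r (PolyLen.len a n) r'
      (PolyLen.len b n) (PolyLen.len m n) := fun r a r' b m => uniformC_xorC L 2 r a r' b m
  have hb : ∀ r (A : Alg), UniformC fun n => blockC (L.len n) 2 (r + 1) (A.circ n) :=
    fun r A => UniformC.blockC A.poly L 2 r
  have h := ((((((((hx 0 (.const 0) 1 (.const 0) (S.keyLen + A.coins)).append
    (hx 0 (.const 0) 2 (.const 0) (S.keyLen + A.coins))).append
    (hx 1 (.const 0) 0 (.const 0) (S.keyLen + A.coins))).append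
    (hb 0 A.alg)).append (hb 1 E)).append
    (hx 2 (.const 0) 0 (.const 0) (.const 1))).append
    (hx 2 S.branchLen 0 (.const 1) S.domLen)).append
    (hx 1 S.ranLen 0 (.const 1 + S.domLen) w)).append
    (hx 1 (S.ranLen + w) 0 (.const 1 + S.domLen + w) (.const 1))
  simp only [L, PolyLen.add_len, PolyLen.const_len] at h
  exact h

/-- The algorithm with the circuits `equationCirc`, which uses the coins of `A`. -/
def equationAdversary (w : PolyLen) : PPT where
  alg := ⟨_, uniformC_equationCirc S A E w⟩
  coins := A.coins

/-- Once the input has been moved out, the main register is zero. The four output fields are then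
appended to it one after the other by adding segments of the registers of the prover and the
extractor. -/
lemma equationAdversary_run (w : PolyLen) (n : ℕ) (k : S.Key n) (r : Str (A.coins.len n)) :
    let a := A.run n (List.ofFn k) r
    let e := E.run n (List.ofFn k ++ List.ofFn r)
    let s := (equationAdversary S A E w).run n (List.ofFn k) r
    s 0 = e 0 ∧
    readStr s 1 (S.domLen.len n) = readStr e (S.branchLen.len n) (S.domLen.len n) ∧
    readStr s (1 + S.domLen.len n) (w.len n) = readStr a (S.ranLen.len n) (w.len n) ∧
    s (1 + S.domLen.len n + w.len n) = a (S.ranLen.len n + w.len n) := by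
  intro a e s
  obtain ⟨L, hL⟩ : ∃ L, L = S.keyLen.len n + A.coins.len n + 1 + S.domLen.len n + w.len n + 1 :=
    ⟨_, rfl⟩
  set l := List.ofFn k ++ List.ofFn r with hl
  have hlen : l.length = S.keyLen.len n + A.coins.len n := by simp [hl]
  have hself : xorSeg (load l) (load l) 0 0 (S.keyLen.len n + A.coins.len n) = load [] :=
    xorSeg_self fun i hi => load_of_le (by omega)
  have hcopy : xorSeg (load []) (load l) 0 0 (S.keyLen.len n + A.coins.len n) = load l := by
    rw [xorSeg_load (b := 0) rfl, List.nil_append]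
    funext i
    rw [load_ofFn_readStr]
    split_ifs with h
    · rw [zero_add]
    · exact (load_of_le (by omega)).symm
  set z := load [] with hz
  set v1 : Str 1 := readStr e 0 1 with hv1
  set v2 : S.Dom n := readStr e (S.branchLen.len n) (S.domLen.len n) with hv2
  set v3 : Str (w.len n) := readStr a (S.ranLen.len n) (w.len n) with hv3
  set v4 : Str 1 := readStr a (S.ranLen.len n + w.len n) 1 with hv4
  have h1 : xorSeg z e 0 0 1 = load (List.ofFn v1) := by
    rw [xorSeg_load (b := 0) rfl, List.nil_append]
  have h2 : xorSeg (load (List.ofFn v1)) e (S.branchLen.len n) 1 (S.domLen.len n) =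
      load (List.ofFn v1 ++ List.ofFn v2) := by rw [xorSeg_load (by simp)]
  have h3 : xorSeg (load (List.ofFn v1 ++ List.ofFn v2)) a (S.ranLen.len n)
      (1 + S.domLen.len n) (w.len n) = load (List.ofFn v1 ++ List.ofFn v2 ++ List.ofFn v3) := by
    rw [xorSeg_load (by simp; omega)]
  have h4 : xorSeg (load (List.ofFn v1 ++ List.ofFn v2 ++ List.ofFn v3)) a
      (S.ranLen.len n + w.len n) (1 + S.domLen.len n + w.len n) 1 =
      load (List.ofFn v1 ++ List.ofFn v2 ++ List.ofFn v3 ++ List.ofFn v4) := by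
    rw [xorSeg_load (by simp; omega)]
  have hs : s = enc L 2 (cfg [load (List.ofFn v1 ++ List.ofFn v2 ++ List.ofFn v3 ++ List.ofFn v4),
      a, e]) := by
    change runC (equationCirc S A E w n) (load l) = _
    rw [enc_load_cfg (L := L) (K := 2) (l := l) (by omega) 2]
    unfold equationCirc
    simp only [runC_append, ← hL]
    set st : List Wires → Wires := fun l => enc L 2 (cfg l) with hst
    change runC _ (runC _ (runC _ (runC _ (runC _ (runC _ (runC _ (runC _ (runC _
      (st [load l, z, z]))))))))) = _
    have s0 : runC (xorC L 2 0 0 1 0 (S.keyLen.len n + A.coins.len n)) (st [load l, z, z]) =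
        st [load l, load l, z] :=
      run_xorC_cfg hcopy (by omega) (by omega) (by omega) (by simp) (by omega) (by omega)
    have s1 : runC (xorC L 2 0 0 2 0 (S.keyLen.len n + A.coins.len n)) (st [load l, load l, z]) =
        st [load l, load l, load l] :=
      run_xorC_cfg hcopy (by omega) (by omega) (by omega) (by simp) (by omega) (by omega)
    have s2 : runC (xorC L 2 1 0 0 0 (S.keyLen.len n + A.coins.len n))
        (st [load l, load l, load l]) = st [z, load l, load l] :=
      run_xorC_cfg hself (by omega) (by omega) (by omega) (by simp) (by omega) (by omega)
    have s3 : runC (blockC L 2 1 (A.alg.circ n)) (st [z, load l, load l]) = st [z, a, load l] :=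
      run_blockC_cfg (by omega) (by simp)
    have s4 : runC (blockC L 2 2 (E.circ n)) (st [z, a, load l]) = st [z, a, e] :=
      run_blockC_cfg (by omega) (by simp)
    rw [s0, s1, s2, s3, s4]
    simp only [hst]
    rw [run_xorC_cfg (r := 2) (r' := 0)
        (l := [z, a, e]) h1 (by omega) (by omega) (by omega) (by simp) (by omega)
        (by omega),
      List.set_cons_zero, run_xorC_cfg (r := 2) (r' := 0)
        (l := [load (List.ofFn v1), a, e]) h2 (by omega) (by omega) (by omega) (by simp)
        (by omega) (by omega),
      List.set_cons_zero, run_xorC_cfg (r := 1) (r' := 0)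
        (l := [load (List.ofFn v1 ++ List.ofFn v2), a, e]) h3 (by omega) (by omega)
        (by omega) (by simp) (by omega) (by omega),
      List.set_cons_zero, run_xorC_cfg (r := 1) (r' := 0)
        (l := [load (List.ofFn v1 ++ List.ofFn v2 ++ List.ofFn v3), a, e]) h4 (by omega)
        (by omega) (by omega) (by simp) (by omega) (by omega), List.set_cons_zero]
  have hget : ∀ i < L, s i =
      load (List.ofFn v1 ++ (List.ofFn v2 ++ (List.ofFn v3 ++ (List.ofFn v4 ++ [])))) i := by
    intro i hi
    rw [hs, enc, if_pos hi]
    simp [cfg]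
  have hread : ∀ o m, o + m ≤ L → readStr s o m = readStr (load (List.ofFn v1 ++ (List.ofFn v2 ++
      (List.ofFn v3 ++ (List.ofFn v4 ++ []))))) o m := by
    intro o m h
    funext i
    simp only [readStr]
    exact hget _ (by omega)
  have g1 : readStr s 0 1 = v1 := by
    rw [hread _ _ (by omega)]; exact readStr_load_append (l := []) rfl
  have g2 : readStr s 1 (S.domLen.len n) = v2 := by
    rw [hread _ _ (by omega)]; exact readStr_load_append (by simp)
  have g3 : readStr s (1 + S.domLen.len n) (w.len n) = v3 := by
    rw [hread _ _ (by omega), ← List.append_assoc]; exact readStr_load_append (by simp; omega)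
  have g4 : readStr s (1 + S.domLen.len n + w.len n) 1 = v4 := by
    rw [hread _ _ (by omega), ← List.append_assoc, ← List.append_assoc]
    exact readStr_load_append (by simp; omega)
  refine ⟨?_, g2, g3, ?_⟩
  · simpa [readStr, hv1] using congrFun g1 0
  · simpa [readStr, hv4] using congrFun g4 0

end Distinguisher

/-! ## Averages and negligible functions -/

lemma avg_add {m : ℕ} (φ ψ : Str m → ℝ) : avg (fun r => φ r + ψ r) = avg φ + avg ψ := by
  simp only [avg, Finset.sum_add_distrib, add_div]

lemma avg_mono {m : ℕ} {φ ψ : Str m → ℝ} (h : ∀ r, φ r ≤ ψ r) : avg φ ≤ avg ψ :=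
  div_le_div_of_nonneg_right (Finset.sum_le_sum fun r _ => h r) (by positivity)

lemma avg_const {m : ℕ} (c : ℝ) : avg (fun _ : Str m => c) = c := by
  simp [avg]

lemma ind_nonneg (E : Prop) : 0 ≤ ind E := by
  unfold ind; split_ifs <;> norm_num

lemma ind_le_one (E : Prop) : ind E ≤ 1 := by
  unfold ind; split_ifs <;> norm_num

lemma ind_true {E : Prop} (h : E) : ind E = 1 := if_pos h

lemma ind_false {E : Prop} (h : ¬E) : ind E = 0 := if_neg h

namespace KeyGen

variable {κ : PolyLen} (g : KeyGen κ)

lemma mean_add (n : ℕ) (φ ψ : Str (κ.len n) → Str (g.trapLen.len n) → ℝ) :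
    g.mean n (fun k t => φ k t + ψ k t) = g.mean n φ + g.mean n ψ := avg_add _ _

lemma mean_mono {n : ℕ} {φ ψ : Str (κ.len n) → Str (g.trapLen.len n) → ℝ}
    (h : ∀ r, φ (g.key n r) (g.trap n r) ≤ ψ (g.key n r) (g.trap n r)) :
    g.mean n φ ≤ g.mean n ψ := avg_mono h

lemma mean_const (n : ℕ) (c : ℝ) : g.mean n (fun _ _ => c) = c := avg_const c

end KeyGen

lemma Negl.add {f g : ℕ → ℝ} (hf : Negl f) (hg : Negl g) : Negl fun n => f n + g n :=
  Asymptotics.SuperpolynomialDecay.add hf hg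

lemma Negl.const_mul {f : ℕ → ℝ} (hf : Negl f) (c : ℝ) : Negl fun n => c * f n :=
  Asymptotics.SuperpolynomialDecay.const_mul hf c

/-! ## Soundness -/

namespace E3NTCF

variable (P : E3NTCF) (A : PPT) (E : Alg)

/-- The image in the answer of the prover `A` on key `k` and coins `r`. -/
def proverImage (n : ℕ) (k : P.S.Key n) (r : Str (A.coins.len n)) : P.S.Ran n :=
  readStr (A.run n (List.ofFn k) r) 0 (P.S.ranLen.len n)

/-- The output wires of the extractor `E`. -/
def extracted (n : ℕ) (k : P.S.Key n) (r : Str (A.coins.len n)) : Wires :=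
  E.run n (List.ofFn k ++ List.ofFn r)

/-- The branch found by the extractor. -/
def extractedBranch (n : ℕ) (k : P.S.Key n) (r : Str (A.coins.len n)) : P.S.Branch n :=
  readStr (P.extracted A E n k r) 0 (P.S.branchLen.len n)

/-- The preimage found by the extractor. -/
def extractedPoint (n : ℕ) (k : P.S.Key n) (r : Str (A.coins.len n)) : P.S.Dom n :=
  readStr (P.extracted A E n k r) (P.S.branchLen.len n) (P.S.domLen.len n)

/-- The extractor finds a preimage in the extended domain. -/
def Extracts (n : ℕ) (k : P.S.Key n) (r : Str (A.coins.len n)) : Prop :=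
  P.proverImage A n k r ∈ P.S.Y.set n ∧ P.extractedBranch A E n k r ∈ P.S.BExt.set n ∧
  P.S.check n k (P.proverImage A n k r) (P.extractedBranch A E n k r)
    (P.extractedPoint A E n k r) = true ∧
  P.extractedPoint A E n k r ∈ P.S.XExt.set n

/-- The extractor finds a preimage in the domain on the branch given by its first bit. -/
def ExtractsBit (n : ℕ) (k : P.S.Key n) (r : Str (A.coins.len n)) : Prop :=
  P.proverImage A n k r ∈ P.S.Y.set n ∧
  P.S.check n k (P.proverImage A n k r) (bitStr (P.extracted A E n k r 0))
    (P.extractedPoint A E n k r) = true ∧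
  P.extractedPoint A E n k r ∈ P.S.X.set n

/-- The event refers to the key and the coins but to no trapdoor, so it is a legitimate test for
indistinguishability of keys. -/
lemma exists_extracts_distinguisher : ∃ D : PPT, ∀ n (k : P.S.Key n),
    D.prob n (List.ofFn k) (fun s => s 0 = false) = avg fun r => ind (P.Extracts A E n k r) := by
  obtain ⟨dY, hY⟩ := P.S.Y.decidable
  obtain ⟨dB, hB⟩ := P.S.BExt.decidable
  obtain ⟨dX, hX⟩ := P.S.XExt.decidable
  refine ⟨distinguisher P.S A E P.S.branchLen (.const 0) P.S.branchLen dY dB dX, fun n k => ?_⟩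
  have key : ∀ r : Str (A.coins.len n), (distinguisher P.S A E P.S.branchLen (.const 0) P.S.branchLen dY dB dX).run n
      (List.ofFn k) r 0 = false ↔ P.Extracts A E n k r := fun r => by
    refine (distinguisher_run P.S A E P.S.branchLen (.const 0) P.S.branchLen dY dB dX n k r
      le_rfl).trans ?_
    rw [hY, hB, hX]
    have e : (fun i : Fin (P.S.branchLen.len n) => decide ((i : ℕ) < P.S.branchLen.len n) &&
        E.run n (List.ofFn k ++ List.ofFn r) i) = P.extractedBranch A E n k r := by
      funext i
      simp [extractedBranch, readStr, extracted]
    rw [e]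
    rfl
  exact congrArg (avg (m := A.coins.len n)) (funext fun r => congrArg ind (propext (key r)))

lemma exists_extractsBit_distinguisher : ∃ D : PPT, ∀ n (k : P.S.Key n),
    D.prob n (List.ofFn k) (fun s => s 0 = false) = avg fun r => ind (P.ExtractsBit A E n k r) := by
  obtain ⟨dY, hY⟩ := P.S.Y.decidable
  obtain ⟨dX, hX⟩ := P.S.X.decidable
  -- Only the first bit of the extracted branch is used. No test of the branch is wanted here, so
  -- the slot for it repeats the test that the extracted point lies in X.
  refine ⟨distinguisher P.S A E (.const 1) P.S.branchLen P.S.domLen dY dX dX, fun n k => ?_⟩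
  have key : ∀ r : Str (A.coins.len n), (distinguisher P.S A E (.const 1) P.S.branchLen P.S.domLen dY dX dX).run n
      (List.ofFn k) r 0 = false ↔ P.ExtractsBit A E n k r := fun r => by
    refine (distinguisher_run P.S A E (.const 1) P.S.branchLen P.S.domLen dY dX dX n k r
      (P.S.branchLen_pos n)).trans ?_
    rw [hY, hX]
    have e : (fun i : Fin (P.S.branchLen.len n) => decide ((i : ℕ) < (PolyLen.const 1).len n) &&
        E.run n (List.ofFn k ++ List.ofFn r) i) = bitStr (P.extracted A E n k r 0) := by
      funext i
      by_cases hi : (i : ℕ) = 0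
      · simp [bitStr, extracted, hi]
      · simp [bitStr, hi]
    rw [e]
    exact ⟨fun h => ⟨h.1, h.2.2.1, h.2.2.2⟩, fun h => ⟨h.1, h.2.2, h.2.1, h.2.2⟩⟩
  exact congrArg (avg (m := A.coins.len n)) (funext fun r => congrArg ind (propext (key r)))

/-- The answer of the prover. -/
def proverAnswer (n : ℕ) (k : P.S.Key n) (r : Str (A.coins.len n)) : P.Answer n :=
  P.readAnswer n (A.run n (List.ofFn k) r)

/-- The output `(b, x, d, e)` of the adversary against the adaptive hardcore bit. -/
def equationOutput (n : ℕ) (k : P.S.Key n) (r : Str (A.coins.len n)) :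
    Bool × P.S.Dom n × Str (P.F.w.len n) × Bool :=
  (P.extracted A E n k r 0, P.extractedPoint A E n k r, (P.proverAnswer A n k r).d,
    (P.proverAnswer A n k r).e)

/-- The set `H_k` of the adaptive hardcore bit property. -/
def hcSetH (n : ℕ) (k : P.S.Key n) : Set (Bool × P.S.Dom n × Str (P.F.w.len n) × Bool) :=
  P.S.hardcoreSet (P.S.claws P.F.f n k) (fun b => P.F.part b n) (P.F.hcSet n k)
    (P.S.applyJ P.F.J (P.F.w.len n))

/-- The quadruple with its last bit flipped. -/
def flipLast {n : ℕ} (q : Bool × P.S.Dom n × Str (P.F.w.len n) × Bool) :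
    Bool × P.S.Dom n × Str (P.F.w.len n) × Bool := (q.1, q.2.1, q.2.2.1, !q.2.2.2)

/-- The adaptive hardcore bit property applied to the adversary that joins the extracted preimage
with the equation of the prover. -/
lemma negl_equationOutput : Negl fun n =>
    |P.F.gen.mean n (fun k _ => avg fun r => ind (P.equationOutput A E n k r ∈ P.hcSetH n k)) -
     P.F.gen.mean n (fun k _ => avg fun r =>
        ind (P.flipLast (P.equationOutput A E n k r) ∈ P.hcSetH n k))| := by
  have h := P.F.ahcb (equationAdversary P.S A E P.F.w)
  have key : ∀ n (k : P.S.Key n) (r : Str (A.coins.len n)),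
      let s := (equationAdversary P.S A E P.F.w).run n (List.ofFn k) r
      (s 0, readStr s 1 (P.S.domLen.len n), readStr s (1 + P.S.domLen.len n) (P.F.w.len n),
        s (1 + P.S.domLen.len n + P.F.w.len n)) = P.equationOutput A E n k r := by
    intro n k r
    obtain ⟨h1, h2, h3, h4⟩ := equationAdversary_run P.S A E P.F.w n k r
    exact Prod.ext h1 (Prod.ext h2 (Prod.ext h3 h4))
  refine (congrArg Negl (funext fun n => congrArg abs (congrArg₂ (· - ·) ?_ ?_))).mp h
  · exact congrArg (P.F.gen.mean n) (funext fun k => funext fun _ =>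
      congrArg (avg (m := A.coins.len n)) (funext fun r =>
        congrArg (fun q => ind (q ∈ P.hcSetH n k)) (key n k r)))
  · exact congrArg (P.F.gen.mean n) (funext fun k => funext fun _ =>
      congrArg (avg (m := A.coins.len n)) (funext fun r =>
        congrArg (fun q => ind (P.flipLast q ∈ P.hcSetH n k)) (key n k r)))

/-- For good keys the sets `H_k` and its flipped version are disjoint. -/
lemma not_mem_flipLast {n : ℕ} {k : P.S.Key n} {t : Str (P.F.gen.trapLen.len n)}
    (hg : (k, t) ∈ P.F.good n) {q : Bool × P.S.Dom n × Str (P.F.w.len n) × Bool}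
    (h : q ∈ P.hcSetH n k) : P.flipLast q ∉ P.hcSetH n k := by
  obtain ⟨b, x₀, x₁, d, hR, hx, hd, rfl⟩ := h
  rintro ⟨b', x₀', x₁', d', hR', hx', hd', e⟩
  simp only [flipLast, Prod.mk.injEq] at e
  obtain ⟨rfl, e2, rfl, e4⟩ := e
  -- The point x_b lies in X_b, hence has a unique partner. Both memberships then come from the same
  -- claw and the same d, and would give the same last bit.
  cases b
  · simp only [Bool.false_eq_true, if_false] at e2 hx hx'
    subst e2
    rw [(P.F.partner_of_zero n k t hg x₀ hx).unique hR hR'] at e4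
    simp at e4
  · simp only [if_true] at e2 hx hx'
    subst e2
    rw [(P.F.partner_of_one n k t hg x₁ hx).unique hR hR'] at e4
    simp at e4

/-- If the check rejects the extracted pair although the image check accepts, this is exactly the
failure event that weak extractability makes negligible. -/
lemma extracts_of_wImAccepts {n : ℕ} {k : P.S.Key n} {t : Str (P.H.gen.trapLen.len n)}
    {r : Str (A.coins.len n)} (hb : P.extractedBranch A E n k r ∈ P.S.BExt.set n)
    (hx : P.extractedPoint A E n k r ∈ P.S.XExt.set n)
    (h : P.WImAccepts n k t (P.proverAnswer A n k r)) :
    P.Extracts A E n k r ∨ (P.proverImage A n k r ∈ P.S.Y.set n ∧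
      P.S.check n k (P.proverImage A n k r) (P.extractedBranch A E n k r)
        (P.extractedPoint A E n k r) = false ∧
      P.weakExtract.imChk.bit n (List.ofFn t ++ List.ofFn (P.proverImage A n k r)) = true) := by
  rcases hc : P.S.check n k (P.proverImage A n k r) (P.extractedBranch A E n k r)
    (P.extractedPoint A E n k r)
  · exact .inr ⟨h.1, rfl, h.2⟩
  · exact .inl ⟨h.1, hb, hc, hx⟩

/-- The image lies in the support at the extracted pair and in the support at the pair found by
inversion. Disjointness of supports on the extended sets makes the pairs equal, and inversion always
outputs a bit and a point of X. -/
lemma extractsBit_of_sImAccepts {n : ℕ} {k : P.S.Key n} {t : Str (P.G.gen.trapLen.len n)}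
    {r : Str (A.coins.len n)} (hg : (k, t) ∈ P.G.good n) (h : P.Extracts A E n k r)
    (h' : P.SImAccepts n k t (P.proverAnswer A n k r)) : P.ExtractsBit A E n k r := by
  obtain ⟨hy, hb, hc, hx⟩ := h
  obtain ⟨-, hc'⟩ := h'
  have hk := P.G.good_key n _ hg
  set y := P.proverImage A n k r
  have hX := P.G.inv_mem n k t hg y hy
  set b' := P.G.inv.run n (List.ofFn t ++ List.ofFn y) 0
  set x' : P.S.Dom n := readStr (P.G.inv.run n (List.ofFn t ++ List.ofFn y)) 1 (P.S.domLen.len n)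
  change P.S.check n k y (bitStr b') x' = true at hc'
  have m := (P.G.chk_spec n k hk _ hb _ hx y hy).1 hc
  have m' := (P.G.chk_spec n k hk _ (P.S.bit_mem n b') _ (P.S.X_subset n hX) y hy).1 hc'
  have e : (P.extractedBranch A E n k r, P.extractedPoint A E n k r) = (bitStr b', x') := by
    by_contra hne
    exact Set.disjoint_left.1 (P.G.disjoint n k t hg _ hb _ (P.S.bit_mem n b') _ hx _
      (P.S.X_subset n hX) hne) m m'
  obtain ⟨e1, e2⟩ := Prod.mk.inj e
  have e3 : P.extracted A E n k r 0 = b' := by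
    have := congrFun e1 ⟨0, P.S.branchLen_pos n⟩
    simpa [extractedBranch, readStr, bitStr] using this
  refine ⟨hy, ?_, ?_⟩
  · rw [e3, e2]; exact hc'
  · rw [e2]; exact hX

/-- The image lies in the support of f' at the extracted point, so inversion on that branch returns
this very point. The extracted point is therefore the x_b of the verifier's claw. -/
lemma equationOutput_mem {n : ℕ} {k : P.S.Key n} {t : Str (P.F.gen.trapLen.len n)}
    {r : Str (A.coins.len n)} (hg : (k, t) ∈ P.F.good n) (h : P.ExtractsBit A E n k r)
    (h' : P.EqAccepts n k t (P.proverAnswer A n k r)) :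
    P.equationOutput A E n k r ∈ P.hcSetH n k := by
  obtain ⟨hy, hc, hx⟩ := h
  obtain ⟨-, -, -, hR, h0, h1, hd, he⟩ := h'
  have hk := P.F.good_key n _ hg
  have m := (P.F.chk_spec n k hk _ _ hx _ hy).1 hc
  have hi := P.F.inv_fHat n k t hg _ _ hx _ m
  refine ⟨P.extracted A E n k r 0, _, _, _, hR, ?_, hd, ?_⟩
  · split_ifs
    · rename_i hb; rw [hb]; exact h1
    · rename_i hb; rw [Bool.not_eq_true] at hb; rw [hb]; exact h0
  · rw [he]
    simp only [equationOutput, Prod.mk.injEq, true_and, and_true]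
    rw [← hi]
    split_ifs
    · rename_i hb; rw [hb]; rfl
    · rename_i hb; rw [Bool.not_eq_true] at hb; rw [hb]; rfl

/-- The bounds `hW`, `hS`, `hQ`, `hHalf` are chained through the indistinguishability of keys, so
that the extraction probabilities cancel and 1 + 1 + 1/2 is left. -/
theorem soundness : ∃ ν : ℕ → ℝ, Negl ν ∧ ∀ n, P.classicalSuccess A n ≤ 5 / 6 + ν n := by
  obtain ⟨E, hE, hE'⟩ := P.weakExtract.extractor A
  obtain ⟨D, hD⟩ := P.exists_extracts_distinguisher A E
  obtain ⟨D', hD'⟩ := P.exists_extractsBit_distinguisher A E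
  have n1 := P.H.indist D
  have n2 := P.injectiveInvariant D
  have n3 := P.injectiveInvariant D'
  simp only [hD] at n1 n2
  simp only [hD'] at n3
  have n4 := P.negl_equationOutput A E
  have n5 := P.F.good_negl
  have n6 := P.G.good_negl
  -- The hardcore bit advantage enters by half, because the bound 1/2 comes from halving `hHalf`.
  -- Bad keys of F enter once through `hQ` and by half through `hHalf`, which gives 3/2.
  have N := ((((((hE'.add n1).add n2).add n3).add (n4.const_mul (1 / 2))).add
    (n5.const_mul (3 / 2))).add n6).const_mul (1 / 3)
  refine ⟨_, N, fun n => ?_⟩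
  simp only
  have hW : P.H.gen.mean n (fun k t => avg fun r =>
      ind (P.WImAccepts n k t (P.proverAnswer A n k r))) ≤
      P.H.gen.mean n (fun k _ => avg fun r => ind (P.Extracts A E n k r)) +
      P.H.gen.mean n fun k t => avg fun r : Str (A.coins.len n) =>
        ind (P.proverImage A n k r ∈ P.S.Y.set n ∧
          P.S.check n k (P.proverImage A n k r) (P.extractedBranch A E n k r)
            (P.extractedPoint A E n k r) = false ∧
          P.weakExtract.imChk.bit n (List.ofFn t ++ List.ofFn (P.proverImage A n k r)) = true) := by
    rw [← KeyGen.mean_add]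
    refine P.H.gen.mean_mono fun r' => ?_
    rw [← avg_add]
    refine avg_mono fun r => ?_
    by_cases h : P.WImAccepts n (P.H.gen.key n r') (P.H.gen.trap n r')
        (P.proverAnswer A n (P.H.gen.key n r') r)
    · have hm := hE n _ (P.H.gen_key n r') r
      rw [ind_true h]
      rcases P.extracts_of_wImAccepts A E hm.1 hm.2 h with h1 | h1
      · rw [ind_true h1]; exact le_add_of_nonneg_right (ind_nonneg _)
      · rw [ind_true h1]; exact le_add_of_nonneg_left (ind_nonneg _)
    · rw [ind_false h]
      exact add_nonneg (ind_nonneg _) (ind_nonneg _)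
  have hS : P.G.gen.mean n (fun k _ => avg fun r => ind (P.Extracts A E n k r)) +
      P.G.gen.mean n (fun k t => avg fun r => ind (P.SImAccepts n k t (P.proverAnswer A n k r))) ≤
      1 + P.G.gen.mean n (fun k _ => avg fun r => ind (P.ExtractsBit A E n k r)) +
      P.G.gen.mean n (fun k t => ind ((k, t) ∉ P.G.good n)) := by
    rw [← P.G.gen.mean_const n 1]
    simp only [← KeyGen.mean_add]
    refine P.G.gen.mean_mono fun r' => ?_
    rw [← avg_const (m := A.coins.len n) 1,
      ← avg_const (m := A.coins.len n) (ind ((P.G.gen.key n r', P.G.gen.trap n r') ∉ P.G.good n))]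
    simp only [← avg_add]
    refine avg_mono fun r => ?_
    by_cases hg : (P.G.gen.key n r', P.G.gen.trap n r') ∈ P.G.good n
    · have i1 := ind_nonneg (P.ExtractsBit A E n (P.G.gen.key n r') r)
      have i2 := ind_nonneg ((P.G.gen.key n r', P.G.gen.trap n r') ∉ P.G.good n)
      have i3 := ind_le_one (P.Extracts A E n (P.G.gen.key n r') r)
      have i4 := ind_le_one (P.SImAccepts n (P.G.gen.key n r') (P.G.gen.trap n r')
        (P.proverAnswer A n (P.G.gen.key n r') r))
      by_cases h1 : P.Extracts A E n (P.G.gen.key n r') r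
      · by_cases h2 : P.SImAccepts n (P.G.gen.key n r') (P.G.gen.trap n r')
          (P.proverAnswer A n (P.G.gen.key n r') r)
        · rw [ind_true (P.extractsBit_of_sImAccepts A E hg h1 h2)]
          linarith
        · rw [ind_false h2]; linarith
      · rw [ind_false h1]; linarith
    · rw [ind_true hg]
      linarith [ind_nonneg (P.ExtractsBit A E n (P.G.gen.key n r') r),
        ind_le_one (P.Extracts A E n (P.G.gen.key n r') r),
        ind_le_one (P.SImAccepts n (P.G.gen.key n r') (P.G.gen.trap n r')
          (P.proverAnswer A n (P.G.gen.key n r') r))]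
  have hQ : P.F.gen.mean n (fun k _ => avg fun r => ind (P.ExtractsBit A E n k r)) +
      P.F.gen.mean n (fun k t => avg fun r => ind (P.EqAccepts n k t (P.proverAnswer A n k r))) ≤
      1 + P.F.gen.mean n (fun k _ => avg fun r =>
        ind (P.equationOutput A E n k r ∈ P.hcSetH n k)) +
      P.F.gen.mean n (fun k t => ind ((k, t) ∉ P.F.good n)) := by
    rw [← P.F.gen.mean_const n 1]
    simp only [← KeyGen.mean_add]
    refine P.F.gen.mean_mono fun r' => ?_
    rw [← avg_const (m := A.coins.len n) 1,
      ← avg_const (m := A.coins.len n) (ind ((P.F.gen.key n r', P.F.gen.trap n r') ∉ P.F.good n))]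
    simp only [← avg_add]
    refine avg_mono fun r => ?_
    have i1 := ind_nonneg (P.equationOutput A E n (P.F.gen.key n r') r ∈
      P.hcSetH n (P.F.gen.key n r'))
    have i2 := ind_nonneg ((P.F.gen.key n r', P.F.gen.trap n r') ∉ P.F.good n)
    have i3 := ind_le_one (P.ExtractsBit A E n (P.F.gen.key n r') r)
    have i4 := ind_le_one (P.EqAccepts n (P.F.gen.key n r') (P.F.gen.trap n r')
      (P.proverAnswer A n (P.F.gen.key n r') r))
    by_cases hg : (P.F.gen.key n r', P.F.gen.trap n r') ∈ P.F.good n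
    · by_cases h1 : P.ExtractsBit A E n (P.F.gen.key n r') r
      · by_cases h2 : P.EqAccepts n (P.F.gen.key n r') (P.F.gen.trap n r')
          (P.proverAnswer A n (P.F.gen.key n r') r)
        · rw [ind_true (P.equationOutput_mem A E hg h1 h2)]
          linarith
        · rw [ind_false h2]; linarith
      · rw [ind_false h1]; linarith
    · rw [ind_true hg]
      linarith
  have hHalf : P.F.gen.mean n (fun k _ => avg fun r =>
        ind (P.equationOutput A E n k r ∈ P.hcSetH n k)) +
      P.F.gen.mean n (fun k _ => avg fun r =>
        ind (P.flipLast (P.equationOutput A E n k r) ∈ P.hcSetH n k)) ≤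
      1 + P.F.gen.mean n (fun k t => ind ((k, t) ∉ P.F.good n)) := by
    rw [← P.F.gen.mean_const n 1]
    simp only [← KeyGen.mean_add]
    refine P.F.gen.mean_mono fun r' => ?_
    rw [← avg_const (m := A.coins.len n) 1,
      ← avg_const (m := A.coins.len n) (ind ((P.F.gen.key n r', P.F.gen.trap n r') ∉ P.F.good n))]
    simp only [← avg_add]
    refine avg_mono fun r => ?_
    have i2 := ind_nonneg ((P.F.gen.key n r', P.F.gen.trap n r') ∉ P.F.good n)
    have i3 := ind_le_one (P.equationOutput A E n (P.F.gen.key n r') r ∈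
      P.hcSetH n (P.F.gen.key n r'))
    have i4 := ind_le_one (P.flipLast (P.equationOutput A E n (P.F.gen.key n r') r) ∈
      P.hcSetH n (P.F.gen.key n r'))
    by_cases hg : (P.F.gen.key n r', P.F.gen.trap n r') ∈ P.F.good n
    · by_cases h1 : P.equationOutput A E n (P.F.gen.key n r') r ∈ P.hcSetH n (P.F.gen.key n r')
      · rw [ind_false (P.not_mem_flipLast hg h1)]
        linarith
      · rw [ind_false h1]; linarith
    · rw [ind_true hg]
      linarith
  have e : P.classicalSuccess A n =
      (P.F.gen.mean n (fun k t => avg fun r =>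
        ind (P.EqAccepts n k t (P.proverAnswer A n k r))) +
      P.H.gen.mean n (fun k t => avg fun r =>
        ind (P.WImAccepts n k t (P.proverAnswer A n k r))) +
      P.G.gen.mean n (fun k t => avg fun r =>
        ind (P.SImAccepts n k t (P.proverAnswer A n k r)))) / 3 := rfl
  rw [e]
  have a1 := le_abs_self (P.H.gen.mean n (fun k _ => avg fun r => ind (P.Extracts A E n k r)) -
    P.F.gen.mean n (fun k _ => avg fun r => ind (P.Extracts A E n k r)))
  have a2 := le_abs_self (P.F.gen.mean n (fun k _ => avg fun r => ind (P.Extracts A E n k r)) -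
    P.G.gen.mean n (fun k _ => avg fun r => ind (P.Extracts A E n k r)))
  have a3 := neg_abs_le (P.F.gen.mean n (fun k _ => avg fun r => ind (P.ExtractsBit A E n k r)) -
    P.G.gen.mean n (fun k _ => avg fun r => ind (P.ExtractsBit A E n k r)))
  have a4 := le_abs_self (P.F.gen.mean n (fun k _ => avg fun r =>
        ind (P.equationOutput A E n k r ∈ P.hcSetH n k)) -
     P.F.gen.mean n (fun k _ => avg fun r =>
        ind (P.flipLast (P.equationOutput A E n k r) ∈ P.hcSetH n k)))
  have hbad : (P.H.gen.mean n fun k t => avg fun r : Str (A.coins.len n) =>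
        ind (P.proverImage A n k r ∈ P.S.Y.set n ∧
          P.S.check n k (P.proverImage A n k r) (P.extractedBranch A E n k r)
            (P.extractedPoint A E n k r) = false ∧
          P.weakExtract.imChk.bit n (List.ofFn t ++ List.ofFn (P.proverImage A n k r)) = true)) =
      P.H.gen.mean n fun k t => avg fun r : Str (A.coins.len n) =>
        let y := readStr (A.run n (List.ofFn k) r) 0 (P.S.ranLen.len n)
        let e := E.run n (List.ofFn k ++ List.ofFn r)
        ind (y ∈ P.S.Y.set n ∧
          P.S.check n k y (readStr e 0 _) (readStr e (P.S.branchLen.len n) _) = false ∧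
          P.weakExtract.imChk.bit n (List.ofFn t ++ List.ofFn y) = true) := rfl
  rw [hbad] at hW
  linarith

end E3NTCF

/-! ## Quantum circuits -/

/-- Action of a quantum circuit. -/
noncomputable def runQ : List QGate → QState →ₗ[ℂ] QState
  | [] => LinearMap.id
  | g :: C => runQ C ∘ₗ g.act

@[simp] lemma runQ_nil (ψ : QState) : runQ [] ψ = ψ := rfl

@[simp] lemma runQ_cons (g : QGate) (C : List QGate) (ψ : QState) :
    runQ (g :: C) ψ = runQ C (g.act ψ) := rfl

@[simp] lemma runQ_append (C D : List QGate) (ψ : QState) :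
    runQ (C ++ D) ψ = runQ D (runQ C ψ) := by
  induction C generalizing ψ with
  | nil => rfl
  | cons g C ih => simp [ih]

lemma foldl_act_eq_runQ (C : List QGate) (ψ : QState) :
    C.foldl (fun ψ g => g.act ψ) ψ = runQ C ψ := by
  induction C generalizing ψ with
  | nil => rfl
  | cons g C ih => simp [ih]

lemma QPT.run_eq (A : QPT) (n : ℕ) (l : List Bool) :
    A.run n l = runQ (A.circ n) (Finsupp.single (load l) 1) := foldl_act_eq_runQ _ _

lemma QGate.act_single (g : QGate) (s : Wires) (a : ℂ) :
    g.act (Finsupp.single s a) = a • g.onBasis s := by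
  simp [QGate.act]

lemma runQ_classical_single (C : List CGate) (s : Wires) (a : ℂ) :
    runQ (C.map .classical) (Finsupp.single s a) = Finsupp.single (runC C s) a := by
  induction C generalizing s with
  | nil => rfl
  | cons g C ih =>
    simp only [List.map_cons, runQ_cons, runC_cons]
    rw [QGate.act_single, QGate.onBasis, Finsupp.smul_single, smul_eq_mul, mul_one, ih]

/-! ## Norms and measurements -/

lemma sqNorm_eq_tsum (ψ : QState) : sqNorm ψ = ∑' s, ‖ψ s‖ ^ 2 := by
  rw [sqNorm, Finsupp.sum, tsum_eq_sum]
  intro s hs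
  simp [Finsupp.notMem_support_iff.1 hs]

lemma summable_sq (ψ : QState) : Summable fun s => ‖ψ s‖ ^ 2 :=
  summable_of_hasFiniteSupport (ψ.support.finite_toSet.subset fun s hs => by
    simpa using fun h : ψ s = 0 => hs (by simp [h]))

lemma measureProb_eq_tsum (ψ : QState) (E : Wires → Prop) :
    measureProb ψ E = ∑' s, ind (E s) * ‖ψ s‖ ^ 2 := by
  rw [measureProb, Finsupp.sum, tsum_eq_sum]
  intro s hs
  simp [Finsupp.notMem_support_iff.1 hs]

lemma summable_ind_sq (ψ : QState) (E : Wires → Prop) :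
    Summable fun s => ind (E s) * ‖ψ s‖ ^ 2 :=
  (summable_sq ψ).of_nonneg_of_le (fun s => mul_nonneg (ind_nonneg _) (by positivity))
    fun s => mul_le_of_le_one_left (by positivity) (ind_le_one _)

lemma measureProb_nonneg (ψ : QState) (E : Wires → Prop) : 0 ≤ measureProb ψ E := by
  rw [measureProb_eq_tsum]
  exact tsum_nonneg fun s => mul_nonneg (ind_nonneg _) (by positivity)

lemma sqNorm_single (s : Wires) (a : ℂ) : sqNorm (Finsupp.single s a) = ‖a‖ ^ 2 := by
  rw [sqNorm, Finsupp.sum_single_index]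
  simp

lemma sqNorm_smul (c : ℂ) (ψ : QState) : sqNorm (c • ψ) = ‖c‖ ^ 2 * sqNorm ψ := by
  simp only [sqNorm_eq_tsum, Finsupp.smul_apply, smul_eq_mul, norm_mul, mul_pow, tsum_mul_left]

lemma sqNorm_add_le (ψ φ : QState) : sqNorm (ψ + φ) ≤ 2 * sqNorm ψ + 2 * sqNorm φ := by
  simp only [sqNorm_eq_tsum, ← tsum_mul_left]
  rw [← ((summable_sq ψ).mul_left 2).tsum_add ((summable_sq φ).mul_left 2)]
  refine (summable_sq (ψ + φ)).tsum_le_tsum (fun s => ?_)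
    (((summable_sq ψ).mul_left 2).add ((summable_sq φ).mul_left 2))
  have h := norm_add_le (ψ s) (φ s)
  have h1 : ‖(ψ + φ) s‖ ^ 2 ≤ (‖ψ s‖ + ‖φ s‖) ^ 2 := pow_le_pow_left₀ (norm_nonneg _) h 2
  nlinarith [sq_nonneg (‖ψ s‖ - ‖φ s‖)]

lemma sqNorm_mapDomain {e : Wires → Wires} (he : Function.Injective e) (ψ : QState) :
    sqNorm (Finsupp.mapDomain e ψ) = sqNorm ψ := by
  rw [sqNorm, Finsupp.sum_mapDomain_index_inj he]
  rfl

lemma hadamard_apply (k : ℕ) (ψ : QState) (s : Wires) :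
    (QGate.hadamard k).act ψ s = (ψ (Function.update s k false) +
      (if s k then -1 else 1) * ψ (Function.update s k true)) / (Real.sqrt 2 : ℂ) := by
  classical
  induction ψ using Finsupp.induction_linear with
  | zero => simp
  | add f g hf hg => rw [map_add, Finsupp.add_apply, hf, hg]; simp only [Finsupp.add_apply]; ring
  | single t a =>
    rw [QGate.act_single, QGate.onBasis]
    simp only [Finsupp.smul_apply, Finsupp.add_apply, smul_eq_mul, Finsupp.single_apply]
    have key : ∀ (v : Bool), t = Function.update s k v ↔
        (t k = v ∧ ∀ i, i ≠ k → t i = s i) := by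
      intro v
      constructor
      · rintro rfl
        exact ⟨by simp, fun i hi => by simp [hi]⟩
      · rintro ⟨h1, h2⟩
        funext i
        by_cases hi : i = k
        · subst hi; simp [h1]
        · simp [hi, h2 i hi]
    have key' : ∀ (v : Bool), Function.update t k v = s ↔
        (s k = v ∧ ∀ i, i ≠ k → t i = s i) := by
      intro v
      constructor
      · rintro rfl
        exact ⟨by simp, fun i hi => by simp [hi]⟩
      · rintro ⟨h1, h2⟩
        funext i
        by_cases hi : i = k
        · subst hi; simp [h1]
        · simp [hi, h2 i hi]
    simp only [key, key']
    generalize (∀ i, i ≠ k → t i = s i) = p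
    by_cases h : p
    · cases hs : s k <;> cases ht : t k <;> simp [h] <;> ring
    · simp [h]

/-- Flip of wire `k`. -/
def flipWire (k : ℕ) : Wires ≃ Wires :=
  Function.Involutive.toPerm (fun s => Function.update s k (!(s k))) fun s => by simp

/-- Basis states are paired by flipping wire k. On each pair the gate forms normalised sum and
difference, so the parallelogram law preserves the weight of the pair. -/
lemma sqNorm_hadamard (k : ℕ) (ψ : QState) : sqNorm ((QGate.hadamard k).act ψ) = sqNorm ψ := by
  have pair : ∀ φ : QState, 2 * sqNorm φ = ∑' s, (‖φ s‖ ^ 2 + ‖φ (flipWire k s)‖ ^ 2) := by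
    intro φ
    have h := (flipWire k).tsum_eq fun s => ‖φ s‖ ^ 2
    have hs : Summable fun s => ‖φ (flipWire k s)‖ ^ 2 :=
      (flipWire k).summable_iff.2 (summable_sq φ)
    rw [(summable_sq φ).tsum_add hs, h, sqNorm_eq_tsum]
    ring
  have h2 : ‖(Real.sqrt 2 : ℂ)‖ ^ 2 = 2 := by
    rw [Complex.norm_real, Real.norm_eq_abs, sq_abs, Real.sq_sqrt (by norm_num)]
  have para : ∀ a b : ℂ, ‖a + b‖ ^ 2 + ‖a - b‖ ^ 2 = 2 * (‖a‖ ^ 2 + ‖b‖ ^ 2) := by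
    intro a b
    have := parallelogram_law_with_norm ℝ a b
    nlinarith
  have key : ∀ s, ‖(QGate.hadamard k).act ψ s‖ ^ 2 +
      ‖(QGate.hadamard k).act ψ (flipWire k s)‖ ^ 2 = ‖ψ s‖ ^ 2 + ‖ψ (flipWire k s)‖ ^ 2 := by
    intro s
    have e : flipWire k s = Function.update s k (!(s k)) := rfl
    have e0 : Function.update s k (s k) = s := Function.update_eq_self k s
    rw [hadamard_apply, hadamard_apply, e]
    simp only [Function.update_idem, Function.update_self, norm_div, div_pow, h2]
    cases hs : s k
    · rw [hs] at e0
      simp only [e0, Bool.not_false, Bool.false_eq_true, if_false, if_true, one_mul, neg_mul,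
        ← sub_eq_add_neg]
      have := para (ψ s) (ψ (Function.update s k true))
      linarith
    · rw [hs] at e0
      simp only [e0, Bool.not_true, Bool.false_eq_true, if_false, if_true, one_mul, neg_mul,
        ← sub_eq_add_neg]
      have := para (ψ (Function.update s k false)) (ψ s)
      linarith
  have h := pair ((QGate.hadamard k).act ψ)
  rw [tsum_congr key, ← pair ψ] at h
  linarith

/-- A classical gate permutes basis states, and the T gate multiplies amplitudes by phases of
modulus 1. -/
lemma sqNorm_act (g : QGate) (ψ : QState) : sqNorm (g.act ψ) = sqNorm ψ := by
  cases g with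
  | classical g =>
    have h : (QGate.classical g).act ψ = Finsupp.mapDomain g.act ψ := by
      simp [QGate.act, Finsupp.linearCombination_apply, Finsupp.mapDomain, QGate.onBasis]
    rw [h]
    exact sqNorm_mapDomain (Function.LeftInverse.injective g.act_act) ψ
  | hadamard k => exact sqNorm_hadamard k ψ
  | tGate k =>
    have h : ∀ s, (QGate.tGate k).act ψ s =
        (if s k then Complex.exp (Complex.I * (Real.pi / 4 : ℝ)) else 1) * ψ s := by
      intro s
      induction ψ using Finsupp.induction_linear with
      | zero => simp
      | add f g hf hg => rw [map_add, Finsupp.add_apply, hf, hg, Finsupp.add_apply]; ring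
      | single t a =>
        rw [QGate.act_single, QGate.onBasis]
        simp only [Finsupp.smul_apply, smul_eq_mul]
        by_cases hst : t = s
        · subst hst; simp [mul_comm]
        · simp [hst]
    simp only [sqNorm_eq_tsum, h, norm_mul]
    congr 1
    funext s
    have : ‖(if s k then Complex.exp (Complex.I * (Real.pi / 4 : ℝ)) else 1 : ℂ)‖ = 1 := by
      split_ifs
      · rw [mul_comm]; exact Complex.norm_exp_ofReal_mul_I _
      · simp
    rw [this, one_mul]

lemma sqNorm_runQ (C : List QGate) (ψ : QState) : sqNorm (runQ C ψ) = sqNorm ψ := by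
  induction C generalizing ψ with
  | nil => rfl
  | cons g C ih => rw [runQ_cons, ih, sqNorm_act]

lemma measureProb_add_not (ψ : QState) (E : Wires → Prop) :
    measureProb ψ E + measureProb ψ (fun s => ¬E s) = sqNorm ψ := by
  rw [measureProb_eq_tsum, measureProb_eq_tsum, sqNorm_eq_tsum,
    ← (summable_ind_sq ψ E).tsum_add (summable_ind_sq ψ _)]
  congr 1
  funext s
  by_cases h : E s
  · simp [ind_true h, ind_false (not_not.2 h)]
  · simp [ind_true h, ind_false h]

/-- If `ψ` is supported on an event, then any state close to `ψ` satisfies it almost surely. -/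
lemma measureProb_ge_of_support {φ ψ : QState} {E : Wires → Prop} (h : ∀ s, ψ s ≠ 0 → E s) :
    sqNorm φ - sqNorm (φ - ψ) ≤ measureProb φ E := by
  have h1 := measureProb_add_not φ E
  -- Off the event ψ vanishes, so there φ coincides with φ - ψ.
  have h2 : measureProb φ (fun s => ¬E s) ≤ sqNorm (φ - ψ) := by
    rw [measureProb_eq_tsum, sqNorm_eq_tsum]
    refine (summable_ind_sq φ _).tsum_le_tsum (fun s => ?_) (summable_sq _)
    by_cases hs : E s
    · rw [ind_false (not_not.2 hs), zero_mul]; positivity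
    · have : ψ s = 0 := by by_contra h0; exact hs (h s h0)
      rw [ind_true hs, one_mul, Finsupp.sub_apply, this, sub_zero]
  linarith

/-- Close states give close probabilities. -/
lemma measureProb_le_of_close {φ ψ : QState} (hφ : sqNorm φ = 1) (E : Wires → Prop) :
    measureProb ψ E ≤
      measureProb φ E + 2 * Real.sqrt (sqNorm (φ - ψ)) + sqNorm (φ - ψ) := by
  classical
  set T := φ.support ∪ ψ.support ∪ (φ - ψ).support with hT
  have z : ∀ χ : QState, χ.support ⊆ T → ∀ s ∉ T, χ s = 0 :=
    fun χ h s hs => Finsupp.notMem_support_iff.1 fun hh => hs (h hh)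
  have z1 := z φ (fun s hs => by simp only [hT, Finset.mem_union]; exact .inl (.inl hs))
  have z2 := z ψ (fun s hs => by simp only [hT, Finset.mem_union]; exact .inl (.inr hs))
  have z3 := z (φ - ψ) (fun s hs => by simp only [hT, Finset.mem_union]; exact .inr hs)
  have eN : ∀ χ : QState, (∀ s ∉ T, χ s = 0) → sqNorm χ = ∑ s ∈ T, ‖χ s‖ ^ 2 := fun χ h => by
    rw [sqNorm_eq_tsum, tsum_eq_sum fun s hs => by simp [h s hs]]
  have eM : ∀ χ : QState, (∀ s ∉ T, χ s = 0) →
      measureProb χ E = ∑ s ∈ T, ind (E s) * ‖χ s‖ ^ 2 := fun χ h => by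
    rw [measureProb_eq_tsum, tsum_eq_sum fun s hs => by simp [h s hs]]
  -- Cauchy–Schwarz bounds the cross term in the expansion of (|φ| + |φ - ψ|)².
  have cs := Real.sum_mul_le_sqrt_mul_sqrt T (fun s => ‖φ s‖) (fun s => ‖(φ - ψ) s‖)
  rw [← eN φ z1, ← eN _ z3, hφ, Real.sqrt_one, one_mul] at cs
  rw [eM ψ z2, eM φ z1, eN _ z3]
  rw [eN _ z3] at cs
  have pw : ∀ s ∈ T, ind (E s) * ‖ψ s‖ ^ 2 ≤
      ind (E s) * ‖φ s‖ ^ 2 + 2 * (‖φ s‖ * ‖(φ - ψ) s‖) + ‖(φ - ψ) s‖ ^ 2 := by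
    intro s _
    have h1 : ‖ψ s‖ ≤ ‖φ s‖ + ‖(φ - ψ) s‖ := by
      have := norm_sub_le (φ s) ((φ - ψ) s)
      simpa using this
    have h2 : ‖ψ s‖ ^ 2 ≤ (‖φ s‖ + ‖(φ - ψ) s‖) ^ 2 := pow_le_pow_left₀ (norm_nonneg _) h1 2
    have h3 : 0 ≤ ‖φ s‖ * ‖(φ - ψ) s‖ := by positivity
    by_cases h : E s
    · rw [ind_true h]; nlinarith
    · rw [ind_false h]; nlinarith [sq_nonneg ‖(φ - ψ) s‖]
  have := Finset.sum_le_sum pw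
  simp only [Finset.sum_add_distrib, ← Finset.mul_sum] at this
  linarith

lemma sum_le_measureProb {ι : Type*} [Fintype ι] {W : ι → Wires} (hW : Function.Injective W)
    (ψ : QState) (E : Wires → Prop) :
    ∑ i, ind (E (W i)) * ‖ψ (W i)‖ ^ 2 ≤ measureProb ψ E := by
  rw [measureProb_eq_tsum]
  have h := (summable_ind_sq ψ E).sum_le_tsum (Finset.univ.map ⟨W, hW⟩)
    (fun s _ => mul_nonneg (ind_nonneg _) (by positivity))
  rwa [Finset.sum_map] at h

/-! ## Circuits on registers -/

lemma enc_update_injective {L K r : ℕ} (hr : r < K) (B : ℕ → Wires) :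
    Function.Injective fun s => enc L K (Function.update B (r + 1) s) := by
  intro s s' h
  funext i
  have v : ValidWire L K (r + 1) i := ⟨hr, by simp⟩
  have := congrFun h (wire L K (r + 1) i)
  simpa [enc_wire v] using this

/-- By linearity it is enough to treat basis states, where the contents of the other registers are
mere spectators. -/
lemma runQ_map_wire {L K r : ℕ} (hr : r < K) (B : ℕ → Wires) (C : List QGate) (ψ : QState) :
    runQ (C.map (QGate.map (wire L K (r + 1))))
      (Finsupp.mapDomain (fun s => enc L K (Function.update B (r + 1) s)) ψ) =
    Finsupp.mapDomain (fun s => enc L K (Function.update B (r + 1) s)) (runQ C ψ) := by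
  have v : ∀ i, ValidWire L K (r + 1) i := fun i => ⟨hr, by simp⟩
  have gate : ∀ (g : QGate) (ψ : QState), (g.map (wire L K (r + 1))).act
      (Finsupp.mapDomain (fun s => enc L K (Function.update B (r + 1) s)) ψ) =
      Finsupp.mapDomain (fun s => enc L K (Function.update B (r + 1) s)) (g.act ψ) := by
    intro g ψ
    induction ψ using Finsupp.induction_linear with
    | zero => simp
    | add f g hf hg => rw [Finsupp.mapDomain_add, map_add, map_add, hf, hg, Finsupp.mapDomain_add]
    | single s a =>
      rw [Finsupp.mapDomain_single, QGate.act_single, QGate.act_single, Finsupp.mapDomain_smul]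
      congr 1
      have hu : ∀ i b, Function.update (enc L K (Function.update B (r + 1) s))
          (wire L K (r + 1) i) b =
          enc L K (Function.update B (r + 1) (Function.update s i b)) := by
        intro i b
        rw [← enc_update (v i), Function.update_idem, Function.update_self]
      have hw : ∀ i, enc L K (Function.update B (r + 1) s) (wire L K (r + 1) i) = s i := by
        intro i; rw [enc_wire (v i), Function.update_self]
      cases g with
      | classical g =>
        simp only [QGate.map, QGate.onBasis, Finsupp.mapDomain_single]
        rw [act_map_wire hr, Function.update_idem, Function.update_self]
      | hadamard k =>
        simp only [QGate.map, QGate.onBasis, Finsupp.mapDomain_add, Finsupp.mapDomain_single, hu, hw]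
      | tGate k =>
        simp only [QGate.map, QGate.onBasis, Finsupp.mapDomain_single, hw]
  induction C generalizing ψ with
  | nil => rfl
  | cons g C ih => rw [List.map_cons, runQ_cons, gate, ih, runQ_cons]

/-! ## Layers of Hadamard gates -/

/-- The sign `(-1) ^ (a * b)`. -/
def sgn (a b : Bool) : ℝ := if a && b then -1 else 1

/-- The matrix entries of the Walsh–Hadamard transform. The gate on the top wire splits s into two
terms, and only the one that agrees with s' on that wire survives the remaining gates. -/
lemma runQ_hadC_single (o m : ℕ) (s s' : Wires) :
    runQ (hadC o m) (Finsupp.single s 1) s' =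
      (((ind (∀ i, i < o ∨ o + m ≤ i → s i = s' i)) * ((1 / Real.sqrt 2) ^ m *
        ∏ i ∈ Finset.range m, sgn (s (o + i)) (s' (o + i))) : ℝ) : ℂ) := by
  induction m generalizing s with
  | zero =>
    simp only [hadC, downList, runQ_nil, Finset.range_zero, Finset.prod_empty, pow_zero, mul_one]
    by_cases h : s = s'
    · subst h
      rw [ind_true (by intros; rfl)]
      simp
    · rw [ind_false, Finsupp.single_eq_of_ne (Ne.symm h)]
      · simp
      · intro hs
        exact h (funext fun i => hs i (by omega))
  | succ m ih =>
    have e : hadC o (m + 1) = QGate.hadamard (o + m) :: hadC o m := rfl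
    have hp : ∀ v, ∏ i ∈ Finset.range m, sgn (Function.update s (o + m) v (o + i)) (s' (o + i)) =
        ∏ i ∈ Finset.range m, sgn (s (o + i)) (s' (o + i)) := by
      intro v
      refine Finset.prod_congr rfl fun i hi => ?_
      rw [Function.update_of_ne]
      have := Finset.mem_range.1 hi
      omega
    have hi : ∀ v, (∀ i, i < o ∨ o + m ≤ i → Function.update s (o + m) v i = s' i) ↔
        (s' (o + m) = v ∧ ∀ i, i < o ∨ o + (m + 1) ≤ i → s i = s' i) := by
      intro v
      constructor
      · intro h
        refine ⟨by simpa using (h (o + m) (by omega)).symm, fun i hi => ?_⟩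
        have := h i (by omega)
        rwa [Function.update_of_ne (by omega)] at this
      · rintro ⟨h1, h2⟩ i hi
        by_cases h3 : i = o + m
        · rw [h3, Function.update_self, h1]
        · rw [Function.update_of_ne h3]
          exact h2 i (by omega)
    rw [e, runQ_cons, QGate.act_single, one_smul, QGate.onBasis, map_add, Finsupp.add_apply]
    have sm : ∀ (t : Wires) (a : ℂ), runQ (hadC o m) (Finsupp.single t a) s' =
        a * runQ (hadC o m) (Finsupp.single t 1) s' := by
      intro t a
      have : Finsupp.single t a = a • Finsupp.single t (1 : ℂ) := by simp
      rw [this, map_smul, Finsupp.smul_apply, smul_eq_mul]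
    rw [sm, sm _ ((if s (o + m) = true then -1 else 1) / (Real.sqrt 2 : ℂ)), ih, ih]
    simp only [hp, hi, Finset.prod_range_succ, pow_succ]
    set Q := ∏ i ∈ Finset.range m, sgn (s (o + i)) (s' (o + i))
    by_cases hA : ∀ i, i < o ∨ o + (m + 1) ≤ i → s i = s' i
    · rw [ind_true hA]
      cases h1 : s' (o + m)
      · rw [ind_true ⟨rfl, hA⟩, ind_false (by simp)]
        simp [sgn]
        ring
      · rw [ind_false (by simp), ind_true ⟨rfl, hA⟩]
        cases h2 : s (o + m) <;> simp [sgn] <;> ring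
    · rw [ind_false hA, ind_false (fun h => hA h.2), ind_false (fun h => hA h.2)]
      simp

/-- Matrix entries between basis states that differ outside the transformed wires are zero, so an
event that ignores those wires continues to hold on the support. -/
lemma support_runQ_hadC {o m : ℕ} {ψ : QState} {E : Wires → Prop}
    (hE : ∀ s s', (∀ i, i < o ∨ o + m ≤ i → s i = s' i) → E s → E s')
    (h : ∀ s, ψ s ≠ 0 → E s) (s' : Wires) (hs' : runQ (hadC o m) ψ s' ≠ 0) : E s' := by
  have hsum : runQ (hadC o m) ψ s' =
      ψ.sum fun s a => a * runQ (hadC o m) (Finsupp.single s 1) s' := by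
    conv_lhs => rw [← Finsupp.sum_single ψ]
    rw [Finsupp.sum, map_sum, Finsupp.finsetSum_apply]
    refine Finset.sum_congr rfl fun s _ => ?_
    have : Finsupp.single s (ψ s) = ψ s • Finsupp.single s (1 : ℂ) := by simp
    rw [this, map_smul, Finsupp.smul_apply, smul_eq_mul]
  rw [hsum, Finsupp.sum] at hs'
  obtain ⟨s, hs, hne⟩ := Finset.exists_ne_zero_of_sum_ne_zero hs'
  rw [runQ_hadC_single] at hne
  refine hE s s' ?_ (h s (Finsupp.mem_support_iff.1 hs))
  by_contra hcon
  rw [ind_false hcon] at hne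
  simp at hne

/-! ## The prover -/

lemma run_blockC_reverse_cfg {L K r : ℕ} {C : List CGate} {l : List Wires} {w : Wires} (hr : r < K)
    (hl : r + 1 < l.length) :
    runC (blockC L K (r + 1) C).reverse (enc L K (cfg (l.set (r + 1) (runC C w)))) =
      enc L K (cfg (l.set (r + 1) w)) := by
  rw [← update_cfg hl, ← update_cfg hl]
  exact run_blockC_reverse hr C _ w

section Prover

variable (S : Setup) (w : PolyLen) (J Ji : Alg)

/-- Number of wires of the main register of the prover. -/
def proverLen : PolyLen := S.keyLen + S.ranLen + w + .const 1

/-- The first layer of the prover moves the key to the register of the state preparation. -/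
def proverInit (n : ℕ) : List CGate :=
  let L := (proverLen S w).len n
  xorC L 3 0 0 1 0 (S.keyLen.len n) ++ xorC L 3 1 0 0 0 (S.keyLen.len n)

/-- The state preparation, for a branch in uniform superposition. -/
def proverSamp (n : ℕ) : List QGate := hadC (S.keyLen.len n) 1 ++ S.samp.circ n

/-- The third layer of the prover transforms `b`, `x`, `y` into `y`, `J x`, `b`, in place. -/
def proverCode (n : ℕ) : List CGate :=
  let L := (proverLen S w).len n
  let κ := S.keyLen.len n
  let R := S.ranLen.len n
  let δ := S.domLen.len n
  let m := w.len n
  xorC L 3 1 (κ + 1) 2 0 δ ++ blockC L 3 2 (J.circ n) ++ xorC L 3 2 0 0 R m ++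
  (blockC L 3 2 (J.circ n)).reverse ++ xorC L 3 1 (κ + 1) 2 0 δ ++
  xorC L 3 0 R 3 0 m ++ blockC L 3 3 (Ji.circ n) ++ xorC L 3 3 0 1 (κ + 1) δ ++
  (blockC L 3 3 (Ji.circ n)).reverse ++ xorC L 3 0 R 3 0 m ++
  xorC L 3 1 κ 0 (R + m) 1 ++ xorC L 3 0 (R + m) 1 κ 1 ++ xorC L 3 1 (κ + 1 + δ) 0 0 R

/-- The prover. -/
def proverCirc (n : ℕ) : List QGate :=
  (proverInit S w n).map .classical ++
  (proverSamp S n).map (QGate.map (wire ((proverLen S w).len n) 3 1)) ++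
  ((proverCode S w J Ji n).map .classical ++ hadC (S.ranLen.len n) (w.len n + 1))

lemma uniform_proverCirc : Uniform (proverCirc S w J Ji) := by
  set L := proverLen S w with hL
  have hx : ∀ r a r' b m, UniformC fun n => xorC (L.len n) 3 r (PolyLen.len a n) r'
      (PolyLen.len b n) (PolyLen.len m n) := fun r a r' b m => uniformC_xorC L 3 r a r' b m
  have hb : ∀ r (A : Alg), UniformC fun n => blockC (L.len n) 3 (r + 1) (A.circ n) :=
    fun r A => UniformC.blockC A.poly L 3 r
  have h1 : UniformC (proverInit S w) := by
    have h := (hx 0 (.const 0) 1 (.const 0) S.keyLen).append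
      (hx 1 (.const 0) 0 (.const 0) S.keyLen)
    simp only [PolyLen.const_len] at h
    exact h
  have h2 : Uniform (proverSamp S) := by
    have h := (uniform_hadC S.keyLen (.const 1)).append S.samp.poly
    simp only [PolyLen.const_len] at h
    exact h
  have h3 : UniformC (proverCode S w J Ji) := by
    have h := ((((((((((((hx 1 (S.keyLen + .const 1) 2 (.const 0) S.domLen).append (hb 1 J)).append
      (hx 2 (.const 0) 0 S.ranLen w)).append (hb 1 J).reverse).append
      (hx 1 (S.keyLen + .const 1) 2 (.const 0) S.domLen)).append
      (hx 0 S.ranLen 3 (.const 0) w)).append (hb 2 Ji)).append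
      (hx 3 (.const 0) 1 (S.keyLen + .const 1) S.domLen)).append (hb 2 Ji).reverse).append
      (hx 0 S.ranLen 3 (.const 0) w)).append
      (hx 1 S.keyLen 0 (S.ranLen + w) (.const 1))).append
      (hx 0 (S.ranLen + w) 1 S.keyLen (.const 1))).append
      (hx 1 (S.keyLen + .const 1 + S.domLen) 0 (.const 0) S.ranLen)
    simp only [PolyLen.add_len, PolyLen.const_len] at h
    exact h
  have h4 : Uniform fun n => hadC (S.ranLen.len n) (w.len n + 1) := by
    have h := uniform_hadC S.ranLen (w + .const 1)
    simp only [PolyLen.add_len, PolyLen.const_len] at h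
    exact h
  exact ((uniform_classical.2 h1).append (h2.map_wire L 3 0)).append
    ((uniform_classical.2 h3).append h4)

/-- The prover as a QPT algorithm. -/
def prover : QPT := ⟨_, uniform_proverCirc S w J Ji⟩

variable {n : ℕ} (k : S.Key n)

/-- The basis state of the prover with answer `y`, `d`, `e`. -/
def proverState (y : S.Ran n) (d : Str (w.len n)) (e : Bool) : Wires :=
  enc ((proverLen S w).len n) 3 (cfg [load (List.ofFn y ++ List.ofFn d ++ [e]),
    load (List.ofFn k ++ [false] ++ List.ofFn (fun _ : Fin (S.domLen.len n) => false) ++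
      List.ofFn y), load [], load []])

/-- The wires of the prover with contents `s` of the register of the state preparation. -/
def proverEmb (n : ℕ) (s : Wires) : Wires :=
  enc ((proverLen S w).len n) 3 (Function.update (cfg [load [], load [], load [], load []]) 1 s)

lemma load_replicate_false (m : ℕ) : load [] = load (List.ofFn fun _ : Fin m => false) := by
  funext i
  by_cases h : i < m
  · exact (load_ofFn (fun _ : Fin m => false) ⟨i, h⟩).symm
  · exact (load_of_le (by simpa using h)).symm

lemma run_proverInit :
    runC (proverInit S w n) (load (List.ofFn k)) = proverEmb S w n (load (List.ofFn k)) := by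
  have hLe : (proverLen S w).len n = S.keyLen.len n + S.ranLen.len n + w.len n + 1 := rfl
  unfold proverInit proverEmb
  simp only
  generalize (proverLen S w).len n = L at *
  have hlen : (List.ofFn k).length = S.keyLen.len n := by simp
  rw [update_cfg (by simp), runC_append]
  conv_lhs => rw [enc_load_cfg (L := L) (K := 3) (l := List.ofFn k) (by omega) 3]
  have hcopy : xorSeg (load []) (load (List.ofFn k)) 0 0 (S.keyLen.len n) = load (List.ofFn k) := by
    rw [xorSeg_load (b := 0) rfl, List.nil_append]
    congr 2
    have := readStr_load_append (l := []) (l' := []) (v := k) rfl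
    rwa [List.append_nil, List.nil_append] at this
  have hself : xorSeg (load (List.ofFn k)) (load (List.ofFn k)) 0 0 (S.keyLen.len n) = load [] :=
    xorSeg_self fun i hi => load_of_le (by omega)
  set z := load []
  set l := load (List.ofFn k)
  set st : List Wires → Wires := fun l => enc L 3 (cfg l) with hst
  change runC _ (runC _ (st [l, z, z, z])) = _
  have s0 : runC (xorC L 3 0 0 1 0 (S.keyLen.len n)) (st [l, z, z, z]) = st [l, l, z, z] :=
    run_xorC_cfg hcopy (by omega) (by omega) (by omega) (by simp) (by omega) (by omega)
  have s1 : runC (xorC L 3 1 0 0 0 (S.keyLen.len n)) (st [l, l, z, z]) = st [z, l, z, z] :=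
    run_xorC_cfg hself (by omega) (by omega) (by omega) (by simp) (by omega) (by omega)
  rw [s0, s1]
  rfl

/-- J(x) is computed, copied out and uncomputed. The inverse of J is then run on that copy to erase
x, and is uncomputed as well. The branch bit is moved rather than copied. Afterwards all wires
outside the transformed segment depend on y alone, which is what allows the two branches of a claw
to interfere. -/
lemma run_proverCode (b : Bool) (x : S.Dom n) (y : S.Ran n)
    (hx : readStr (Ji.run n (List.ofFn (S.applyJ J (w.len n) x))) 0 (S.domLen.len n) = x) :
    runC (proverCode S w J Ji n)
      (proverEmb S w n (load (List.ofFn k ++ [b] ++ List.ofFn x ++ List.ofFn y))) =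
    proverState S w k y (S.applyJ J (w.len n) x) b := by
  have hLe : (proverLen S w).len n = S.keyLen.len n + S.ranLen.len n + w.len n + 1 := rfl
  unfold proverCode proverEmb proverState
  simp only
  generalize (proverLen S w).len n = L at *
  set κ := S.keyLen.len n
  set R := S.ranLen.len n
  set δ := S.domLen.len n
  set m := w.len n
  set u := S.applyJ J m x with hu
  have hb1 : [b] = List.ofFn (fun _ : Fin 1 => b) := by simp
  have hf1 : [false] = List.ofFn (fun _ : Fin 1 => false) := by simp
  set a1 := load (List.ofFn k ++ [b] ++ List.ofFn x ++ List.ofFn y) with ha1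
  set a2 := load (List.ofFn k ++ [b] ++ List.ofFn (fun _ : Fin δ => false) ++ List.ofFn y) with ha2
  set a3 := load (List.ofFn k ++ [false] ++ List.ofFn (fun _ : Fin δ => false) ++ List.ofFn y)
    with ha3
  set z := load [] with hz
  set c1 := load (List.ofFn (fun _ : Fin R => false) ++ List.ofFn u) with hc1
  set c2 := load (List.ofFn (fun _ : Fin R => false) ++ List.ofFn u ++ [b]) with hc2
  set c3 := load (List.ofFn y ++ List.ofFn u ++ [b]) with hc3
  have e0 : xorSeg z a1 (κ + 1) 0 δ = load (List.ofFn x) := by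
    rw [hz, xorSeg_load (b := 0) rfl, List.nil_append, ha1, List.append_assoc,
      readStr_load_append (by simp [κ])]
  have e2 : xorSeg z (runC (J.circ n) (load (List.ofFn x))) 0 R m = c1 := by
    rw [hz, load_replicate_false R, xorSeg_load (by simp)]
    rfl
  have e4 : xorSeg (load (List.ofFn x)) a1 (κ + 1) 0 δ = z := by rw [← e0, xorSeg_xorSeg]
  have e5 : xorSeg z c1 R 0 m = load (List.ofFn u) := by
    rw [hz, xorSeg_load (b := 0) rfl, List.nil_append, hc1]
    congr 2
    have := readStr_load_append (l := List.ofFn (fun _ : Fin R => false)) (l' := []) (v := u)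
      (a := R) (by simp)
    rwa [List.append_nil] at this
  have e7 : xorSeg a1 (runC (Ji.circ n) (load (List.ofFn u))) 0 (κ + 1) δ = a2 := by
    rw [ha1, ha2, List.append_assoc, List.append_assoc _ (List.ofFn fun _ => false)]
    exact xorSeg_erase (by simp [κ]) hx
  have e9 : xorSeg (load (List.ofFn u)) c1 R 0 m = z := by rw [← e5, xorSeg_xorSeg]
  have e10 : xorSeg c1 a2 κ (R + m) 1 = c2 := by
    rw [hc1, xorSeg_load (by simp [R, m]), hc2, hb1, ha2]
    congr 3
    rw [hb1, List.append_assoc, List.append_assoc]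
    exact readStr_load_append (by simp [κ])
  have e11 : xorSeg a2 c2 (R + m) κ 1 = a3 := by
    rw [ha2, ha3, hb1, hf1, List.append_assoc, List.append_assoc, List.append_assoc,
      List.append_assoc]
    refine xorSeg_erase (by simp [κ]) ?_
    rw [hc2, hb1, ← List.append_nil (_ ++ _ ++ _), List.append_assoc _ _ []]
    exact readStr_load_append (by simp [R, m])
  have e12 : xorSeg c2 a3 (κ + 1 + δ) 0 R = c3 := by
    have h : xorSeg c3 a3 (κ + 1 + δ) 0 R = c2 := by
      rw [hc3, hc2, List.append_assoc, List.append_assoc]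
      refine xorSeg_erase (l := []) rfl ?_
      rw [ha3, ← List.append_nil (_ ++ _ ++ _ ++ _), List.append_assoc _ _ []]
      exact readStr_load_append (by simp [κ, δ]; omega)
    rw [← h, xorSeg_xorSeg]
  rw [update_cfg (by simp)]
  simp only [runC_append]
  set st : List Wires → Wires := fun l => enc L 3 (cfg l) with hst
  change runC _ (runC _ (runC _ (runC _ (runC _ (runC _ (runC _ (runC _ (runC _ (runC _ (runC _
    (runC _ (runC _ (st [z, a1, z, z]))))))))))))) = st [c3, a3, z, z]
  have s0 : runC (xorC L 3 1 (κ + 1) 2 0 δ) (st [z, a1, z, z]) =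
      st [z, a1, load (List.ofFn x), z] :=
    run_xorC_cfg e0 (by omega) (by omega) (by omega) (by simp) (by omega) (by omega)
  have s1 : runC (blockC L 3 2 (J.circ n)) (st [z, a1, load (List.ofFn x), z]) =
      st [z, a1, runC (J.circ n) (load (List.ofFn x)), z] :=
    run_blockC_cfg (by omega) (by simp)
  have s2 : runC (xorC L 3 2 0 0 R m) (st [z, a1, runC (J.circ n) (load (List.ofFn x)), z]) =
      st [c1, a1, runC (J.circ n) (load (List.ofFn x)), z] :=
    run_xorC_cfg e2 (by omega) (by omega) (by omega) (by simp) (by omega) (by omega)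
  have s3 : runC (blockC L 3 2 (J.circ n)).reverse
      (st [c1, a1, runC (J.circ n) (load (List.ofFn x)), z]) =
      st [c1, a1, load (List.ofFn x), z] :=
    run_blockC_reverse_cfg (r := 1) (l := [c1, a1, z, z]) (by omega) (by simp)
  have s4 : runC (xorC L 3 1 (κ + 1) 2 0 δ) (st [c1, a1, load (List.ofFn x), z]) =
      st [c1, a1, z, z] :=
    run_xorC_cfg e4 (by omega) (by omega) (by omega) (by simp) (by omega) (by omega)
  have s5 : runC (xorC L 3 0 R 3 0 m) (st [c1, a1, z, z]) =
      st [c1, a1, z, load (List.ofFn u)] :=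
    run_xorC_cfg e5 (by omega) (by omega) (by omega) (by simp) (by omega) (by omega)
  have s6 : runC (blockC L 3 3 (Ji.circ n)) (st [c1, a1, z, load (List.ofFn u)]) =
      st [c1, a1, z, runC (Ji.circ n) (load (List.ofFn u))] :=
    run_blockC_cfg (by omega) (by simp)
  have s7 : runC (xorC L 3 3 0 1 (κ + 1) δ)
      (st [c1, a1, z, runC (Ji.circ n) (load (List.ofFn u))]) =
      st [c1, a2, z, runC (Ji.circ n) (load (List.ofFn u))] :=
    run_xorC_cfg e7 (by omega) (by omega) (by omega) (by simp) (by omega) (by omega)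
  have s8 : runC (blockC L 3 3 (Ji.circ n)).reverse
      (st [c1, a2, z, runC (Ji.circ n) (load (List.ofFn u))]) =
      st [c1, a2, z, load (List.ofFn u)] :=
    run_blockC_reverse_cfg (r := 2) (l := [c1, a2, z, z]) (by omega) (by simp)
  have s9 : runC (xorC L 3 0 R 3 0 m) (st [c1, a2, z, load (List.ofFn u)]) =
      st [c1, a2, z, z] :=
    run_xorC_cfg e9 (by omega) (by omega) (by omega) (by simp) (by omega) (by omega)
  have s10 : runC (xorC L 3 1 κ 0 (R + m) 1) (st [c1, a2, z, z]) = st [c2, a2, z, z] :=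
    run_xorC_cfg e10 (by omega) (by omega) (by omega) (by simp) (by omega) (by omega)
  have s11 : runC (xorC L 3 0 (R + m) 1 κ 1) (st [c2, a2, z, z]) = st [c2, a3, z, z] :=
    run_xorC_cfg e11 (by omega) (by omega) (by omega) (by simp) (by omega) (by omega)
  have s12 : runC (xorC L 3 1 (κ + 1 + δ) 0 0 R) (st [c2, a3, z, z]) = st [c3, a3, z, z] :=
    run_xorC_cfg e12 (by omega) (by omega) (by omega) (by simp) (by omega) (by omega)
  rw [s0, s1, s2, s3, s4, s5, s6, s7, s8, s9, s10, s11, s12]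

end Prover

/-! ## Characters -/

/-- The sign `(-1) ^ (d · u)`. -/
noncomputable def chi {m : ℕ} (d u : Str m) : ℝ := ∏ i, sgn (u i) (d i)

lemma chi_eq {m : ℕ} (d u : Str m) : chi d u = if dot d u then -1 else 1 := by
  have h : chi d u = (-1) ^ (Finset.univ.filter (fun i => (d i && u i) = true)).card := by
    rw [← Finset.prod_const, Finset.prod_filter]
    exact Finset.prod_congr rfl fun i _ => by simp only [sgn, Bool.and_comm]
  rw [h, dot]
  generalize (Finset.univ.filter (fun i => (d i && u i) = true)).card = c
  by_cases ho : Odd c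
  · simp [ho.neg_one_pow, ho]
  · simp [(Nat.not_odd_iff_even.1 ho).neg_one_pow, ho]

lemma sgn_xor (a b c : Bool) : sgn (xor a b) c = sgn a c * sgn b c := by
  cases a <;> cases b <;> cases c <;> norm_num [sgn]

lemma chi_xorStr {m : ℕ} (d u v : Str m) : chi d (xorStr u v) = chi d u * chi d v := by
  rw [chi, chi, chi, ← Finset.prod_mul_distrib]
  exact Finset.prod_congr rfl fun i _ => sgn_xor _ _ _

lemma chi_mul_self {m : ℕ} (d u : Str m) : chi d u * chi d u = 1 := by
  rw [chi_eq]; split_ifs <;> norm_num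

/-! ### The final state of the prover: outcomes, preparation error and the ideal state -/

section Prover

variable (S : Setup) (w : PolyLen) (J Ji : Alg) {n : ℕ} (k : S.Key n)

lemma proverState_lt (y : S.Ran n) (d : Str (w.len n)) (e : Bool) {i : ℕ}
    (hi : i < (proverLen S w).len n) :
    proverState S w k y d e i = load (List.ofFn y ++ (List.ofFn d ++ [e])) i := by
  rw [proverState, enc, if_pos hi, ← List.append_assoc]
  rfl

lemma proverState_image (y : S.Ran n) (d : Str (w.len n)) (e : Bool) :
    readStr (proverState S w k y d e) 0 (S.ranLen.len n) = y := by
  have hL : (proverLen S w).len n = S.keyLen.len n + S.ranLen.len n + w.len n + 1 := rfl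
  refine Eq.trans (funext fun i => ?_) (readStr_load_append (l := []) (v := y)
    (l' := List.ofFn d ++ [e]) rfl)
  exact proverState_lt S w k y d e (by omega)

lemma proverState_string (y : S.Ran n) (d : Str (w.len n)) (e : Bool) :
    readStr (proverState S w k y d e) (S.ranLen.len n) (w.len n) = d := by
  have hL : (proverLen S w).len n = S.keyLen.len n + S.ranLen.len n + w.len n + 1 := rfl
  refine Eq.trans (funext fun i => ?_) (readStr_load_append (l := List.ofFn y) (v := d)
    (l' := [e]) (a := S.ranLen.len n) (by simp))
  exact proverState_lt S w k y d e (by omega)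

lemma proverState_bit (y : S.Ran n) (d : Str (w.len n)) (e : Bool) :
    proverState S w k y d e (S.ranLen.len n + w.len n) = e := by
  have hL : (proverLen S w).len n = S.keyLen.len n + S.ranLen.len n + w.len n + 1 := rfl
  rw [proverState_lt S w k y d e (by omega), ← List.append_assoc, load_append, if_neg (by simp)]
  simp [load]

/-- Outside the segment of d and e the basis state records nothing but y. Contributions with
different images stay orthogonal, and those with the same image interfere. -/
lemma proverState_agree (y y' : S.Ran n) (d d' : Str (w.len n)) (e e' : Bool) :
    (∀ i, i < S.ranLen.len n ∨ S.ranLen.len n + (w.len n + 1) ≤ i →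
      proverState S w k y d e i = proverState S w k y' d' e' i) ↔ y = y' := by
  have hL : (proverLen S w).len n = S.keyLen.len n + S.ranLen.len n + w.len n + 1 := rfl
  constructor
  · intro h
    rw [← proverState_image S w k y d e, ← proverState_image S w k y' d' e']
    funext i
    exact h _ (Or.inl (by omega))
  · rintro rfl i hi
    by_cases h : i < (proverLen S w).len n
    · rw [proverState_lt S w k y d e h, proverState_lt S w k y d' e' h]
      rcases hi with hi | hi
      · rw [load_append, if_pos (by simpa using hi), load_append, if_pos (by simpa using hi)]
      · rw [load_of_le (by simpa using hi), load_of_le (by simpa using hi)]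
    · simp only [proverState, enc, if_neg h]
      rfl

lemma runQ_hadC_proverState (y y' : S.Ran n) (d u : Str (w.len n)) (e b : Bool) :
    runQ (hadC (S.ranLen.len n) (w.len n + 1)) (Finsupp.single (proverState S w k y' u b) 1)
      (proverState S w k y d e) =
    ((ind (y' = y) * ((1 / Real.sqrt 2) ^ (w.len n + 1) * (chi d u * sgn b e)) : ℝ) : ℂ) := by
  rw [runQ_hadC_single, proverState_agree, Finset.prod_range_succ, proverState_bit,
    proverState_bit, Finset.prod_range]
  have h : ∏ i : Fin (w.len n), sgn (proverState S w k y' u b (S.ranLen.len n + i))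
      (proverState S w k y d e (S.ranLen.len n + i)) = chi d u :=
    Finset.prod_congr rfl fun i _ => congrArg₂ sgn
      (congrFun (proverState_string S w k y' u b) i) (congrFun (proverState_string S w k y d e) i)
  rw [h]

/-- The gates of the prover after the state preparation. -/
def proverTail (n : ℕ) : List QGate :=
  (proverCode S w J Ji n).map .classical ++ hadC (S.ranLen.len n) (w.len n + 1)

/-- The final state of the prover if the state preparation for the functions `p` is exact. -/
noncomputable def idealState (p : Bool → S.Dom n → PMF (S.Ran n)) : QState :=
  runQ (proverTail S w J Ji n) (Finsupp.mapDomain (proverEmb S w n)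
    ((1 / (Real.sqrt 2 : ℂ)) • (S.target n k false (p false) + S.target n k true (p true))))

lemma proverEmb_injective : Function.Injective (proverEmb S w n) :=
  enc_update_injective (by omega) _

/-- The wire after the key is 0 at the start, so the Hadamard gate on it yields the equal
superposition of both branch inputs. Everything after that is linear. -/
lemma prover_run_eq : (prover S w J Ji).run n (List.ofFn k) =
    runQ (proverTail S w J Ji n) (Finsupp.mapDomain (proverEmb S w n)
      ((1 / (Real.sqrt 2 : ℂ)) • (S.samp.run n (List.ofFn k ++ [false]) +
        S.samp.run n (List.ofFn k ++ [true])))) := by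
  have hu : ∀ v, Function.update (load (List.ofFn k)) (S.keyLen.len n) v =
      load (List.ofFn k ++ [v]) := by
    intro v
    funext i
    rw [load_append, Function.update_apply, List.length_ofFn]
    split_ifs with h1 h2 h2
    · omega
    · subst h1; simp [load]
    · rfl
    · rw [load_of_le (by simp; omega), load_of_le (by simp; omega)]
  rw [QPT.run_eq]
  change runQ (_ ++ _ ++ proverTail S w J Ji n) _ = _
  rw [runQ_append, runQ_append, runQ_classical_single, run_proverInit]
  congr 1
  have h := runQ_map_wire (L := (proverLen S w).len n) (K := 3) (r := 0) (by omega)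
    (cfg [load [], load [], load [], load []]) (proverSamp S n)
    (Finsupp.single (load (List.ofFn k)) 1)
  rw [Finsupp.mapDomain_single] at h
  refine h.trans ?_
  change Finsupp.mapDomain (proverEmb S w n) _ = _
  congr 1
  have hh : hadC (S.keyLen.len n) 1 = [QGate.hadamard (S.keyLen.len n)] := rfl
  rw [proverSamp, runQ_append, hh, runQ_cons, runQ_nil, QGate.act_single, one_smul,
    QGate.onBasis, load_of_le (by simp), hu, hu, map_add, QPT.run_eq, QPT.run_eq, smul_add,
    ← map_smul, ← map_smul, Finsupp.smul_single, Finsupp.smul_single]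
  simp

lemma sqNorm_prover_run : sqNorm ((prover S w J Ji).run n (List.ofFn k)) = 1 := by
  rw [QPT.run_eq, sqNorm_runQ, sqNorm_single]; simp

/-- The remaining gates and the embedding into the wires preserve norms. The factor 1/2 from the
branch superposition meets 2(ε + ε) from the sum of the two errors. -/
lemma sqNorm_prover_sub {p : Bool → S.Dom n → PMF (S.Ran n)} {ε : ℝ}
    (h : ∀ b, sqNorm (S.samp.run n (List.ofFn k ++ [b]) - S.target n k b (p b)) ≤ ε) :
    sqNorm ((prover S w J Ji).run n (List.ofFn k) - idealState S w J Ji k p) ≤ 2 * ε := by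
  rw [prover_run_eq, idealState, ← map_sub, sqNorm_runQ, ← Finsupp.mapDomain.addMonoidHom_apply,
    ← Finsupp.mapDomain.addMonoidHom_apply, ← map_sub, Finsupp.mapDomain.addMonoidHom_apply,
    sqNorm_mapDomain (proverEmb_injective S w), ← smul_sub, sqNorm_smul, add_sub_add_comm]
  have h2 : ‖(1 / (Real.sqrt 2 : ℂ))‖ ^ 2 = 1 / 2 := by
    rw [norm_div, norm_one, Complex.norm_real, div_pow, Real.norm_eq_abs, sq_abs,
      Real.sq_sqrt (by norm_num), one_pow]
  rw [h2]
  have := sqNorm_add_le (S.samp.run n (List.ofFn k ++ [false]) - S.target n k false (p false))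
    (S.samp.run n (List.ofFn k ++ [true]) - S.target n k true (p true))
  linarith [h false, h true]

lemma runQ_proverCode_target (hJ : ∀ x ∈ S.X.set n,
    readStr (Ji.run n (List.ofFn (S.applyJ J (w.len n) x))) 0 (S.domLen.len n) = x) (b : Bool) (p : S.Dom n → PMF (S.Ran n)) :
    runQ ((proverCode S w J Ji n).map .classical)
      (Finsupp.mapDomain (proverEmb S w n) (S.target n k b p)) =
    ∑ x ∈ S.X.set n, ∑ y : S.Ran n,
      ((Real.sqrt ((p x y).toReal / (S.X.set n).card) : ℝ) : ℂ) •
        Finsupp.single (proverState S w k y (S.applyJ J (w.len n) x) b) 1 := by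
  rw [Setup.target, Finsupp.mapDomain_finsetSum, map_sum]
  refine Finset.sum_congr rfl fun x hx => ?_
  rw [Finsupp.mapDomain_finsetSum, map_sum]
  refine Finset.sum_congr rfl fun y _ => ?_
  rw [Finsupp.mapDomain_single, ← mul_one ((Real.sqrt _ : ℝ) : ℂ), ← smul_eq_mul,
    ← Finsupp.smul_single, map_smul, runQ_classical_single,
    run_proverCode S w J Ji k b x y (hJ x hx)]
  simp

end Prover

/-! ### Amplitudes and support of the ideal final state -/

section Prover

variable (S : Setup) (w : PolyLen) (J Ji : Alg) {n : ℕ} (k : S.Key n)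

lemma idealState_eq (p : Bool → S.Dom n → PMF (S.Ran n)) : idealState S w J Ji k p =
    (1 / (Real.sqrt 2 : ℂ)) • runQ (hadC (S.ranLen.len n) (w.len n + 1))
      (runQ ((proverCode S w J Ji n).map .classical)
        (Finsupp.mapDomain (proverEmb S w n) (S.target n k false (p false))) +
      runQ ((proverCode S w J Ji n).map .classical)
        (Finsupp.mapDomain (proverEmb S w n) (S.target n k true (p true)))) := by
  rw [idealState, proverTail, runQ_append, Finsupp.mapDomain_smul, Finsupp.mapDomain_add, map_smul,
    map_add, map_smul]

/-- Of the w + 2 factors 1/√2, w + 1 come from the final Hadamard layer and one from the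
superposition of the branches. -/
lemma idealState_apply (hJ : ∀ x ∈ S.X.set n,
    readStr (Ji.run n (List.ofFn (S.applyJ J (w.len n) x))) 0 (S.domLen.len n) = x)
    (p : Bool → S.Dom n → PMF (S.Ran n)) (y : S.Ran n) (d : Str (w.len n)) (e : Bool) :
    idealState S w J Ji k p (proverState S w k y d e) =
      (((1 / Real.sqrt 2) ^ (w.len n + 2) *
        (∑ x ∈ S.X.set n, Real.sqrt ((p false x y).toReal / (S.X.set n).card) *
            (chi d (S.applyJ J (w.len n) x) * sgn false e) +
          ∑ x ∈ S.X.set n, Real.sqrt ((p true x y).toReal / (S.X.set n).card) *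
            (chi d (S.applyJ J (w.len n) x) * sgn true e)) : ℝ) : ℂ) := by
  have h : ∀ b, runQ (hadC (S.ranLen.len n) (w.len n + 1))
      (∑ x ∈ S.X.set n, ∑ y : S.Ran n,
        ((Real.sqrt ((p b x y).toReal / (S.X.set n).card) : ℝ) : ℂ) •
        Finsupp.single (proverState S w k y (S.applyJ J (w.len n) x) b) 1)
      (proverState S w k y d e) =
      (((1 / Real.sqrt 2) ^ (w.len n + 1) * ∑ x ∈ S.X.set n,
        Real.sqrt ((p b x y).toReal / (S.X.set n).card) *
            (chi d (S.applyJ J (w.len n) x) * sgn b e) : ℝ) : ℂ) := by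
    intro b
    rw [map_sum, Finsupp.finsetSum_apply, Finset.mul_sum, Complex.ofReal_sum]
    refine Finset.sum_congr rfl fun x _ => ?_
    rw [map_sum, Finsupp.finsetSum_apply, Finset.sum_eq_single y]
    · rw [map_smul, Finsupp.smul_apply, runQ_hadC_proverState, ind_true rfl, smul_eq_mul,
        ← Complex.ofReal_mul]
      congr 1
      ring
    · intro y' _ hy
      rw [map_smul, Finsupp.smul_apply, runQ_hadC_proverState, ind_false hy]
      simp
    · intro hy
      exact absurd (Finset.mem_univ _) hy
  rw [idealState_eq, runQ_proverCode_target S w J Ji k hJ, runQ_proverCode_target S w J Ji k hJ,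
    Finsupp.smul_apply, map_add, Finsupp.add_apply, h, h, smul_eq_mul]
  push_cast
  ring

/-- Before the last layer only images in the supports of p occur, and the last layer does not touch
the wires of the image. -/
lemma idealState_support (hJ : ∀ x ∈ S.X.set n,
    readStr (Ji.run n (List.ofFn (S.applyJ J (w.len n) x))) 0 (S.domLen.len n) = x)
    {p : Bool → S.Dom n → PMF (S.Ran n)} {E : S.Ran n → Prop}
    (hE : ∀ b, ∀ x ∈ S.X.set n, ∀ y ∈ (p b x).support, E y) (s : Wires)
    (hs : idealState S w J Ji k p s ≠ 0) : E (readStr s 0 (S.ranLen.len n)) := by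
  have hb : ∀ b s, (∑ x ∈ S.X.set n, ∑ y : S.Ran n,
      ((Real.sqrt ((p b x y).toReal / (S.X.set n).card) : ℝ) : ℂ) •
      Finsupp.single (proverState S w k y (S.applyJ J (w.len n) x) b) (1 : ℂ)) s ≠ 0 →
      E (readStr s 0 (S.ranLen.len n)) := by
    intro b s h
    rw [Finsupp.finsetSum_apply] at h
    obtain ⟨x, hx, h⟩ := Finset.exists_ne_zero_of_sum_ne_zero h
    rw [Finsupp.finsetSum_apply] at h
    obtain ⟨y, -, h⟩ := Finset.exists_ne_zero_of_sum_ne_zero h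
    rw [Finsupp.smul_apply, smul_eq_mul] at h
    have h1 := left_ne_zero_of_mul h
    have h2 := right_ne_zero_of_mul h
    have e : proverState S w k y (S.applyJ J (w.len n) x) b = s := by
      by_contra hne
      exact h2 (Finsupp.single_eq_of_ne (Ne.symm hne))
    rw [← e, proverState_image]
    refine hE b x hx y ?_
    rw [PMF.mem_support_iff]
    intro h0
    rw [h0] at h1
    simp at h1
  rw [idealState_eq, runQ_proverCode_target S w J Ji k hJ, runQ_proverCode_target S w J Ji k hJ,
    Finsupp.smul_apply, smul_eq_mul] at hs
  refine support_runQ_hadC (E := fun s => E (readStr s 0 (S.ranLen.len n))) ?_ ?_ s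
    (right_ne_zero_of_mul hs)
  · intro s s' h hs
    have : readStr s 0 (S.ranLen.len n) = readStr s' 0 (S.ranLen.len n) :=
      funext fun i => h _ (Or.inl (by omega))
    rwa [← this]
  · intro s h
    rw [Finsupp.add_apply] at h
    by_cases h0 : (∑ x ∈ S.X.set n, ∑ y : S.Ran n,
      ((Real.sqrt ((p false x y).toReal / (S.X.set n).card) : ℝ) : ℂ) •
      Finsupp.single (proverState S w k y (S.applyJ J (w.len n) x) false) (1 : ℂ)) s = 0
    · rw [h0, zero_add] at h
      exact hb true s h
    · exact hb false s h0

end Prover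

/-! ## Hellinger distance -/

lemma sum_toReal_pmf {m : ℕ} (p : PMF (Str m)) : ∑ y, (p y).toReal = 1 := by
  rw [← ENNReal.toReal_sum fun y _ => p.apply_ne_top y, ← tsum_fintype (L := .unconditional _),
    p.tsum_coe]
  rfl

/-- Expand the squares. Twice H² is the squared Euclidean distance of the vectors √p and √q. -/
lemma two_mul_hellingerSq {m : ℕ} (p q : PMF (Str m)) :
    2 * hellingerSq p q = ∑ y, (Real.sqrt (p y).toReal - Real.sqrt (q y).toReal) ^ 2 := by
  have h : ∀ y, (Real.sqrt (p y).toReal - Real.sqrt (q y).toReal) ^ 2 =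
      (p y).toReal + (q y).toReal - 2 * Real.sqrt ((p y).toReal * (q y).toReal) := by
    intro y
    rw [Real.sqrt_mul ENNReal.toReal_nonneg, sub_sq, Real.sq_sqrt ENNReal.toReal_nonneg,
      Real.sq_sqrt ENNReal.toReal_nonneg]
    ring
  simp only [h, Finset.sum_sub_distrib, Finset.sum_add_distrib, sum_toReal_pmf, ← Finset.mul_sum,
    hellingerSq]
  ring

lemma hellingerSq_nonneg {m : ℕ} (p q : PMF (Str m)) : 0 ≤ hellingerSq p q := by
  have h := two_mul_hellingerSq p q
  have : 0 ≤ ∑ y, (Real.sqrt (p y).toReal - Real.sqrt (q y).toReal) ^ 2 :=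
    Finset.sum_nonneg fun y _ => sq_nonneg _
  linarith

/-- The triangle inequality for the vectors of square roots, squared with (a + b)² ≤ 2a² + 2b². For
a claw the middle point is the common value of f at both ends. -/
lemma hellingerSq_le {m : ℕ} (p q f : PMF (Str m)) :
    hellingerSq p q ≤ 2 * hellingerSq f p + 2 * hellingerSq f q := by
  have h1 := two_mul_hellingerSq p q
  have h2 := two_mul_hellingerSq f p
  have h3 := two_mul_hellingerSq f q
  have : ∑ y, (Real.sqrt (p y).toReal - Real.sqrt (q y).toReal) ^ 2 ≤
      ∑ y, (2 * (Real.sqrt (f y).toReal - Real.sqrt (p y).toReal) ^ 2 +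
        2 * (Real.sqrt (f y).toReal - Real.sqrt (q y).toReal) ^ 2) := by
    refine Finset.sum_le_sum fun y _ => ?_
    nlinarith [sq_nonneg ((Real.sqrt (f y).toReal - Real.sqrt (p y).toReal) +
      (Real.sqrt (f y).toReal - Real.sqrt (q y).toReal))]
  rw [Finset.sum_add_distrib, ← Finset.mul_sum, ← Finset.mul_sum] at this
  linarith

/-! ## Negligible functions -/

lemma Negl.abs {ν : ℕ → ℝ} (h : Negl ν) : Negl fun n => |ν n| :=
  (Asymptotics.superpolynomialDecay_iff_abs_tendsto_zero _ _ _).2 fun m => by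
    simpa [abs_mul] using (Asymptotics.superpolynomialDecay_iff_abs_tendsto_zero _ _ _).1 h m

/-- Decay of √|ν| against n^m is decay of |ν| against n^(2m), by continuity of the square root at 0.
-/
lemma Negl.sqrt {ν : ℕ → ℝ} (h : Negl ν) : Negl fun n => Real.sqrt |ν n| := by
  intro m
  have h1 := ((Real.continuous_sqrt.tendsto 0).comp (h.abs (m * 2)))
  rw [Real.sqrt_zero] at h1
  refine h1.congr fun n => ?_
  have h2 : ((n : ℝ) ^ (m * 2)) * |ν n| = ((n : ℝ) ^ m) ^ 2 * |ν n| := by rw [pow_mul]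
  simp only [Function.comp_apply]
  rw [h2, Real.sqrt_mul (by positivity), Real.sqrt_sq (by positivity)]

lemma negl_of_eventually_zero {ν : ℕ → ℝ} {N : ℕ} (h : ∀ n, N < n → ν n = 0) : Negl ν := by
  intro m
  refine tendsto_const_nhds.congr' ?_
  filter_upwards [Filter.eventually_gt_atTop N] with n hn
  rw [h n hn, mul_zero]

/-! ### Acceptance of the ideal state in the equation test -/

namespace E3NTCF

variable (P : E3NTCF) (Ji : Alg) {n : ℕ} {k : P.S.Key n}

/-- The basis state of the prover with a given answer. -/
def answerState (k : P.S.Key n) (a : P.Answer n) : Wires :=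
  proverState P.S P.F.w k a.y a.d a.e

lemma readAnswer_answerState (a : P.Answer n) : P.readAnswer n (P.answerState k a) = a := by
  rcases a with ⟨y, d, e⟩
  simp only [readAnswer, answerState, proverState_image, proverState_string, proverState_bit]

/-- The final state of the prover on a key of `F`, up to errors in the state preparation. -/
noncomputable def eqState (k : P.S.Key n) : QState :=
  idealState P.S P.F.w P.F.J Ji k (P.F.fHat n k)

variable {t : Str (P.F.gen.trapLen.len n)}

lemma fHat_eq_of_mem (hg : (k, t) ∈ P.F.good n) {b : Bool} {x x' : P.S.Dom n} {y : P.S.Ran n}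
    (hx : x ∈ P.S.X.set n) (hx' : x' ∈ P.S.X.set n) (hy : y ∈ (P.F.fHat n k b x).support)
    (hy' : y ∈ (P.F.fHat n k b x').support) : x = x' :=
  (P.F.inv_fHat n k t hg b x hx y hy).symm.trans (P.F.inv_fHat n k t hg b x' hx' y hy')

/-- On each branch inversion leaves a single preimage of y, so the amplitude has just two terms,
with signs χ(d, J x₀) and χ(d, J x₁)·(-1)^e. For the correct e both signs equal χ(d, J x₀), and the
terms add up. -/
lemma norm_eqState_ge (hJ : ∀ x ∈ P.S.X.set n, readStr (Ji.run n
      (List.ofFn (P.S.applyJ P.F.J (P.F.w.len n) x))) 0 (P.S.domLen.len n) = x)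
    (hg : (k, t) ∈ P.F.good n) {x₀ x₁ : P.S.Dom n} (hc : (x₀, x₁) ∈ P.S.claws P.F.f n k)
    {y : P.S.Ran n} (h0 : y ∈ (P.F.fHat n k false x₀).support)
    (h1 : y ∈ (P.F.fHat n k true x₁).support) (d : Str (P.F.w.len n)) :
    Real.sqrt ((P.F.fHat n k false x₀ y).toReal * (P.F.fHat n k true x₁ y).toReal) /
        (P.S.X.set n).card * (1 / 2 ^ P.F.w.len n) ≤
      ‖P.eqState Ji k (P.answerState k ⟨y, d, dot d (xorStr (P.S.applyJ P.F.J (P.F.w.len n) x₀)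
        (P.S.applyJ P.F.J (P.F.w.len n) x₁))⟩)‖ ^ 2 := by
  have hne : ∀ b x, x ∈ P.S.X.set n → ∀ x' ∈ P.S.X.set n, y ∈ (P.F.fHat n k b x).support →
      x' ≠ x → P.F.fHat n k b x' y = 0 := by
    intro b x hx x' hx' hy hxx
    by_contra h
    exact hxx (P.fHat_eq_of_mem hg hx' hx ((PMF.mem_support_iff _ _).2 h) hy)
  rw [eqState, answerState, idealState_apply P.S P.F.w P.F.J Ji k hJ,
    Finset.sum_eq_single x₀ (fun x hx h => by rw [hne false x₀ hc.1 x hx h0 h]; simp)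
      (fun h => absurd hc.1 h),
    Finset.sum_eq_single x₁ (fun x hx h => by rw [hne true x₁ hc.2.1 x hx h1 h]; simp)
      (fun h => absurd hc.2.1 h)]
  dsimp only
  generalize P.S.applyJ P.F.J (P.F.w.len n) x₀ = u₀
  generalize P.S.applyJ P.F.J (P.F.w.len n) x₁ = u₁
  have hs0 : sgn false (dot d (xorStr u₀ u₁)) = 1 := by simp [sgn]
  have hs1 : sgn true (dot d (xorStr u₀ u₁)) = chi d u₀ * chi d u₁ := by
    rw [← chi_xorStr, chi_eq]; simp [sgn]
  have c0 := chi_mul_self d u₀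
  have c1 := chi_mul_self d u₁
  rw [hs0, hs1, Complex.norm_real, Real.norm_eq_abs, sq_abs]
  set q₀ := (P.F.fHat n k false x₀ y).toReal
  set q₁ := (P.F.fHat n k true x₁ y).toReal
  have hq0 : 0 ≤ q₀ := ENNReal.toReal_nonneg
  have hq1 : 0 ≤ q₁ := ENNReal.toReal_nonneg
  set N : ℝ := ((P.S.X.set n).card : ℝ)
  have hN : 0 ≤ N := Nat.cast_nonneg _
  have hprod : Real.sqrt (q₀ * q₁) / N = Real.sqrt (q₀ / N) * Real.sqrt (q₁ / N) := by
    rw [← Real.sqrt_mul (by positivity), div_mul_div_comm, Real.sqrt_div (by positivity),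
      Real.sqrt_mul_self hN]
  have hpow : ((1 / Real.sqrt 2) ^ (P.F.w.len n + 2)) ^ 2 = 1 / 2 ^ P.F.w.len n * (1 / 4) := by
    rw [← pow_mul, mul_comm, pow_mul, div_pow, Real.sq_sqrt (by norm_num), one_pow, pow_add,
      one_div_pow]
    norm_num
  rw [hprod, mul_pow, hpow]
  set a := Real.sqrt (q₀ / N)
  set b := Real.sqrt (q₁ / N)
  have hsum : (a * (chi d u₀ * 1) + b * (chi d u₁ * (chi d u₀ * chi d u₁))) ^ 2 = (a + b) ^ 2 := by
    have : a * (chi d u₀ * 1) + b * (chi d u₁ * (chi d u₀ * chi d u₁)) =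
        chi d u₀ * (a + b * (chi d u₁ * chi d u₁)) := by ring
    rw [this, c1, mul_pow, sq (chi d u₀), c0]
    ring
  rw [hsum]
  -- What remains is (a + b)²/4 ≥ ab, which is (a - b)² ≥ 0.
  have h2 : 0 < (1 : ℝ) / 2 ^ P.F.w.len n := by positivity
  nlinarith [mul_nonneg h2.le (sq_nonneg (a - b))]

lemma eqAccepts_of_claw (hg : (k, t) ∈ P.F.good n) {x₀ x₁ : P.S.Dom n}
    (hc : (x₀, x₁) ∈ P.S.claws P.F.f n k) (p0 : x₀ ∈ P.F.part false n)
    (p1 : x₁ ∈ P.F.part true n) {y : P.S.Ran n} (h0 : y ∈ (P.F.fHat n k false x₀).support)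
    (h1 : y ∈ (P.F.fHat n k true x₁).support) {d : Str (P.F.w.len n)}
    (hd : d ∈ P.F.hcSet n k false x₀ ∩ P.F.hcSet n k true x₁) :
    P.EqAccepts n k t ⟨y, d, dot d (xorStr (P.S.applyJ P.F.J (P.F.w.len n) x₀)
        (P.S.applyJ P.F.J (P.F.w.len n) x₁))⟩ := by
  have hk := P.F.good_key n _ hg
  have hy := P.F.fHat_range n k hk false x₀ hc.1 y h0
  have i0 := P.F.inv_fHat n k t hg false x₀ hc.1 y h0
  have i1 := P.F.inv_fHat n k t hg true x₁ hc.2.1 y h1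
  simp only [EqAccepts, i0, i1]
  exact ⟨hy, (P.F.chk_spec n k hk false x₀ hc.1 y hy).2 h0,
    (P.F.chk_spec n k hk true x₁ hc.2.1 y hy).2 h1, hc, p0, p1, hd, trivial⟩

/-- Only the accepting outcomes (y, d, e) that come from claws with both ends in the support are
counted. For fixed y at most one x in `D` contributes, because inversion determines it, so no
outcome is counted twice. -/
lemma measureProb_eqState_ge (hJ : ∀ x ∈ P.S.X.set n, readStr (Ji.run n
      (List.ofFn (P.S.applyJ P.F.J (P.F.w.len n) x))) 0 (P.S.domLen.len n) = x)
    (hg : (k, t) ∈ P.F.good n) {D : Finset (P.S.Dom n)} {π : P.S.Dom n → P.S.Dom n}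
    (hc : ∀ x ∈ D, (x, π x) ∈ P.S.claws P.F.f n k) (p0 : ∀ x ∈ D, x ∈ P.F.part false n)
    (p1 : ∀ x ∈ D, π x ∈ P.F.part true n) :
    ∑ x ∈ D, (∑ y, Real.sqrt ((P.F.fHat n k false x y).toReal *
      (P.F.fHat n k true (π x) y).toReal)) / (P.S.X.set n).card *
        avg (fun d => ind (d ∈ P.F.hcSet n k false x ∩ P.F.hcSet n k true (π x))) ≤
      measureProb (P.eqState Ji k) fun s => P.EqAccepts n k t (P.readAnswer n s) := by
  set N : ℝ := ((P.S.X.set n).card : ℝ)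
  set T : P.S.Dom n → P.S.Ran n → ℝ := fun x y =>
    Real.sqrt ((P.F.fHat n k false x y).toReal * (P.F.fHat n k true (π x) y).toReal) with hT
  set m := P.F.w.len n
  set G : P.S.Dom n → Str m → Prop :=
    fun x d => d ∈ P.F.hcSet n k false x ∩ P.F.hcSet n k true (π x)
  let W : P.S.Ran n × Str m × Bool → Wires := fun i => P.answerState k ⟨i.1, i.2.1, i.2.2⟩
  have hW : Function.Injective W := by
    rintro ⟨y, d, e⟩ ⟨y', d', e'⟩ h
    have := congrArg (P.readAnswer n) h
    simp only [W, readAnswer_answerState, Answer.mk.injEq] at this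
    simp [this]
  refine le_trans ?_ (sum_le_measureProb hW (P.eqState Ji k) _)
  simp only [Fintype.sum_prod_type, W, readAnswer_answerState]
  have hl : ∀ x, (∑ y, T x y) / N * avg (fun d => ind (G x d)) =
      ∑ y, ∑ d, T x y / N * (1 / 2 ^ m) * ind (G x d) := by
    intro x
    rw [avg, Finset.sum_div, Finset.sum_div, Finset.sum_mul_sum]
    refine Finset.sum_congr rfl fun y _ => Finset.sum_congr rfl fun d _ => ?_
    ring
  rw [Finset.sum_congr rfl fun x _ => hl x, Finset.sum_comm]
  refine Finset.sum_le_sum fun y _ => ?_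
  rw [Finset.sum_comm]
  refine Finset.sum_le_sum fun d _ => ?_
  have hnn : ∀ e, 0 ≤ ind (P.EqAccepts n k t ⟨y, d, e⟩) * ‖(P.eqState Ji k) (P.answerState k ⟨y, d, e⟩)‖ ^ 2 :=
    fun e => mul_nonneg (ind_nonneg _) (by positivity)
  by_cases hx : ∃ x ∈ D, T x y / N * (1 / 2 ^ m) * ind (G x d) ≠ 0
  · obtain ⟨x, hx, h⟩ := hx
    have hT0 : ∀ x, T x y ≠ 0 → y ∈ (P.F.fHat n k false x).support ∧
        y ∈ (P.F.fHat n k true (π x)).support := by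
      intro x h
      rw [PMF.mem_support_iff, PMF.mem_support_iff]
      constructor <;> intro h0 <;> simp [hT, h0] at h
    have hTx : ∀ x, T x y / N * (1 / 2 ^ m) * ind (G x d) ≠ 0 → T x y ≠ 0 := by
      intro x h h0
      simp [h0] at h
    obtain ⟨h0, h1⟩ := hT0 x (hTx x h)
    have hd : G x d := by
      by_contra hd
      simp [ind_false hd] at h
    rw [Finset.sum_eq_single x]
    · have hn := P.norm_eqState_ge Ji hJ hg (hc x hx) h0 h1 d
      have ha := P.eqAccepts_of_claw hg (hc x hx) (p0 x hx) (p1 x hx) h0 h1 hd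
      generalize dot d (xorStr (P.S.applyJ P.F.J (P.F.w.len n) x)
        (P.S.applyJ P.F.J (P.F.w.len n) (π x))) = e at hn ha
      have hs := Finset.single_le_sum (fun e _ => hnn e) (Finset.mem_univ e)
      rw [ind_true ha, one_mul] at hs
      rw [ind_true hd, mul_one]
      exact hn.trans hs
    -- A second contributing point would also have y in its support on branch 0, and inversion would
    -- identify the two.
    · intro x' hx' hne
      by_contra h'
      exact hne (P.fHat_eq_of_mem hg (hc x' hx').1 (hc x hx).1 (hT0 x' (hTx x' h')).1 h0)
    · intro h; exact absurd hx h
  · push Not at hx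
    rw [Finset.sum_eq_zero hx]
    exact Finset.sum_nonneg fun e _ => hnn e

/-- Each x₀ in X₀ ∩ X₁ has weight 1/|X|. It loses a Hellinger term at each end of its claw, 2ε on
average for either end, and 2δ for the strings d outside one of the two hardcore sets. -/
lemma eqState_accept (hJ : ∀ x ∈ P.S.X.set n, readStr (Ji.run n
      (List.ofFn (P.S.applyJ P.F.J (P.F.w.len n) x))) 0 (P.S.domLen.len n) = x)
    (hg : (k, t) ∈ P.F.good n) (hn : P.F.threshold < n) {ε δ : ℝ}
    (hε : ∀ b, (∑ x ∈ P.S.X.set n, hellingerSq (P.F.f n k b x) (P.F.fHat n k b x)) /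
      (P.S.X.set n).card ≤ ε)
    (hδ : ∀ b, ∀ x ∈ P.S.X.set n, avg (fun d => ind (d ∉ P.F.hcSet n k b x)) ≤ δ) :
    P.F.c - 4 * ε - 2 * δ ≤
      measureProb (P.eqState Ji k) fun s => P.EqAccepts n k t (P.readAnswer n s) := by
  classical
  set D := P.F.part false n ∩ P.F.part true n with hD
  have hpart : ∀ x ∈ D, ∃ x', (x, x') ∈ P.S.claws P.F.f n k := fun x hx =>
    (P.F.partner_of_zero n k t hg x (Finset.mem_inter.1 hx).1).exists
  choose! π hπ using hpart
  have hp1 : ∀ x ∈ D, π x ∈ P.F.part true n := fun x hx =>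
    P.F.overlap_zero n hn k t hg x (π x) (hπ x hx) hx
  -- Partners are unique from the other side too. Thus the errors at the partners, summed over `D`,
  -- are a sum over distinct points of X, and the average bound for branch 1 applies.
  have hinj : Set.InjOn π D := by
    intro x hx x' hx' h
    refine (P.F.partner_of_one n k t hg _ (hp1 x hx)).unique (hπ x hx) ?_
    rw [h]
    exact hπ x' hx'
  refine le_trans ?_ (P.measureProb_eqState_ge Ji hJ hg hπ
    (fun x hx => (Finset.mem_inter.1 hx).1) hp1)
  set X := P.S.X.set n with hX
  have hNpos : (0 : ℝ) < X.card := Nat.cast_pos.2 (P.S.X_nonempty n).card_pos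
  set N : ℝ := (X.card : ℝ)
  have hDX : D ⊆ X := fun x hx => P.F.part_subset false n (Finset.mem_inter.1 hx).1
  set p : Bool → P.S.Dom n → PMF (P.S.Ran n) := P.F.fHat n k
  set f := P.F.f n k
  have havg : ∀ x ∈ D, 1 - 2 * δ ≤
      avg (fun d => ind (d ∈ P.F.hcSet n k false x ∩ P.F.hcSet n k true (π x))) := by
    intro x hx
    have h1 := hδ false x (hDX hx)
    have h2 := hδ true (π x) (hπ x hx).2.1
    have h3 : avg (fun _ : Str (P.F.w.len n) => (1 : ℝ)) ≤ avg (fun d =>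
        ind (d ∈ P.F.hcSet n k false x ∩ P.F.hcSet n k true (π x)) +
          (ind (d ∉ P.F.hcSet n k false x) + ind (d ∉ P.F.hcSet n k true (π x)))) := by
      refine avg_mono fun d => ?_
      by_cases a : d ∈ P.F.hcSet n k false x
      · by_cases b : d ∈ P.F.hcSet n k true (π x)
        · rw [ind_true ⟨a, b⟩]
          linarith [ind_nonneg (d ∉ P.F.hcSet n k false x), ind_nonneg (d ∉ P.F.hcSet n k true (π x))]
        · rw [ind_true b]
          linarith [ind_nonneg (d ∉ P.F.hcSet n k false x),
            ind_nonneg (d ∈ P.F.hcSet n k false x ∩ P.F.hcSet n k true (π x))]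
      · rw [ind_true a]
        linarith [ind_nonneg (d ∉ P.F.hcSet n k true (π x)),
          ind_nonneg (d ∈ P.F.hcSet n k false x ∩ P.F.hcSet n k true (π x))]
    rw [avg_const, avg_add, avg_add] at h3
    linarith
  have hbc : ∀ x, ∑ y, Real.sqrt ((p false x y).toReal * (p true (π x) y).toReal) =
      1 - hellingerSq (p false x) (p true (π x)) := fun x => by rw [hellingerSq]; ring
  simp only [hbc]
  have hδ0 : 0 ≤ δ := by
    obtain ⟨x, hx⟩ := P.S.X_nonempty n
    refine le_trans ?_ (hδ false x hx)
    have := avg_mono (m := P.F.w.len n) (φ := fun _ => 0)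
      (ψ := fun d => ind (d ∉ P.F.hcSet n k false x)) (fun d => ind_nonneg _)
    rwa [avg_const] at this
  -- With h the squared Hellinger distance of the two sampled distributions, (1 - h)(1 - 2δ) ≥ 1 - h
  -- - 2δ. The triangle inequality through the common value f(x₀) = f(x₁) bounds h.
  have hterm : ∀ x ∈ D, 1 / N - 2 * (hellingerSq (f false x) (p false x) / N) -
      2 * (hellingerSq (f true (π x)) (p true (π x)) / N) - 2 * δ * (1 / N) ≤
      (1 - hellingerSq (p false x) (p true (π x))) / N *
        avg (fun d => ind (d ∈ P.F.hcSet n k false x ∩ P.F.hcSet n k true (π x))) := by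
    intro x hx
    have h1 := hellingerSq_le (p false x) (p true (π x)) (f false x)
    have h2 : f false x = f true (π x) := (hπ x hx).2.2
    have h3 := hellingerSq_nonneg (p false x) (p true (π x))
    have h4 : 0 ≤ 1 - hellingerSq (p false x) (p true (π x)) := by
      rw [← hbc]; exact Finset.sum_nonneg fun y _ => Real.sqrt_nonneg _
    have h5 := mul_le_mul_of_nonneg_left (havg x hx) (div_nonneg h4 hNpos.le)
    refine le_trans ?_ h5
    have h6 : hellingerSq (f false x) (p true (π x)) =
        hellingerSq (f true (π x)) (p true (π x)) := by rw [h2]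
    rw [h6] at h1
    have e : (1 - hellingerSq (p false x) (p true (π x))) / N * (1 - 2 * δ) -
      (1 / N - 2 * (hellingerSq (f false x) (p false x) / N) -
      2 * (hellingerSq (f true (π x)) (p true (π x)) / N) - 2 * δ * (1 / N)) =
      (2 * hellingerSq (f false x) (p false x) + 2 * hellingerSq (f true (π x)) (p true (π x)) -
        hellingerSq (p false x) (p true (π x)) +
        2 * δ * hellingerSq (p false x) (p true (π x))) / N := by ring
    have : 0 ≤ (2 * hellingerSq (f false x) (p false x) +
        2 * hellingerSq (f true (π x)) (p true (π x)) -
        hellingerSq (p false x) (p true (π x)) +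
        2 * δ * hellingerSq (p false x) (p true (π x))) / N :=
      div_nonneg (by have := mul_nonneg hδ0 h3; linarith) hNpos.le
    linarith
  refine le_trans ?_ (Finset.sum_le_sum hterm)
  simp only [Finset.sum_sub_distrib, ← Finset.mul_sum, ← Finset.sum_div]
  have hs0 : (∑ x ∈ D, hellingerSq (f false x) (p false x)) / N ≤ ε :=
    (div_le_div_of_nonneg_right (Finset.sum_le_sum_of_subset_of_nonneg hDX
      fun x _ _ => hellingerSq_nonneg _ _) hNpos.le).trans (hε false)
  have hs1 : (∑ x ∈ D, hellingerSq (f true (π x)) (p true (π x))) / N ≤ ε := by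
    refine le_trans (div_le_div_of_nonneg_right ?_ hNpos.le) (hε true)
    rw [← Finset.sum_image (f := fun x => hellingerSq (f true x) (p true x)) hinj]
    refine Finset.sum_le_sum_of_subset_of_nonneg ?_ fun x _ _ => hellingerSq_nonneg _ _
    intro x' hx'
    obtain ⟨x, hx, rfl⟩ := Finset.mem_image.1 hx'
    exact (hπ x hx).2.1
  have hcard : (∑ _x ∈ D, (1 : ℝ)) / N = D.card / N := by simp
  have hov : P.F.c ≤ D.card / N := by
    have := P.F.overlap n hn
    convert this using 3
  have hle : (D.card : ℝ) / N ≤ 1 := by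
    rw [div_le_one hNpos]
    exact Nat.cast_le.2 (Finset.card_le_card hDX)
  rw [hcard]
  -- The fraction |D|/|X| is at least c for the main term and at most 1 for the term with 2δ.
  nlinarith

end E3NTCF

/-! ### Completeness -/

namespace E3NTCF

variable (P : E3NTCF) {Ji : Alg}

/-- `Ji` inverts `J` on the range. -/
def Inverts (Ji : Alg) : Prop := ∀ n, ∀ x ∈ P.S.X.set n, readStr (Ji.run n
  (List.ofFn (P.S.applyJ P.F.J (P.F.w.len n) x))) 0 (P.S.domLen.len n) = x

/-- The ideal state satisfies `E` with certainty, so only the preparation error can violate it. Both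
image tests have this form. -/
lemma prover_image (hJ : P.Inverts Ji) {n : ℕ} {k : P.S.Key n}
    {p : Bool → P.S.Dom n → PMF (P.S.Ran n)} {ε : ℝ}
    (h : ∀ b, sqNorm (P.S.samp.run n (List.ofFn k ++ [b]) - P.S.target n k b (p b)) ≤ ε)
    {E : P.S.Ran n → Prop} (hE : ∀ b, ∀ x ∈ P.S.X.set n, ∀ y ∈ (p b x).support, E y) :
    1 - 2 * ε ≤ measureProb ((prover P.S P.F.w P.F.J Ji).run n (List.ofFn k))
      fun s => E (P.readAnswer n s).y := by
  have h1 := sqNorm_prover_sub P.S P.F.w P.F.J Ji k h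
  have h2 := measureProb_ge_of_support (φ := (prover P.S P.F.w P.F.J Ji).run n (List.ofFn k))
    (idealState_support P.S P.F.w P.F.J Ji k (hJ n) hE)
  rw [sqNorm_prover_run] at h2
  have h3 : 1 - 2 * ε ≤ 1 - sqNorm ((prover P.S P.F.w P.F.J Ji).run n (List.ofFn k) -
      idealState P.S P.F.w P.F.J Ji k p) := by linarith
  exact h3.trans h2

lemma prover_weak_image (hJ : P.Inverts Ji) : ∃ ν, Negl ν ∧ ∀ n, 1 - ν n ≤
    P.H.gen.mean n fun k t => measureProb ((prover P.S P.F.w P.F.J Ji).run n (List.ofFn k))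
      fun s => P.WImAccepts n k t (P.readAnswer n s) := by
  obtain ⟨ν, hν, h⟩ := P.H.samp_spec
  refine ⟨_, hν.const_mul 2, fun n => ?_⟩
  rw [← P.H.gen.mean_const n (1 - 2 * ν n)]
  refine P.H.gen.mean_mono fun r => ?_
  have hk := P.H.gen_key n r
  refine P.prover_image hJ (h n _ hk) (E := fun y => y ∈ P.S.Y.set n ∧
    P.weakExtract.imChk.bit n (List.ofFn (P.H.gen.trap n r) ++ List.ofFn y) = true)
    fun b x hx y hy => ⟨?_, ?_⟩
  · exact P.H.h_range n _ hk _ (P.S.bit_mem n b) x (P.S.X_subset n hx) y hy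
  · exact P.weakExtract.imChk_image n r _ (P.S.bit_mem n b) x (P.S.X_subset n hx) y hy

lemma prover_strong_image (hJ : P.Inverts Ji) : ∃ ν, Negl ν ∧ ∀ n, 1 - ν n ≤
    P.G.gen.mean n fun k t => measureProb ((prover P.S P.F.w P.F.J Ji).run n (List.ofFn k))
      fun s => P.SImAccepts n k t (P.readAnswer n s) := by
  obtain ⟨ν, hν, h⟩ := P.G.samp_spec
  -- With the absolute value the claimed bound never exceeds 1, so on bad keys the indicator alone
  -- covers it.
  refine ⟨_, (hν.abs.const_mul 2).add P.G.good_negl, fun n => ?_⟩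
  suffices 1 - 2 * |ν n| ≤ P.G.gen.mean n fun k t =>
      measureProb ((prover P.S P.F.w P.F.J Ji).run n (List.ofFn k))
        (fun s => P.SImAccepts n k t (P.readAnswer n s)) + ind ((k, t) ∉ P.G.good n) by
    rw [KeyGen.mean_add] at this
    linarith
  rw [← P.G.gen.mean_const n (1 - 2 * |ν n|)]
  refine P.G.gen.mean_mono fun r => ?_
  have hk := P.G.gen_key n r
  by_cases hg : (P.G.gen.key n r, P.G.gen.trap n r) ∈ P.G.good n
  · rw [ind_false (not_not.2 hg), add_zero]
    have := P.prover_image hJ (h n _ hk) (E := fun y => y ∈ P.S.Y.set n ∧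
      P.S.check n (P.G.gen.key n r) y
        (bitStr (P.G.inv.run n (List.ofFn (P.G.gen.trap n r) ++ List.ofFn y) 0))
        (readStr (P.G.inv.run n (List.ofFn (P.G.gen.trap n r) ++ List.ofFn y)) 1 _) = true)
      fun b x hx y hy => ?_
    · refine le_trans ?_ this
      linarith [le_abs_self (ν n)]
    · have hY := P.G.g_range n _ hk _ (P.S.bit_mem n b) x (P.S.X_subset n hx) y hy
      obtain ⟨h1, h2⟩ := P.G.inv_g n _ _ hg b x hx y hy
      rw [h1, h2]
      exact ⟨hY, (P.G.chk_spec n _ hk _ (P.S.bit_mem n b) x (P.S.X_subset n hx) y hY).2 hy⟩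
  · rw [ind_true hg]
    have := measureProb_nonneg ((prover P.S P.F.w P.F.J Ji).run n (List.ofFn (P.G.gen.key n r)))
      fun s => P.SImAccepts n (P.G.gen.key n r) (P.G.gen.trap n r) (P.readAnswer n s)
    linarith [abs_nonneg (ν n)]

lemma prover_equation (hJ : P.Inverts Ji) : ∃ ν, Negl ν ∧ ∀ n, P.F.c - ν n ≤
    P.F.gen.mean n fun k t => measureProb ((prover P.S P.F.w P.F.J Ji).run n (List.ofFn k))
      fun s => P.EqAccepts n k t (P.readAnswer n s) := by
  obtain ⟨ν, hν, h⟩ := P.F.samp_spec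
  obtain ⟨ε, hε, hhel⟩ := P.F.hellinger
  obtain ⟨δ, hδ, hdense⟩ := P.F.hcSet_dense
  have hthr : Negl fun n => ind (n ≤ P.F.threshold) :=
    negl_of_eventually_zero (N := P.F.threshold) fun n hn => ind_false (by omega)
  -- The errors in order: parameters below the threshold, where nothing is promised and c ≤ 1 makes
  -- the bound trivial; the Hellinger distance; the hardcore sets; and the state preparation, whose
  -- squared error 2ν enters through `measureProb_le_of_close`.
  set err : ℕ → ℝ := fun n => ind (n ≤ P.F.threshold) + (4 * |ε n| + (2 * |δ n| +
    (2 * Real.sqrt |2 * ν n| + |2 * ν n|))) with herr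
  have hN : Negl err := hthr.add ((hε.abs.const_mul 4).add ((hδ.abs.const_mul 2).add
    (((hν.const_mul 2).sqrt.const_mul 2).add (hν.const_mul 2).abs)))
  refine ⟨_, hN.add P.F.good_negl, fun n => ?_⟩
  suffices P.F.c - err n ≤ P.F.gen.mean n fun k t =>
      measureProb ((prover P.S P.F.w P.F.J Ji).run n (List.ofFn k))
        (fun s => P.EqAccepts n k t (P.readAnswer n s)) + ind ((k, t) ∉ P.F.good n) by
    rw [KeyGen.mean_add] at this
    linarith
  rw [← P.F.gen.mean_const n (P.F.c - err n)]
  refine P.F.gen.mean_mono fun r => ?_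
  have hk := P.F.gen_key n r
  set k := P.F.gen.key n r
  set t := P.F.gen.trap n r
  set φ := (prover P.S P.F.w P.F.J Ji).run n (List.ofFn k) with hφ
  have h0 := measureProb_nonneg φ fun s => P.EqAccepts n k t (P.readAnswer n s)
  have hc := P.F.c_le_one
  have e1 := ind_nonneg (n ≤ P.F.threshold)
  have e2 := abs_nonneg (ε n)
  have e3 := abs_nonneg (δ n)
  have e4 := Real.sqrt_nonneg |2 * ν n|
  have e5 := abs_nonneg (2 * ν n)
  have hE : err n = ind (n ≤ P.F.threshold) + (4 * |ε n| + (2 * |δ n| +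
    (2 * Real.sqrt |2 * ν n| + |2 * ν n|))) := rfl
  rw [hE]
  by_cases hg : (k, t) ∈ P.F.good n
  · rw [ind_false (not_not.2 hg), add_zero]
    by_cases hn : n ≤ P.F.threshold
    · rw [ind_true hn]
      linarith
    · have h1 := P.eqState_accept Ji (hJ n) hg (not_le.1 hn) (hhel n k hk) (hdense n k hk)
      have h2 := measureProb_le_of_close (φ := φ) (ψ := P.eqState Ji k)
        (sqNorm_prover_run P.S P.F.w P.F.J Ji k)
        (fun s => P.EqAccepts n k t (P.readAnswer n s))
      have h3 : sqNorm (φ - P.eqState Ji k) ≤ |2 * ν n| :=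
        (sqNorm_prover_sub P.S P.F.w P.F.J Ji k (h n k hk)).trans (le_abs_self _)
      have h4 := Real.sqrt_le_sqrt h3
      linarith [le_abs_self (ε n), le_abs_self (δ n)]
  · rw [ind_true hg]
    linarith

/-- The equation test contributes c and the image tests contribute 1 each, with weight 1/3, up to
negligible errors. -/
theorem completeness : ∃ Q : QPT, ∃ ν, Negl ν ∧
    ∀ n, (2 + P.F.c) / 3 - ν n ≤ P.quantumSuccess Q n := by
  obtain ⟨Ji, hJ⟩ : ∃ Ji, P.Inverts Ji := P.F.J_inv
  obtain ⟨ν₁, n₁, h₁⟩ := P.prover_equation hJ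
  obtain ⟨ν₂, n₂, h₂⟩ := P.prover_weak_image hJ
  obtain ⟨ν₃, n₃, h₃⟩ := P.prover_strong_image hJ
  refine ⟨prover P.S P.F.w P.F.J Ji, _, ((n₁.add n₂).add n₃).const_mul (1 / 3), fun n => ?_⟩
  rw [quantumSuccess, success]
  linarith [h₁ n, h₂ n, h₃ n]

end E3NTCF

end PoQ

theorem mainTheorem1 (P : PoQ.E3NTCF) :
    (∃ Q : PoQ.QPT, ∃ ν : ℕ → ℝ, PoQ.Negl ν ∧
      ∀ n, (2 + P.F.c) / 3 - ν n ≤ P.quantumSuccess Q n) ∧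
    (∀ A : PoQ.PPT, ∃ ν : ℕ → ℝ, PoQ.Negl ν ∧
      ∀ n, P.classicalSuccess A n ≤ 5 / 6 + ν n) := by
  exact ⟨P.completeness, P.soundness⟩
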